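/- **Setting.** Let $G$ be a finite set of register values with an initial value $g_{init}\in G$. Let $\Sigma_D=\{r(g),w(g):g\in G\}$ be the leader's actions and $\Sigma_C=\{\bar r(g),\bar w(g):g\in G\}$ the contributors' actions. A $(\mathcal C,\mathcal D)$-system over $G$ consists of a (possibly infinite) transition system $\mathcal C=\langle S,\delta\subseteq S\times\Sigma_C\times S,s_{init}\rangle$ (the contributor) and a (possibly infinite) transition system $\mathcal D=\langle T,\Delta\subseteq T\times\Sigma_D\times T,t_{init}\rangle$ (the leader). A configuration $(M,t,g)$ consists of a finite multiset $M$ of contributor states, a leader state $t$ and a register value $g$. In one step either the leader or a single contributor takes a transition; a write of $h$ sets the register to $h$, and a read of $h$ is possible only if the register contains $h$. A run is a finite or infinite sequence of consecutive steps; it is initial if it starts in $(n[s_{init}],t_{init},g_{init})$ for some $n\ge 0$, and maximal if it is initial and cannot be prolonged (every infinite initial run is maximal). A maximal trace is the sequence of actions of a maximal run. For an alphabet $\Sigma$, $\Sigma^\infty$ is the set of finite and infinite words over $\Sigma$. A property $P\subseteq(\Sigma_C\cup\Sigma_D)^\infty$ is $\mathcal C$-expanding if it is closed under replacing each occurrence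 of a contributor action $a$ by a positive number of copies of $a$ (the number may depend on the occurrence). Automata have a finite set of states, an initial state, and two sets $F,R$ of states; a finite word is accepted if some run on it ends in $F$, an infinite word if some run on it visits $R$ infinitely often. LTL formulas have letters as atoms and are built with $\top,\neg,\wedge$, next and until; on finite words, next and until refer to existing positions. The size of an automaton is the number of its states and transitions plus $|F|+|R|$; the size of a formula is its number of symbols. A pushdown system has a finite set $Q$ of states, a finite stack alphabet $\Gamma$, an initial state, an initial stack symbol, and a finite set of transitions $(q,A,a,q',w)$ with $a$ in the action alphabet and $w\in\Gamma^*$, which give the steps $(q,A\beta)\xrightarrow{a}(q',w\beta)$ of its transition system with state set $Q\times\Gamma^*$. Its size is $|Q|\cdot|\Gamma|\cdot 2|G|+\sum_{(q,A,a,q',w)}(1+|w|)$. **Theorem.** There is an absolute constant $c$ such that the following holds, where for each $G$ there is a set $\tilde G$ of at most $c|G|$ register values that depends only on, and is computable from, $|G|$, and $\tilde\Sigma_D=\{r(g),w(g):g\in\tilde G\}$. For every $(\mathcal C,\mathcal D)$-system over $G$ there is a $(\tilde{\mathcal C},\tilde{\mathcal D})$-system over $\tilde G$ such that for every $\mathcal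 C$-expanding property $P\subseteq(\Sigma_C\cup\Sigma_D)^\infty$ there is a property $\tilde P\subseteq\tilde\Sigma_D^\infty$ with: 1. the $(\mathcal C,\mathcal D)$-system has a finite (resp. infinite) maximal trace in $P$ if and only if the $(\tilde{\mathcal C},\tilde{\mathcal D})$-system has a finite (resp. infinite) maximal trace whose projection on $\tilde\Sigma_D$ is in $\tilde P$; 2. every infinite run of the $(\tilde{\mathcal C},\tilde{\mathcal D})$-system contains infinitely many writes of $\tilde{\mathcal D}$; 3. the $(\tilde{\mathcal C},\tilde{\mathcal D})$-system has an infinite initial run if and only if the $(\mathcal C,\mathcal D)$-system has one. If $P$ is accepted by an automaton (resp. defined by an LTL formula), then so is $\tilde P$: an automaton (resp. formula) for $\tilde P$ can be computed from one for $P$, its size is at most $c|G|$ times the size of the given one, and, for automata, its number of states is at most $c$ times that of the given one. If $\mathcal C$ and $\mathcal D$ are the transition systems of pushdown systems $\mathcal A_C$ and $\mathcal A_D$, then $\tilde{\mathcal C}$ and $\tilde{\mathcal D}$ can be chosen to be the transition systems of pushdown systems $\tilde{\mathcal A}_C$ and $\tilde{\mathcal A}_D$ that, together with the initial register value, are computable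 from $\mathcal A_C$, $\mathcal A_D$ and $g_{init}$, and whose sizes are linear for fixed $G$: for $X\in\{C,D\}$, $\tilde{\mathcal A}_X$ has at most $c|G|$ times as many states, at most $c$ times as many stack symbols, and at most $c|G|$ times the size of $\mathcal A_X$. -/

import Mathlib

universe u v

namespace ParamSys

/-! ### Finite and infinite words -/

/-- An element of `α^∞`: a finite or an infinite word. -/
inductive Word (α : Type) : Type where
  | fin (l : List α) : Word α
  | inf (s : ℕ → α) : Word α

namespace Word

variable {α β : Type}

def IsFinite : Word α → Prop
  | fin _ => True
  | inf _ => False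

def IsInfinite : Word α → Prop
  | fin _ => False
  | inf _ => True

/-- The letter at position `i`, if there is one. -/
def get? : Word α → ℕ → Option α
  | fin l, i => l[i]?
  | inf s, i => some (s i)

/-- `u.HasProj π v`: the word `v` is obtained from `u` by erasing the letters that `π` sends to
`none` and replacing every other letter by its image. The projection of an infinite word is
infinite or finite according to whether infinitely or finitely many letters are kept. -/
def HasProj (π : α → Option β) : Word α → Word β → Prop
  | fin l, fin l' => l' = l.filterMap π
  | fin _, inf _ => False
  | inf s, fin l' => ∃ N : ℕ, (∀ i, N ≤ i → π (s i) = none) ∧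
      l' = ((List.range N).map s).filterMap π
  | inf s, inf s' => ∃ e : ℕ → ℕ, StrictMono e ∧ (∀ n, π (s (e n)) = some (s' n)) ∧
      ∀ i, i ∉ Set.range e → π (s i) = none

/-- `IsExpansion p u v`: the word `v` is obtained from `u` by replacing each occurrence of a
letter `a` satisfying `p` by some positive number of copies of `a` (the number may depend on the
occurrence; `m i` is the number for position `i`), all other letters being kept as they are. -/
def IsExpansion (p : α → Prop) : Word α → Word α → Prop
  | fin l, fin l' => ∃ m : ℕ → ℕ, (∀ i, 0 < m i) ∧
      (∀ i a, l[i]? = some a → ¬ p a → m i = 1) ∧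
      l' = l.zipIdx.flatMap fun x => List.replicate (m x.2) x.1
  | inf s, inf s' => ∃ m : ℕ → ℕ, (∀ i, 0 < m i) ∧ (∀ i, ¬ p (s i) → m i = 1) ∧
      ∀ i r, r < m i → s' ((∑ j ∈ Finset.range i, m j) + r) = s i
  | _, _ => False

end Word

/-! ### Actions -/

/-- The read and write operations on a register with values in `G`. This is the action alphabet
of the leader, and a disjoint copy of it is that of the contributors. -/
inductive Op (G : Type) : Type where
  | read (g : G) : Op G
  | write (g : G) : Op G

/-- The disjoint union of the alphabets of the leader and of the contributors. -/
inductive Act (G : Type) : Type where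
  | leader (o : Op G) : Act G
  | contrib (o : Op G) : Act G

/-- The projection on the leader alphabet. -/
def Act.leader? {G : Type} : Act G → Option (Op G)
  | .leader o => some o
  | .contrib _ => none

def Act.IsContrib {G : Type} : Act G → Prop
  | .leader _ => False
  | .contrib _ => True

/-- A property is expanding if it is closed under replication of contributor actions. -/
def IsExpanding {G : Type} (P : Set (Word (Act G))) : Prop :=
  ∀ u v, u ∈ P → Word.IsExpansion Act.IsContrib u v → v ∈ P

/-! ### Systems with one leader and arbitrarily many contributors -/

/-- A transition system with set of states `S` over the alphabet `α`. -/
structure TransitionSystem (S : Type*) (α : Type) where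
  step : S → α → S → Prop
  init : S

/-- A contributor process `C`, a leader process `D`, and a register with values in `G`. -/
structure System (G : Type) (S T : Type*) where
  C : TransitionSystem S (Op G)
  D : TransitionSystem T (Op G)
  ginit : G

/-- A configuration: the (finite) multiset of contributor states, the state of the leader and the
value of the register. -/
structure Config (G : Type) (S T : Type*) where
  contributors : Multiset S
  leader : T
  register : G

namespace System

variable {G : Type} {S T : Type*} (sys : System G S T)

/-- The transitions. In the last two, one contributor moves from `s` to `s'`. -/
inductive Step : Config G S T → Act G → Config G S T → Prop
  | leaderWrite (M : Multiset S) (t t' : T) (g h : G) : sys.D.step t (.write h) t' →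
      Step ⟨M, t, g⟩ (.leader (.write h)) ⟨M, t', h⟩
  | leaderRead (M : Multiset S) (t t' : T) (g : G) : sys.D.step t (.read g) t' →
      Step ⟨M, t, g⟩ (.leader (.read g)) ⟨M, t', g⟩
  | contribWrite (M : Multiset S) (s s' : S) (t : T) (g h : G) : sys.C.step s (.write h) s' →
      Step ⟨s ::ₘ M, t, g⟩ (.contrib (.write h)) ⟨s' ::ₘ M, t, h⟩
  | contribRead (M : Multiset S) (s s' : S) (t : T) (g : G) : sys.C.step s (.read g) s' →
      Step ⟨s ::ₘ M, t, g⟩ (.contrib (.read g)) ⟨s' ::ₘ M, t, g⟩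

/-- `sys.FinRun c l c'`: there is a finite run from `c` to `c'` labelled by `l`. -/
inductive FinRun : Config G S T → List (Act G) → Config G S T → Prop
  | nil (c : Config G S T) : FinRun c [] c
  | cons (c c' c'' : Config G S T) (a : Act G) (l : List (Act G)) :
      sys.Step c a c' → FinRun c' l c'' → FinRun c (a :: l) c''

/-- `sys.InfRun c a`: the configurations `c 0, c 1, …` and actions `a 0, a 1, …` form an infinite
run (from the arbitrary configuration `c 0`). -/
def InfRun (c : ℕ → Config G S T) (a : ℕ → Act G) : Prop :=
  ∀ i, sys.Step (c i) (a i) (c (i + 1))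

/-- The initial configuration with `n` contributors. -/
def initial (n : ℕ) : Config G S T :=
  ⟨Multiset.replicate n sys.C.init, sys.D.init, sys.ginit⟩

/-- The labels of maximal initial runs: of the finite ones that cannot be prolonged, and of the
infinite ones. -/
def IsMaximalTrace : Word (Act G) → Prop
  | .fin l => ∃ n c, sys.FinRun (sys.initial n) l c ∧ ¬ ∃ a c', sys.Step c a c'
  | .inf a => ∃ n c, c 0 = sys.initial n ∧ sys.InfRun c a

/-- The system has an infinite initial run, for some number of contributors. -/
def HasInfiniteRun : Prop :=
  ∃ n c a, c 0 = sys.initial n ∧ sys.InfRun c a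

end System

/-! ### Pushdown systems -/

/-- A transition `(q, A, a, q', w)`: from state `q` with top stack symbol `A`, perform `a`, go to
`q'` and replace `A` by the word `w` (whose first letter becomes the top of the stack). -/
structure PushdownTransition (n m : ℕ) (α : Type) where
  source : Fin n
  top : Fin m
  label : α
  target : Fin n
  push : List (Fin m)

/-- A pushdown system over the alphabet `α`. Its states are `0, …, numStates - 1` and its stack
symbols `0, …, numSymbols - 1`. As it has to define a transition system over `α`, all its
transitions are labelled by letters of `α`. -/
structure Pushdown (α : Type) where
  numStates : ℕ
  numSymbols : ℕ
  trans : List (PushdownTransition numStates numSymbols α)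
  init : Fin numStates
  initSymbol : Fin numSymbols

/-- The transition system of a pushdown system. A state consists of a state of the pushdown system
and a stack content. -/
def Pushdown.toTS {α : Type} (A : Pushdown α) :
    TransitionSystem (Fin A.numStates × List (Fin A.numSymbols)) α where
  step x a y := ∃ τ ∈ A.trans, τ.label = a ∧ ∃ β : List (Fin A.numSymbols),
    x = (τ.source, τ.top :: β) ∧ y = (τ.target, τ.push ++ β)
  init := (A.init, [A.initSymbol])

/-- The size of the transition table: one entry for each triple of a state, a stack symbol and one
of the `2 * k` letters, plus the total length of the transitions. -/
def Pushdown.size {k : ℕ} (A : Pushdown (Op (Fin k))) : ℕ :=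
  A.numStates * A.numSymbols * (2 * k) + (A.trans.map fun τ => 1 + τ.push.length).sum

/-- A system with register values `0, …, k - 1` in which both processes are pushdown systems. -/
structure PushdownSys (k : ℕ) where
  AC : Pushdown (Op (Fin k))
  AD : Pushdown (Op (Fin k))
  ginit : Fin k

def PushdownSys.toSystem {k : ℕ} (A : PushdownSys k) :
    System (Fin k) (Fin A.AC.numStates × List (Fin A.AC.numSymbols))
      (Fin A.AD.numStates × List (Fin A.AD.numSymbols)) where
  C := A.AC.toTS
  D := A.AD.toTS
  ginit := A.ginit

/-! ### Automata on finite and infinite words -/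

/-- An automaton with states `0, …, numStates - 1`, a set of states that are final for finite
words, and a set of states that have to be repeated infinitely often on infinite words. -/
structure BuchiAut (α : Type) where
  numStates : ℕ
  trans : List (Fin numStates × α × Fin numStates)
  init : Fin numStates
  final : List (Fin numStates)
  repeating : List (Fin numStates)

namespace BuchiAut

variable {α : Type} (B : BuchiAut α)

/-- There is a path from the first to the second state labelled by the list. -/
inductive Path : Fin B.numStates → List α → Fin B.numStates → Prop
  | nil (q : Fin B.numStates) : Path q [] q
  | cons (q q' q'' : Fin B.numStates) (a : α) (l : List α) :
      (q, a, q') ∈ B.trans → Path q' l q'' → Path q (a :: l) q''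

def Accepts : Word α → Prop
  | .fin l => ∃ q ∈ B.final, B.Path B.init l q
  | .inf s => ∃ ρ : ℕ → Fin B.numStates, ρ 0 = B.init ∧
      (∀ i, (ρ i, s i, ρ (i + 1)) ∈ B.trans) ∧ ∀ N, ∃ i, N ≤ i ∧ ρ i ∈ B.repeating

/-- The set of accepted finite and infinite words. -/
def language : Set (Word α) := {u | B.Accepts u}

def size : ℕ := B.numStates + B.trans.length + B.final.length + B.repeating.length

end BuchiAut

/-! ### Linear-time temporal logic on finite and infinite words -/

/-- LTL formulas whose atoms are letters. -/
inductive LTL (α : Type) : Type where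
  | tt : LTL α
  | atom (a : α) : LTL α
  | neg (φ : LTL α) : LTL α
  | conj (φ ψ : LTL α) : LTL α
  | next (φ : LTL α) : LTL α
  | until (φ ψ : LTL α) : LTL α

namespace LTL

variable {α : Type}

/-- Satisfaction at position `i` of a word; `next` and `until` refer to existing positions. -/
def Sat (w : Word α) : ℕ → LTL α → Prop
  | _, tt => True
  | i, atom a => w.get? i = some a
  | i, neg φ => ¬ Sat w i φ
  | i, conj φ ψ => Sat w i φ ∧ Sat w i ψ
  | i, next φ => (w.get? (i + 1)).isSome ∧ Sat w (i + 1) φ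
  | i, .until φ ψ => ∃ j, i ≤ j ∧ (w.get? j).isSome ∧ Sat w j ψ ∧
      ∀ l, i ≤ l → l < j → Sat w l φ

/-- The set of words defined by a formula. -/
def language (φ : LTL α) : Set (Word α) := {w | Sat w 0 φ}

def size : LTL α → ℕ
  | tt => 1
  | atom _ => 1
  | neg φ => φ.size + 1
  | conj φ ψ => φ.size + ψ.size + 1
  | next φ => φ.size + 1
  | .until φ ψ => φ.size + ψ.size + 1

end LTL

/-! ### Finite descriptions and effectiveness -/

def Op.code {k : ℕ} : Op (Fin k) → Bool × ℕ
  | .read g => (false, g.val)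
  | .write g => (true, g.val)

def Act.code {k : ℕ} : Act (Fin k) → Bool × Bool × ℕ
  | .leader o => (false, o.code)
  | .contrib o => (true, o.code)

abbrev PushdownCode : Type :=
  ℕ × ℕ × List (ℕ × ℕ × (Bool × ℕ) × ℕ × List ℕ) × ℕ × ℕ

def Pushdown.code {k : ℕ} (A : Pushdown (Op (Fin k))) : PushdownCode :=
  (A.numStates, A.numSymbols,
    A.trans.map (fun τ => (τ.source.val, τ.top.val, τ.label.code, τ.target.val,
      τ.push.map Fin.val)),
    A.init.val, A.initSymbol.val)

def PushdownSys.code {k : ℕ} (A : PushdownSys k) : PushdownCode × PushdownCode × ℕ :=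
  (A.AC.code, A.AD.code, A.ginit.val)

/-- The description of an automaton, given descriptions of the letters. -/
def BuchiAut.code {α β : Type} (f : α → β) (B : BuchiAut α) :
    ℕ × List (ℕ × β × ℕ) × ℕ × List ℕ × List ℕ :=
  (B.numStates, B.trans.map (fun τ => (τ.1.val, f τ.2.1, τ.2.2.val)), B.init.val,
    B.final.map Fin.val, B.repeating.map Fin.val)

/-- The description of a formula: prefix notation, with numbers for the operators. -/
def LTL.code {α β : Type} (f : α → β) : LTL α → List (ℕ ⊕ β)
  | .tt => [Sum.inl 0]
  | .atom a => [Sum.inr (f a)]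
  | .neg φ => Sum.inl 1 :: φ.code f
  | .conj φ ψ => Sum.inl 2 :: (φ.code f ++ ψ.code f)
  | .next φ => Sum.inl 3 :: φ.code f
  | .until φ ψ => Sum.inl 4 :: (φ.code f ++ ψ.code f)

/-- A family of maps `F k : X k → Y k` is effective if some computable function yields a
description of `F k x` from `k` and the description of `x`. -/
def IsEffective {X Y : ℕ → Type} {A B : Type} [Primcodable A] [Primcodable B]
    (codeX : ∀ k, X k → A) (codeY : ∀ k, Y k → B) (F : ∀ k, X k → Y k) : Prop :=
  ∃ f : ℕ × A → B, Computable f ∧ ∀ k x, f (k, codeX k x) = codeY k (F k x)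

/-! ### The transformation of systems -/

/-- The system `sys'` reduces properties of `sys` to properties of its leader: every expanding
property `P` has a counterpart `P'` over the leader actions of `sys'`, and the maps `autT`
and `ltlT` turn automata and formulas for `P` into automata and formulas for `P'`. -/
def Reduces {k k' : ℕ} {S T S' T' : Type*}
    (autT : BuchiAut (Act (Fin k)) → BuchiAut (Op (Fin k')))
    (ltlT : LTL (Act (Fin k)) → LTL (Op (Fin k')))
    (sys : System (Fin k) S T) (sys' : System (Fin k') S' T') : Prop :=
  (∀ P : Set (Word (Act (Fin k))), IsExpanding P →
    ∃ P' : Set (Word (Op (Fin k'))),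
      ((∃ u, u.IsFinite ∧ sys.IsMaximalTrace u ∧ u ∈ P) ↔
        ∃ u', u'.IsFinite ∧ sys'.IsMaximalTrace u' ∧ ∃ v ∈ P', u'.HasProj Act.leader? v) ∧
      ((∃ u, u.IsInfinite ∧ sys.IsMaximalTrace u ∧ u ∈ P) ↔
        ∃ u', u'.IsInfinite ∧ sys'.IsMaximalTrace u' ∧ ∃ v ∈ P', u'.HasProj Act.leader? v) ∧
      (∀ B : BuchiAut (Act (Fin k)), B.language = P → (autT B).language = P') ∧
      (∀ φ : LTL (Act (Fin k)), φ.language = P → (ltlT φ).language = P')) ∧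
  (∀ c a, sys'.InfRun c a → ∀ N, ∃ i, N ≤ i ∧ ∃ g, a i = .leader (.write g)) ∧
  (sys'.HasInfiniteRun ↔ sys.HasInfiniteRun)

/-- The size of `A'` is linear in that of `A`, the factor being at most `c * k` where `k` is the
number of register values of `A`. -/
def LinearlyBounded {k k' : ℕ} (c : ℕ) (A : Pushdown (Op (Fin k)))
    (A' : Pushdown (Op (Fin k'))) : Prop :=
  A'.numStates ≤ c * k * A.numStates ∧ A'.numSymbols ≤ c * A.numSymbols ∧
    A'.size ≤ c * k * A.size

end ParamSys

open ParamSys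

/-!
# Reducing properties of leader-contributor systems to properties of the leader

The new leader takes over the register of the original system and all control over it. The values
of the new register are messages (`Msg`). The leader announces each of its own steps by a message
`act`. A contributor which sees that the simulated register has a suitable value takes its
transition labelled by `o` at once, writes a request to perform `o`, and waits until the leader
grants it by another message `act`; then it reads the grant. So the sequence of the messages `act`,
the *log*, is determined by the writes of the leader.

Several contributors may have asked for the same operation `o`, and all those which wait may read
the same grant. This is a run of the original system in which the action is repeated once for
each further reader, immediately after the granted action, where the register still has the value
that `o` leaves. The granted step itself is attributed to some contributor which waits for it,
whether or not this contributor ever reads the grant. Hence the trace simulated by a run is an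
expansion of its log, which for an expanding property does no harm (`Simulates.step`,
`exists_simulation_of_finRun`, `exists_simulation_of_infRun`). In the other direction, each step of
a run of the original system is simulated by a block of steps with this step as its log
(`finRun_simulation`).

To recognize finite maximal runs, the leader may declare by the message `done g` that the run has
ended. It can leave the mode reached by this only to the mode `dead`, and it does so whenever it or
a contributor still can do something: contributors which wait return to requesting when they read
the declaration, so a run of the new system which is maximal and whose last leader action is the
declaration simulates a maximal run (`Simulates.deadlock`, `deadlock_protocol`). Infinitely many
writes of the leader are enforced since contributors cannot read requests, and reading and writing
alternate (`infinitely_many_leader_writes`).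

The new property (`counterpart`) says that the word ends with the declaration or has infinitely many
announcements, and that its log is in the old property. For automata this needs a flag in the states
(`BuchiAut.language_transform`). For formulas, `LTL.lift` skips the letters between announcements,
and is chosen such that every symbol of a code is replaced by a fixed word; both the linear size and
the effectiveness rely on this (`LTL.language_transform`).

For pushdown systems the product with the controls is again a pushdown system, once a marked
symbol at the bottom keeps the stack from becoming empty: communication goes on when the simulated
process is stuck (`Control.isBisimulation_pushdown`). All constructions are primitive recursive on
codes, which `fun_prop` proves from closure properties of primitive recursive functions.
-/

namespace ParamSys

/-! ### Messages and control of the protocol -/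

/-- The value of the register after the operation. -/
def Op.val {G : Type} : Op G → G
  | .read g => g
  | .write g => g

/-- The register values at which the operation is possible. -/
def Op.views {k : ℕ} : Op (Fin k) → List (Fin k)
  | .read g => [g]
  | .write _ => List.finRange k

/-- The contents of the new register. `act a` is written by the leader: it announces its own step
if `a` is a leader action, and grants a contributor step if `a` is a contributor action. `done g`
is the declaration of the leader that the simulated run has ended with register value `g`, and
`req o` is the request of a contributor to perform `o`. -/
inductive Msg (k : ℕ) : Type where
  | act (a : Act (Fin k)) : Msg k
  | done (g : Fin k) : Msg k
  | req (o : Op (Fin k)) : Msg k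

/-- The number of the block of `k` consecutive register values to which a message belongs. -/
def Msg.tag {k : ℕ} : Msg k → ℕ
  | .act (.leader (.read _)) => 0
  | .act (.leader (.write _)) => 1
  | .act (.contrib (.read _)) => 2
  | .act (.contrib (.write _)) => 3
  | .done _ => 4
  | .req (.read _) => 5
  | .req (.write _) => 6

/-- The register value of the original system which a message mentions. -/
def Msg.val {k : ℕ} : Msg k → Fin k
  | .act (.leader o) => o.val
  | .act (.contrib o) => o.val
  | .done g => g
  | .req o => o.val

theorem Msg.tag_lt {k : ℕ} (m : Msg k) : m.tag < 7 := by
  rcases m with ((_ | _) | (_ | _)) | _ | (_ | _) <;> simp [Msg.tag]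

/-- The encoding of messages as values of the new register. -/
def Msg.toFin {k : ℕ} (m : Msg k) : Fin (7 * k) :=
  finProdFinEquiv (⟨m.tag, m.tag_lt⟩, m.val)

theorem Msg.toFin_bijective {k : ℕ} : Function.Bijective (Msg.toFin (k := k)) := by
  constructor
  · intro m m' h
    have h' := finProdFinEquiv.injective h
    simp only [Prod.mk.injEq, Fin.mk.injEq] at h'
    rcases m with ((_ | _) | (_ | _)) | _ | (_ | _) <;>
      rcases m' with ((_ | _) | (_ | _)) | _ | (_ | _) <;>
      simp_all [Msg.tag, Msg.val, Op.val]
  · intro x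
    obtain ⟨⟨t, g⟩, rfl⟩ := finProdFinEquiv.surjective x
    have : ∃ m : Msg k, m.tag = t ∧ m.val = g := by
      fin_cases t
      · exact ⟨.act (.leader (.read g)), rfl, rfl⟩
      · exact ⟨.act (.leader (.write g)), rfl, rfl⟩
      · exact ⟨.act (.contrib (.read g)), rfl, rfl⟩
      · exact ⟨.act (.contrib (.write g)), rfl, rfl⟩
      · exact ⟨.done g, rfl, rfl⟩
      · exact ⟨.req (.read g), rfl, rfl⟩
      · exact ⟨.req (.write g), rfl, rfl⟩
    obtain ⟨m, hm, hg⟩ := this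
    refine ⟨m, ?_⟩
    unfold Msg.toFin
    congr 1
    exact Prod.ext (Fin.ext hm) hg

@[simp]
theorem Msg.toFin_inj {k : ℕ} {m m' : Msg k} : m.toFin = m'.toFin ↔ m = m' :=
  Msg.toFin_bijective.1.eq_iff

/-- All operations on a register with `k` values. -/
def Op.all (k : ℕ) : List (Op (Fin k)) :=
  (List.finRange k).map .read ++ (List.finRange k).map .write

theorem Op.mem_all {k : ℕ} (o : Op (Fin k)) : o ∈ Op.all k := by
  cases o <;> simp [Op.all]

/-- The messages which tell that the simulated register contains `g`. -/
def leaderMsgs {k : ℕ} (g : Fin k) : List (Msg k) :=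
  [.act (.leader (.read g)), .act (.leader (.write g)), .act (.contrib (.read g)),
    .act (.contrib (.write g)), .done g]

theorem mem_leaderMsgs {k : ℕ} {g : Fin k} {m : Msg k} :
    m ∈ leaderMsgs g ↔ (∃ a, m = .act a ∧ m.val = g) ∨ m = .done g := by
  rcases m with ((x | x) | (x | x)) | x | (x | x) <;> simp [leaderMsgs, Msg.val, Op.val]

/-- A finite control which drives a process over the alphabet `Op (Fin k)`. Its local rules change
the mode only; a rule in `sync o` changes the mode while the process performs `o`. In both cases
the action visible outside is the label of the rule. -/
structure Control (k : ℕ) (μ : Type) where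
  loc : List (μ × Op (Fin (7 * k)) × μ)
  sync : Op (Fin k) → List (μ × Op (Fin (7 * k)) × μ)
  init : μ

/-- The transitions of the control alone. -/
def Control.Rule {k : ℕ} {μ : Type} (K : Control k μ) (m : μ) (b : Op (Fin (7 * k))) (m' : μ) :
    Prop :=
  (m, b, m') ∈ K.loc ∨ ∃ o, (m, b, m') ∈ K.sync o

/-- The process driven by the control. -/
def Control.product {k : ℕ} {μ : Type} {S : Type*} (K : Control k μ)
    (C : TransitionSystem S (Op (Fin k))) : TransitionSystem (μ × S) (Op (Fin (7 * k))) where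
  step x b y := ((x.1, b, y.1) ∈ K.loc ∧ y.2 = x.2) ∨
    ∃ o, (x.1, b, y.1) ∈ K.sync o ∧ C.step x.2 o y.2
  init := (K.init, C.init)

/-- The modes of a contributor. A contributor in mode `pend o` or `wait o` has already moved to the
target of a transition labelled by `o`; it still has to request this operation, or to wait until the
leader grants it. -/
inductive CMode (k : ℕ) : Type where
  | passive : CMode k
  | pend (o : Op (Fin k)) : CMode k
  | wait (o : Op (Fin k)) : CMode k

/-- The modes of the leader. In mode `idle g` the simulated register contains `g`, in mode `ack o`
the leader has read a request to perform `o`, in mode `ended g` it has declared the end of the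
simulated run, and in mode `dead` this declaration was wrong. -/
inductive LMode (k : ℕ) : Type where
  | idle (g : Fin k) : LMode k
  | ack (o : Op (Fin k)) : LMode k
  | ended (g : Fin k) : LMode k
  | dead : LMode k

/-- The control of the contributors. -/
def cControl (k : ℕ) : Control k (CMode k) where
  loc := (Op.all k).flatMap fun o =>
    (.pend o, .write (Msg.toFin (.req o)), .wait o) ::
    (.wait o, .read (Msg.toFin (.act (.contrib o))), .passive) ::
    (List.finRange k).map fun g => (.wait o, .read (Msg.toFin (.done g)), .pend o)
  sync o := o.views.flatMap fun g => (leaderMsgs g).map fun m =>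
    (.passive, .read m.toFin, .pend o)
  init := .passive

/-- The control of the leader, which contains the simulated register. -/
def lControl {k : ℕ} (ginit : Fin k) : Control k (LMode k) where
  loc := ((Op.all k).flatMap fun o =>
      (.ack o, .write (Msg.toFin (.act (.contrib o))), .idle o.val) ::
      o.views.map fun g => (.idle g, .read (Msg.toFin (.req o)), .ack o)) ++
    (List.finRange k).flatMap fun g =>
      (.idle g, .write (Msg.toFin (.done g)), .ended g) ::
      (Op.all k).map fun o => (.ended g, .read (Msg.toFin (.req o)), .dead)
  sync o := o.views.flatMap fun g =>
    [(.idle g, .write (Msg.toFin (.act (.leader o))), .idle o.val),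
      (.ended g, .write (Msg.toFin (.act (.leader o))), .dead)]
  init := .idle ginit

theorem mem_cControl_loc {k : ℕ} {m m' : CMode k} {b : Op (Fin (7 * k))} :
    (m, b, m') ∈ (cControl k).loc ↔
      (∃ o, m = .pend o ∧ b = .write (Msg.toFin (.req o)) ∧ m' = .wait o) ∨
      (∃ o, m = .wait o ∧ b = .read (Msg.toFin (.act (.contrib o))) ∧ m' = .passive) ∨
      ∃ o g, m = .wait o ∧ b = .read (Msg.toFin (.done g)) ∧ m' = .pend o := by
  simp only [cControl, List.mem_flatMap, Op.mem_all, true_and, List.mem_cons, Prod.mk.injEq,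
    List.mem_map, List.mem_finRange, exists_or, eq_comm]

theorem mem_cControl_sync {k : ℕ} {m m' : CMode k} {b : Op (Fin (7 * k))} {o : Op (Fin k)} :
    (m, b, m') ∈ (cControl k).sync o ↔
      m = .passive ∧ m' = .pend o ∧ ∃ g ∈ o.views, ∃ x ∈ leaderMsgs g, b = .read x.toFin := by
  simp only [cControl, List.mem_flatMap, List.mem_map, Prod.mk.injEq]
  constructor
  · rintro ⟨g, hg, x, hx, rfl, rfl, rfl⟩
    exact ⟨rfl, rfl, g, hg, x, hx, rfl⟩
  · rintro ⟨rfl, rfl, g, hg, x, hx, rfl⟩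
    exact ⟨g, hg, x, hx, rfl, rfl, rfl⟩

theorem mem_lControl_loc {k : ℕ} {g₀ : Fin k} {m m' : LMode k} {b : Op (Fin (7 * k))} :
    (m, b, m') ∈ (lControl g₀).loc ↔
      (∃ o, m = .ack o ∧ b = .write (Msg.toFin (.act (.contrib o))) ∧ m' = .idle o.val) ∨
      (∃ o, ∃ g ∈ o.views, m = .idle g ∧ b = .read (Msg.toFin (.req o)) ∧ m' = .ack o) ∨
      (∃ g, m = .idle g ∧ b = .write (Msg.toFin (.done g)) ∧ m' = .ended g) ∨
      ∃ g o, m = .ended g ∧ b = .read (Msg.toFin (.req o)) ∧ m' = .dead := by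
  simp only [lControl, List.mem_append, List.mem_flatMap, Op.mem_all, true_and, List.mem_cons,
    Prod.mk.injEq, List.mem_map, List.mem_finRange, exists_or, eq_comm, or_assoc]

theorem mem_lControl_sync {k : ℕ} {g₀ : Fin k} {m m' : LMode k} {b : Op (Fin (7 * k))}
    {o : Op (Fin k)} :
    (m, b, m') ∈ (lControl g₀).sync o ↔
      b = .write (Msg.toFin (.act (.leader o))) ∧ ∃ g ∈ o.views,
        (m = .idle g ∧ m' = .idle o.val) ∨ (m = .ended g ∧ m' = .dead) := by
  simp only [lControl, List.mem_flatMap, List.mem_cons, Prod.mk.injEq, List.not_mem_nil, or_false]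
  constructor
  · rintro ⟨g, hg, ⟨rfl, rfl, rfl⟩ | ⟨rfl, rfl, rfl⟩⟩
    · exact ⟨rfl, g, hg, .inl ⟨rfl, rfl⟩⟩
    · exact ⟨rfl, g, hg, .inr ⟨rfl, rfl⟩⟩
  · rintro ⟨rfl, g, hg, ⟨rfl, rfl⟩ | ⟨rfl, rfl⟩⟩
    · exact ⟨g, hg, .inl ⟨rfl, rfl, rfl⟩⟩
    · exact ⟨g, hg, .inr ⟨rfl, rfl, rfl⟩⟩

/-- The system in which the contributors and the leader are driven by their controls. -/
def protocol {k : ℕ} {S T : Type*} (sys : System (Fin k) S T) :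
    System (Fin (7 * k)) (CMode k × S) (LMode k × T) where
  C := (cControl k).product sys.C
  D := (lControl sys.ginit).product sys.D
  ginit := Msg.toFin (.act (.leader (.write sys.ginit)))

/-- The uniform description of steps: an operation is possible at the values in `views`, and leads
to the value `val`. -/
theorem System.step_iff {k : ℕ} {S T : Type*} (sys : System (Fin k) S T)
    {c c' : Config (Fin k) S T} {a : Act (Fin k)} :
    sys.Step c a c' ↔
      (∃ o t', a = .leader o ∧ sys.D.step c.leader o t' ∧ c.register ∈ o.views ∧
        c' = ⟨c.contributors, t', o.val⟩) ∨
      ∃ o s s' M, a = .contrib o ∧ c.contributors = s ::ₘ M ∧ sys.C.step s o s' ∧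
        c.register ∈ o.views ∧ c' = ⟨s' ::ₘ M, c.leader, o.val⟩ := by
  constructor
  · rintro (⟨M, t, t', g, h, hs⟩ | ⟨M, t, t', g, hs⟩ | ⟨M, s, s', t, g, h, hs⟩ |
      ⟨M, s, s', t, g, hs⟩)
    · exact .inl ⟨_, _, rfl, hs, by simp [Op.views], rfl⟩
    · exact .inl ⟨_, _, rfl, hs, by simp [Op.views], rfl⟩
    · exact .inr ⟨_, _, _, _, rfl, rfl, hs, by simp [Op.views], rfl⟩
    · exact .inr ⟨_, _, _, _, rfl, rfl, hs, by simp [Op.views], rfl⟩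
  · obtain ⟨M, t, g⟩ := c
    rintro (⟨o, t', rfl, hs, hg, rfl⟩ | ⟨o, s, s', M, rfl, rfl, hs, hg, rfl⟩)
    · cases o with
      | read h =>
        obtain rfl : g = h := by simpa [Op.views] using hg
        exact .leaderRead _ _ _ _ hs
      | write h => exact .leaderWrite _ _ _ _ _ hs
    · cases o with
      | read h =>
        obtain rfl : g = h := by simpa [Op.views] using hg
        exact .contribRead _ _ _ _ _ hs
      | write h => exact .contribWrite _ _ _ _ _ _ hs

theorem System.Step.leader {k : ℕ} {S T : Type*} {sys : System (Fin k) S T} {M : Multiset S}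
    {t t' : T} {g : Fin k} {o : Op (Fin k)} (h : sys.D.step t o t') (hg : g ∈ o.views) :
    sys.Step ⟨M, t, g⟩ (.leader o) ⟨M, t', o.val⟩ :=
  sys.step_iff.2 (.inl ⟨o, t', rfl, h, hg, rfl⟩)

theorem System.Step.contrib {k : ℕ} {S T : Type*} {sys : System (Fin k) S T} {M : Multiset S}
    {s s' : S} {t : T} {g : Fin k} {o : Op (Fin k)} (h : sys.C.step s o s') (hg : g ∈ o.views) :
    sys.Step ⟨s ::ₘ M, t, g⟩ (.contrib o) ⟨s' ::ₘ M, t, o.val⟩ :=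
  sys.step_iff.2 (.inr ⟨o, s, s', M, rfl, rfl, h, hg, rfl⟩)

end ParamSys

namespace ParamSys

/-! ### Infinitely many writes of the leader -/

/-- The register contains a request. -/
def Msg.IsReq {k : ℕ} (r : Fin (7 * k)) : Prop := ∃ o, r = Msg.toFin (.req o)

/-- A bound for the number of steps which a contributor can make as long as the leader writes
nothing. Once the register contains a request (`true`), nobody can read from it except the
leader, and there is at most one further write. -/
def CMode.rank {k : ℕ} : Bool → CMode k → ℕ
  | true, .pend _ => 1
  | true, _ => 0
  | false, .pend _ => 2
  | false, .passive => 3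
  | false, .wait _ => 4

/-- A bound for the number of steps which the leader can make without writing. -/
def LMode.rank {k : ℕ} : LMode k → ℕ
  | .idle _ => 1
  | .ended _ => 1
  | .ack _ => 0
  | .dead => 0

theorem CMode.rank_true_le {k : ℕ} (m : CMode k) (b : Bool) : m.rank true ≤ m.rank b := by
  cases m <;> cases b <;> simp [CMode.rank]

theorem not_isReq_of_mem_leaderMsgs {k : ℕ} {g : Fin k} {x : Msg k} (hx : x ∈ leaderMsgs g) :
    ¬ Msg.IsReq x.toFin := by
  rintro ⟨o, ho⟩
  rw [Msg.toFin_inj] at ho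
  subst ho
  simp [leaderMsgs] at hx

theorem cControl_rule_write {k : ℕ} {m m' : CMode k} {r : Fin (7 * k)}
    (h : (cControl k).Rule m (.write r) m') :
    ∃ o, m = .pend o ∧ m' = .wait o ∧ r = Msg.toFin (.req o) := by
  rcases h with h | ⟨o, h⟩
  · rw [mem_cControl_loc] at h
    rcases h with ⟨o, rfl, h, rfl⟩ | ⟨o, rfl, h, rfl⟩ | ⟨o, g, rfl, h, rfl⟩
    · exact ⟨o, rfl, rfl, by simpa using h⟩
    all_goals simp at h
  · rw [mem_cControl_sync] at h
    obtain ⟨-, -, g, -, x, -, h⟩ := h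
    simp at h

theorem cControl_rule_read {k : ℕ} {m m' : CMode k} {r : Fin (7 * k)}
    (h : (cControl k).Rule m (.read r) m') :
    ¬ Msg.IsReq r ∧ m'.rank false < m.rank false := by
  rcases h with h | ⟨o, h⟩
  · rw [mem_cControl_loc] at h
    rcases h with ⟨o, rfl, h, rfl⟩ | ⟨o, rfl, h, rfl⟩ | ⟨o, g, rfl, h, rfl⟩
    · simp at h
    · simp only [Op.read.injEq] at h
      subst h
      simp [Msg.IsReq, CMode.rank]
    · simp only [Op.read.injEq] at h
      subst h
      simp [Msg.IsReq, CMode.rank]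
  · rw [mem_cControl_sync] at h
    obtain ⟨rfl, rfl, g, hg, x, hx, h⟩ := h
    simp only [Op.read.injEq] at h
    subst h
    exact ⟨not_isReq_of_mem_leaderMsgs hx, by simp [CMode.rank]⟩

theorem lControl_rule_read {k : ℕ} {g₀ : Fin k} {m m' : LMode k} {r : Fin (7 * k)}
    (h : (lControl g₀).Rule m (.read r) m') : m'.rank < m.rank := by
  rcases h with h | ⟨o, h⟩
  · rw [mem_lControl_loc] at h
    rcases h with ⟨o, rfl, h, rfl⟩ | ⟨o, g, hg, rfl, h, rfl⟩ | ⟨g, rfl, h, rfl⟩ | ⟨g, o, rfl, h, rfl⟩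
    all_goals simp_all [LMode.rank]
  · rw [mem_lControl_sync] at h
    simp at h

open Classical in
/-- A bound for the number of steps possible without a write of the leader. -/
noncomputable def silentRank {k : ℕ} {S T : Type*} (cm : S → CMode k) (lm : T → LMode k)
    (c : Config (Fin (7 * k)) S T) : ℕ :=
  (c.contributors.map fun s => (cm s).rank (decide (Msg.IsReq c.register))).sum +
    (lm c.leader).rank

theorem silentRank_lt {k : ℕ} {S T : Type*} {sys : System (Fin (7 * k)) S T} {g₀ : Fin k}
    {cm : S → CMode k} {lm : T → LMode k}
    (hC : ∀ x b y, sys.C.step x b y → (cControl k).Rule (cm x) b (cm y))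
    (hD : ∀ x b y, sys.D.step x b y → (lControl g₀).Rule (lm x) b (lm y))
    {c c' : Config (Fin (7 * k)) S T} {a : Act (Fin (7 * k))} (h : sys.Step c a c')
    (ha : ¬ ∃ g, a = .leader (.write g)) : silentRank cm lm c' < silentRank cm lm c := by
  classical
  rcases h with ⟨M, t, t', g, h, hs⟩ | ⟨M, t, t', g, hs⟩ | ⟨M, s, s', t, g, h, hs⟩ |
      ⟨M, s, s', t, g, hs⟩
  · exact absurd ⟨_, rfl⟩ ha
  · have := lControl_rule_read (hD _ _ _ hs)
    simp only [silentRank]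
    omega
  · obtain ⟨o, h1, h2, rfl⟩ := cControl_rule_write (hC _ _ _ hs)
    have hr : Msg.IsReq (Msg.toFin (.req o)) := ⟨o, rfl⟩
    have hle := Multiset.sum_map_le_sum_map (s := M) (fun s => (cm s).rank true)
      (fun s => (cm s).rank (decide (Msg.IsReq g))) (fun s _ => (cm s).rank_true_le _)
    have h3 : CMode.rank true (CMode.wait o) < CMode.rank (decide (Msg.IsReq g)) (.pend o) := by
      cases decide (Msg.IsReq g) <;> simp [CMode.rank]
    simp only [silentRank, Multiset.map_cons, Multiset.sum_cons, h1, h2, decide_eq_true hr]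
    omega
  · obtain ⟨h1, h2⟩ := cControl_rule_read (hC _ _ _ hs)
    simp only [silentRank, Multiset.map_cons, Multiset.sum_cons, decide_eq_false h1]
    omega

/-- Contributors and leader alternate between reading and writing, and contributors cannot read
requests, so that without a write of the leader everything stops. -/
theorem infinitely_many_leader_writes {k : ℕ} {S T : Type*} {sys : System (Fin (7 * k)) S T}
    {g₀ : Fin k} {cm : S → CMode k} {lm : T → LMode k}
    (hC : ∀ x b y, sys.C.step x b y → (cControl k).Rule (cm x) b (cm y))
    (hD : ∀ x b y, sys.D.step x b y → (lControl g₀).Rule (lm x) b (lm y))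
    {c : ℕ → Config (Fin (7 * k)) S T} {a : ℕ → Act (Fin (7 * k))} (h : sys.InfRun c a) (N : ℕ) :
    ∃ i, N ≤ i ∧ ∃ g, a i = .leader (.write g) := by
  by_contra hcon
  push Not at hcon
  have hdec : ∀ n, silentRank cm lm (c (N + n)) + n ≤ silentRank cm lm (c N) := by
    intro n
    induction n with
    | zero => simp
    | succ n ih =>
      have := silentRank_lt hC hD (h (N + n)) (fun ⟨g, hg⟩ => hcon (N + n) (by omega) g hg)
      rw [← Nat.add_assoc N n 1]
      omega
  have := hdec (silentRank cm lm (c N) + 1)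
  omega

end ParamSys

namespace ParamSys

/-! ### Runs and words -/

theorem System.FinRun.append {G : Type} {S T : Type*} {sys : System G S T}
    {c c' c'' : Config G S T} {l l' : List (Act G)} (h : sys.FinRun c l c')
    (h' : sys.FinRun c' l' c'') : sys.FinRun c (l ++ l') c'' := by
  induction h with
  | nil => exact h'
  | cons c c₁ _ a l hs _ ih => exact .cons _ _ _ _ _ hs (ih h')

theorem System.Step.finRun {G : Type} {S T : Type*} {sys : System G S T}
    {c c' : Config G S T} {a : Act G} (h : sys.Step c a c') : sys.FinRun c [a] c' :=
  .cons _ _ _ _ _ h (.nil _)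

/-- Induction over a finite run from its start. -/
theorem System.FinRun.snoc_induction {G : Type} {S T : Type*} {sys : System G S T}
    {p : List (Act G) → Config G S T → Prop} {c₀ : Config G S T} (h0 : p [] c₀)
    (hstep : ∀ l c a c', p l c → sys.Step c a c' → p (l ++ [a]) c')
    {l : List (Act G)} {c : Config G S T} (h : sys.FinRun c₀ l c) : p l c := by
  suffices H : ∀ c₁ l₂ c₂, sys.FinRun c₁ l₂ c₂ → ∀ l₁, p l₁ c₁ → p (l₁ ++ l₂) c₂ by
    simpa using H _ _ _ h [] h0
  intro c₁ l₂ c₂ h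
  induction h with
  | nil => simp
  | cons c c' c'' a l hs _ ih =>
    intro l₁ h₁
    simpa using ih _ (hstep _ _ _ _ h₁ hs)

theorem exists_seq_of_step {α : Type*} {p : ℕ → α → Prop} {r : ℕ → α → α → Prop} {a₀ : α}
    (h₀ : p 0 a₀) (h : ∀ n a, p n a → ∃ b, p (n + 1) b ∧ r n a b) :
    ∃ f : ℕ → α, f 0 = a₀ ∧ ∀ n, p n (f n) ∧ r n (f n) (f (n + 1)) := by
  choose! g hg using h
  let f : ℕ → α := fun n => Nat.rec a₀ (fun n a => g n a) n
  have hf : ∀ n, p n (f n) := by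
    intro n
    induction n with
    | zero => exact h₀
    | succ n ih => exact (hg n _ ih).1
  exact ⟨f, rfl, fun n => ⟨hf n, (hg n _ (hf n)).2⟩⟩

namespace Word

variable {α β γ : Type}

theorem HasProj.comp_iff {π : α → Option β} {ρ : β → Option γ} {s : ℕ → α} {v : ℕ → β}
    {u : ℕ → γ} (h : (inf s).HasProj π (inf v)) :
    (inf s).HasProj (fun x => (π x).bind ρ) (inf u) ↔ (inf v).HasProj ρ (inf u) := by
  obtain ⟨e, he, h1, h2⟩ := h
  constructor
  · rintro ⟨f, hf, h3, h4⟩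
    dsimp only at h3 h4
    have hfe : ∀ n, ∃ j, e j = f n := by
      intro n
      by_contra hcon
      have := h3 n
      rw [h2 (f n) (by simpa using hcon)] at this
      simp at this
    choose j hj using hfe
    refine ⟨j, ?_, ?_, ?_⟩
    · intro a b hab
      have := hf hab
      rw [← hj, ← hj] at this
      exact he.lt_iff_lt.1 this
    · intro n
      have := h3 n
      rw [← hj, h1] at this
      simpa using this
    · intro i hi
      have : e i ∉ Set.range f := by
        rintro ⟨n, hn⟩
        refine hi ⟨n, he.injective ?_⟩
        rw [hj, hn]
      have := h4 _ this
      rw [h1] at this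
      simpa using this
  · rintro ⟨f, hf, h3, h4⟩
    refine ⟨e ∘ f, he.comp hf, ?_, ?_⟩
    · intro n
      simp [h1, h3]
    · intro i hi
      by_cases hi' : i ∈ Set.range e
      · obtain ⟨j, rfl⟩ := hi'
        have : j ∉ Set.range f := by
          rintro ⟨n, rfl⟩
          exact hi ⟨n, rfl⟩
        simp [h1, h4 j this]
      · simp [h2 i hi']

theorem exists_hasProj {π : α → Option β} {s : ℕ → α} (h : ∀ N, ∃ i, N ≤ i ∧ (π (s i)).isSome) :
    ∃ v, (inf s).HasProj π (inf v) := by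
  have hinf : {i | (π (s i)).isSome = true}.Infinite := by
    rw [Set.infinite_iff_exists_gt]
    intro a
    obtain ⟨i, hi, h⟩ := h (a + 1)
    exact ⟨i, h, by omega⟩
  have hs : ∀ n, (π (s (Nat.nth (fun i => (π (s i)).isSome = true) n))).isSome := fun n =>
    Nat.nth_mem_of_infinite hinf n
  refine ⟨fun n => (π (s (Nat.nth _ n))).get (hs n), _, Nat.nth_strictMono hinf, ?_, ?_⟩
  · intro n
    simp
  · intro i hi
    rw [Nat.range_nth_of_infinite hinf] at hi
    simpa using hi

theorem HasProj.frequently {π : α → Option β} {s : ℕ → α} {v : ℕ → β}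
    (h : (inf s).HasProj π (inf v)) (N : ℕ) : ∃ i, N ≤ i ∧ (π (s i)).isSome := by
  obtain ⟨e, he, h1, -⟩ := h
  exact ⟨e N, he.id_le N, by simp [h1]⟩

theorem not_hasProj_fin {π : α → Option β} {s : ℕ → α} {l : List β}
    (h : ∀ N, ∃ i, N ≤ i ∧ (π (s i)).isSome) : ¬ (inf s).HasProj π (fin l) := by
  rintro ⟨N, hN, -⟩
  obtain ⟨i, hi, hs⟩ := h N
  simp [hN i hi] at hs

/-- The expansions of finite words, generated from the left to the right. -/
inductive ListExpansion (p : α → Prop) : List α → List α → Prop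
  | nil : ListExpansion p [] []
  | snoc (l l' : List α) (a : α) : ListExpansion p l l' → ListExpansion p (l ++ [a]) (l' ++ [a])
  | dup (l l' : List α) (a : α) : p a → ListExpansion p (l ++ [a]) l' →
      ListExpansion p (l ++ [a]) (l' ++ [a])

theorem flatMap_zipIdx_congr {l : List α} {m m' : ℕ → ℕ} (h : ∀ i, i < l.length → m i = m' i) :
    (l.zipIdx.flatMap fun x => List.replicate (m x.2) x.1) =
      l.zipIdx.flatMap fun x => List.replicate (m' x.2) x.1 := by
  have : ∀ x ∈ l.zipIdx, List.replicate (m x.2) x.1 = List.replicate (m' x.2) x.1 := by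
    rintro ⟨a, i⟩ hx
    rw [h i (by simpa using List.snd_lt_of_mem_zipIdx hx)]
  rw [List.flatMap_def, List.flatMap_def, List.map_congr_left this]

theorem ListExpansion.isExpansion {p : α → Prop} {l l' : List α} (h : ListExpansion p l l') :
    IsExpansion p (fin l) (fin l') := by
  induction h with
  | nil => exact ⟨fun _ => 1, by simp, by simp, by simp⟩
  | snoc l l' a _ ih =>
    obtain ⟨m, hm, h1, rfl⟩ := ih
    refine ⟨Function.update m l.length 1, ?_, ?_, ?_⟩
    · intro i
      by_cases hi : i = l.length
      · simp [hi]
      · simp [hi, hm]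
    · intro i b hb hpb
      by_cases hi : i = l.length
      · simp [hi]
      · have hlt : i < l.length := by
          have := (List.getElem?_eq_some_iff.1 hb).1
          simp at this
          omega
        rw [List.getElem?_append_left hlt] at hb
        simp [hi, h1 i b hb hpb]
    · simp only [List.zipIdx_append, List.flatMap_append, List.zipIdx_singleton,
        List.flatMap_cons, List.flatMap_nil]
      congr 1
      · apply flatMap_zipIdx_congr
        intro i hi
        simp [hi.ne]
      · simp
  | dup l l' a hpa _ ih =>
    obtain ⟨m, hm, h1, rfl⟩ := ih
    refine ⟨Function.update m l.length (m l.length + 1), ?_, ?_, ?_⟩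
    · intro i
      by_cases hi : i = l.length
      · simp [hi]
      · simp [hi, hm]
    · intro i b hb hpb
      by_cases hi : i = l.length
      · subst hi
        simp at hb
        exact absurd (hb ▸ hpa) hpb
      · simp [hi, h1 i b hb hpb]
    · simp only [List.zipIdx_append, List.flatMap_append, List.zipIdx_singleton,
        List.flatMap_cons, List.flatMap_nil, List.append_assoc]
      congr 1
      · apply flatMap_zipIdx_congr
        intro i hi
        simp [hi.ne]
      · simp [List.replicate_succ']

/-- Let `em` and `κ` be sequences of optional letters with contents `w` and `u`. If `em` repeats
`κ`, except that it may also emit further copies of the last letter of `κ`, then `w` is an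
expansion of `u`. -/
theorem isExpansion_of_emissions {p : α → Prop} {em κ last : ℕ → Option α} {u w : ℕ → α}
    (hw : (inf em).HasProj id (inf w)) (hu : (inf κ).HasProj id (inf u))
    (hlast0 : last 0 = none) (hlast : ∀ n, last (n + 1) = (κ n).or (last n))
    (h : ∀ n, (∃ a, κ n = some a ∧ em n = some a) ∨
      (κ n = none ∧ (em n = none ∨ ∃ a, p a ∧ em n = some a ∧ last n = some a))) :
    IsExpansion p (inf u) (inf w) := by
  obtain ⟨f, hf, hf1, hf2⟩ := hw
  obtain ⟨e, he, he1, he2⟩ := hu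
  simp only [id] at hf1 hf2 he1 he2
  have hem : ∀ n a, κ n = some a → em n = some a := by
    intro n a ha
    rcases h n with ⟨b, h1, h2⟩ | ⟨h1, -⟩
    · rw [← ha, h1, h2]
    · simp [h1] at ha
  have hex : ∀ i, ∃ j, f j = e i := by
    intro i
    by_contra hcon
    have h1 := hem _ _ (he1 i)
    rw [hf2 (e i) (by simpa using hcon)] at h1
    simp at h1
  choose j hj using hex
  have hjm : StrictMono j := fun a b hab => hf.lt_iff_lt.1 (by rw [hj, hj]; exact he hab)
  have hnone : ∀ n, n < e 0 → κ n = none := by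
    intro n hn
    apply he2
    rintro ⟨i, rfl⟩
    exact absurd (he.lt_iff_lt.1 hn) (by omega)
  have hlnone : ∀ n, n ≤ e 0 → last n = none := by
    intro n
    induction n with
    | zero => intro _; exact hlast0
    | succ n ih =>
      intro hn
      rw [hlast, hnone n (by omega), ih (by omega)]
      rfl
  have hj0 : j 0 = 0 := by
    by_contra hne
    have h1 : f 0 < e 0 := by rw [← hj]; exact hf (Nat.pos_of_ne_zero hne)
    rcases h (f 0) with ⟨b, h2, -⟩ | ⟨-, h2 | ⟨a, -, -, h2⟩⟩
    · simp [hnone _ h1] at h2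
    · simp [hf1] at h2
    · simp [hlnone _ h1.le] at h2
  have hbetween : ∀ i n, e i < n → n < e (i + 1) → κ n = none := by
    intro i n h1 h2
    apply he2
    rintro ⟨i', rfl⟩
    have h1 := he.lt_iff_lt.1 h1
    have h2 := he.lt_iff_lt.1 h2
    omega
  have hlsome : ∀ i n, e i < n → n ≤ e (i + 1) → last n = some (u i) := by
    intro i n
    induction n with
    | zero => intro h1; omega
    | succ n ih =>
      intro h1 h2
      rw [hlast]
      rcases Nat.lt_or_ge (e i) n with h3 | h3
      · rw [hbetween i n h3 (by omega), ih h3 (by omega)]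
        rfl
      · obtain rfl : n = e i := by omega
        simp [he1]
  have hsum : ∀ i, ∑ x ∈ Finset.range i, (j (x + 1) - j x) = j i := by
    intro i
    rw [Finset.sum_range_tsub hjm.monotone, hj0, Nat.sub_zero]
  have hcase : ∀ i r, r < j (i + 1) - j i → 0 < r → p (w (j i + r)) ∧ w (j i + r) = u i := by
    intro i r hr hr0
    have h1 : e i < f (j i + r) := by rw [← hj]; exact hf (by omega)
    have h2 : f (j i + r) < e (i + 1) := by rw [← hj]; exact hf (by omega)
    rcases h (f (j i + r)) with ⟨b, h3, -⟩ | ⟨-, h3 | ⟨a, hpa, h3, h4⟩⟩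
    · simp [hbetween i _ h1 h2] at h3
    · simp [hf1] at h3
    · rw [hf1] at h3
      rw [hlsome i _ h1 h2.le] at h4
      simp only [Option.some.injEq] at h3 h4
      exact ⟨h3 ▸ hpa, h3.trans h4.symm⟩
  refine ⟨fun i => j (i + 1) - j i, ?_, ?_, ?_⟩
  · intro i
    exact Nat.sub_pos_of_lt (hjm (Nat.lt_succ_self i))
  · intro i hi
    by_contra hne
    have : j i < j (i + 1) := hjm (Nat.lt_succ_self i)
    dsimp only at hne
    obtain ⟨h1, h2⟩ := hcase i 1 (by omega) one_pos
    exact hi (h2 ▸ h1)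
  · intro i r hr
    rw [hsum]
    rcases Nat.eq_zero_or_pos r with rfl | hr0
    · have h1 := hem _ _ (he1 i)
      rw [← hj, hf1] at h1
      simpa using h1
    · exact (hcase i r hr hr0).2

end Word

end ParamSys

namespace ParamSys

/-! ### The log of the leader -/

open Classical in
/-- The action of the original system which is announced by an action of the new leader. -/
noncomputable def logOp {k : ℕ} : Op (Fin (7 * k)) → Option (Act (Fin k))
  | .read _ => none
  | .write r => if h : ∃ a, r = Msg.toFin (.act a) then some h.choose else none

@[simp]
theorem logOp_read {k : ℕ} (r : Fin (7 * k)) : logOp (.read r) = none := rfl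

@[simp]
theorem logOp_write_act {k : ℕ} (a : Act (Fin k)) :
    logOp (.write (Msg.toFin (.act a))) = some a := by
  have h : ∃ a', Msg.toFin (.act a) = Msg.toFin (.act a') := ⟨a, rfl⟩
  have := Msg.act.inj (Msg.toFin_inj.1 h.choose_spec)
  rw [logOp, dif_pos h]
  exact congrArg some this.symm

@[simp]
theorem logOp_write_done {k : ℕ} (g : Fin k) : logOp (.write (Msg.toFin (.done g))) = none := by
  simp [logOp]

@[simp]
theorem logOp_write_req {k : ℕ} (o : Op (Fin k)) : logOp (.write (Msg.toFin (.req o))) = none := by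
  simp [logOp]

theorem logOp_eq_some {k : ℕ} {b : Op (Fin (7 * k))} {a : Act (Fin k)} :
    logOp b = some a ↔ b = .write (Msg.toFin (.act a)) := by
  constructor
  · intro h
    cases b with
    | read r => simp at h
    | write r =>
      obtain ⟨m, rfl⟩ := Msg.toFin_bijective.2 r
      cases m <;> simp_all
  · rintro rfl
    simp

/-- The action of the original system which is announced by an action of the new system. -/
noncomputable def logAct {k : ℕ} (b : Act (Fin (7 * k))) : Option (Act (Fin k)) :=
  b.leader?.bind logOp

@[simp]
theorem logAct_leader {k : ℕ} (o : Op (Fin (7 * k))) : logAct (.leader o) = logOp o := rfl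

@[simp]
theorem logAct_contrib {k : ℕ} (o : Op (Fin (7 * k))) : logAct (.contrib o) = none := rfl

/-- The property of the new leader that corresponds to `P`: finite words have to end with the
declaration that the simulated run is finished, and the log has to be in `P`. -/
def counterpart {k : ℕ} (P : Set (Word (Act (Fin k)))) : Set (Word (Op (Fin (7 * k)))) :=
  {v | match v with
    | .fin l => ∃ y g, l = y ++ [.write (Msg.toFin (.done g))] ∧ .fin (y.filterMap logOp) ∈ P
    | .inf s => ∃ u, (Word.inf s).HasProj logOp (.inf u) ∧ .inf u ∈ P}

/-! ### Every run of the new system simulates a run of the original one -/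

section Soundness

variable {k : ℕ} {S T : Type*} (sys : System (Fin k) S T)

/-- The relation between a contributor of the new system and the state of the original contributor
which it simulates. As long as its operation is not performed, the new contributor is ahead by one
step; afterwards the states agree. In the loose version, which holds after the end of the simulated
run, this is also possible in mode `pend`. -/
def Agree (strict : Prop) : (CMode k × S) × S → Prop
  | ((.passive, s), s₀) => s = s₀
  | ((.pend o, s), s₀) => sys.C.step s₀ o s ∨ (¬ strict ∧ s = s₀)
  | ((.wait o, s), s₀) => sys.C.step s₀ o s ∨ s = s₀

/-- Some contributor waits to perform the operation, and has not performed it yet. -/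
def Waiter (P : Multiset ((CMode k × S) × S)) (o : Op (Fin k)) : Prop :=
  ∃ s s₀, ((.wait o, s), s₀) ∈ P ∧ sys.C.step s₀ o s

/-- The relation between the mode of the leader, the registers of both systems, and the last
letter of the log. -/
def ModeInv (P : Multiset ((CMode k × S) × S)) (r : Fin (7 * k)) (g : Fin k)
    (last : Option (Act (Fin k))) : LMode k → Prop
  | .idle h => h = g ∧ ((∃ o, r = Msg.toFin (.req o) ∧ Waiter sys P o) ∨
      (∃ o, r = Msg.toFin (.act (.leader o))) ∨
      ∃ o, r = Msg.toFin (.act (.contrib o)) ∧ last = some (.contrib o) ∧ g = o.val)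
  | .ack o => g ∈ o.views ∧ Waiter sys P o ∧ ∃ o', r = Msg.toFin (.req o')
  | .ended h => h = g ∧ (r = Msg.toFin (.done g) ∨ ∃ o, r = Msg.toFin (.req o))
  | .dead => (∃ o, r = Msg.toFin (.req o)) ∨ ∃ o, r = Msg.toFin (.act (.leader o))

/-- The leader has not yet declared the end of the simulated run. -/
def LMode.IsStrict : LMode k → Prop
  | .idle _ => True
  | .ack _ => True
  | .ended _ => False
  | .dead => False

/-- The simulation relation; the multiset pairs the contributors of both systems. -/
structure Simulates (d : Config (Fin (7 * k)) (CMode k × S) (LMode k × T))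
    (c : Config (Fin k) S T) (last : Option (Act (Fin k)))
    (P : Multiset ((CMode k × S) × S)) : Prop where
  new : d.contributors = P.map Prod.fst
  old : c.contributors = P.map Prod.snd
  leader : c.leader = d.leader.2
  agree : ∀ p ∈ P, Agree sys d.leader.1.IsStrict p
  mode : ModeInv sys P d.register c.register last d.leader.1

/-- The optional action `em` leads from `c` to `c'`. -/
def Emits (c : Config (Fin k) S T) (em : Option (Act (Fin k))) (c' : Config (Fin k) S T) : Prop :=
  match em with
  | none => c' = c
  | some a => sys.Step c a c'

/-- What the original system performs when the new one performs a step announcing `κ`: the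
announced action or, if there is none, possibly another copy of the last announced one. -/
def EmissionRule (last κ em : Option (Act (Fin k))) : Prop :=
  (∃ a, κ = some a ∧ em = some a) ∨
    (κ = none ∧ (em = none ∨ ∃ a : Act (Fin k), a.IsContrib ∧ em = some a ∧ last = some a))

variable {sys}

theorem Agree.loosen {p : (CMode k × S) × S} {q : Prop} (h : Agree sys q p) :
    Agree sys False p := by
  obtain ⟨⟨m, s⟩, s₀⟩ := p
  cases m
  · exact h
  · exact h.imp_right fun h => ⟨not_false, h.2⟩
  · exact h

theorem exists_eq_cons_of_map_fst_eq {α β : Type*} {P : Multiset (α × β)} {x : α}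
    {M : Multiset α} (h : P.map Prod.fst = x ::ₘ M) :
    ∃ y P', P = (x, y) ::ₘ P' ∧ M = P'.map Prod.fst := by
  classical
  obtain ⟨⟨x', y⟩, hp, rfl, hM⟩ := (Multiset.map_eq_cons _ _ _ _).2 h
  exact ⟨y, P.erase (x', y), (Multiset.cons_erase hp).symm, hM.symm⟩

theorem Waiter.cons {P : Multiset ((CMode k × S) × S)} {o : Op (Fin k)} {p p' : (CMode k × S) × S}
    (h : Waiter sys (p ::ₘ P) o) (hp : ∀ o s s₀, p ≠ ((.wait o, s), s₀)) :
    Waiter sys (p' ::ₘ P) o := by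
  obtain ⟨s, s₀, hmem, hs⟩ := h
  rcases Multiset.mem_cons.1 hmem with h | h
  · exact absurd h.symm (hp _ _ _)
  · exact ⟨s, s₀, Multiset.mem_cons_of_mem h, hs⟩

theorem Op.val_mem_views (o : Op (Fin k)) : o.val ∈ o.views := by
  cases o <;> simp [Op.views, Op.val]

/-- If the current value of the register is not a request, then a contributor changing its mode
by reading preserves the condition on the leader. -/
theorem ModeInv.cons {P : Multiset ((CMode k × S) × S)} {r : Fin (7 * k)} {g : Fin k}
    {last : Option (Act (Fin k))} {m : LMode k} {p p' : (CMode k × S) × S}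
    (h : ModeInv sys (p ::ₘ P) r g last m) (hr : ¬ Msg.IsReq r) :
    ModeInv sys (p' ::ₘ P) r g last m := by
  cases m with
  | idle _ =>
    obtain ⟨h1, ⟨o, rfl, -⟩ | h2⟩ := h
    · exact absurd ⟨o, rfl⟩ hr
    · exact ⟨h1, .inr h2⟩
  | ack _ => exact absurd h.2.2 hr
  | ended _ => exact h
  | dead => exact h

/-- A contributor writing a request. -/
theorem ModeInv.request {P : Multiset ((CMode k × S) × S)} {r : Fin (7 * k)} {g : Fin k}
    {last : Option (Act (Fin k))} {m : LMode k} {s s₀ : S} {o : Op (Fin k)}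
    (h : ModeInv sys (((.pend o, s), s₀) ::ₘ P) r g last m)
    (hs : Agree sys m.IsStrict ((.pend o, s), s₀)) :
    ModeInv sys (((.wait o, s), s₀) ::ₘ P) (Msg.toFin (.req o)) g last m := by
  cases m with
  | idle _ =>
    refine ⟨h.1, .inl ⟨o, rfl, s, s₀, Multiset.mem_cons_self _ _, ?_⟩⟩
    simpa [Agree, LMode.IsStrict] using hs
  | ack _ => exact ⟨h.1, h.2.1.cons (by simp), o, rfl⟩
  | ended _ => exact ⟨h.1, .inr ⟨o, rfl⟩⟩
  | dead => exact .inl ⟨o, rfl⟩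

theorem Op.mem_views_read {r : Fin k} {x : Fin k} : x ∈ (Op.read r).views ↔ x = r := by
  simp [Op.views]

theorem Simulates.step {d d' : Config (Fin (7 * k)) (CMode k × S) (LMode k × T)}
    {c : Config (Fin k) S T} {last : Option (Act (Fin k))} {P : Multiset ((CMode k × S) × S)}
    (h : Simulates sys d c last P) {b : Act (Fin (7 * k))} (hs : (protocol sys).Step d b d') :
    ∃ c' em P', Emits sys c em c' ∧ EmissionRule last (logAct b) em ∧
      Simulates sys d' c' ((logAct b).or last) P' := by
  obtain ⟨hnew, hold, hleader, hagree, hmode⟩ := h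
  obtain ⟨M, t, g⟩ := c
  obtain ⟨M', ⟨mode, t'⟩, r⟩ := d
  simp only at hnew hold hleader hagree hmode
  subst hnew hold hleader
  rw [System.step_iff] at hs
  rcases hs with ⟨o, ⟨mode', t''⟩, rfl, hs, hr, rfl⟩ | ⟨b, ⟨cm, s⟩, ⟨cm', s'⟩, N, rfl, hN, hs, hr, rfl⟩
  · simp only [logAct_leader]
    simp only at hr
    rcases hs with ⟨hs, rfl⟩ | ⟨o', hs, hst⟩
    · -- the leader changes its mode only
      simp only at hs
      rcases mem_lControl_loc.1 hs with ⟨o, rfl, rfl, rfl⟩ | ⟨o, h, hh, rfl, rfl, rfl⟩ |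
        ⟨h, rfl, rfl, rfl⟩ | ⟨h, o, rfl, rfl, rfl⟩
      · obtain ⟨hg, ⟨s, s₀, hmem, hst⟩, -⟩ := hmode
        obtain ⟨P', rfl⟩ := Multiset.exists_cons_of_mem hmem
        refine ⟨⟨s ::ₘ P'.map Prod.snd, t'', o.val⟩, some (.contrib o), ((.wait o, s), s) ::ₘ P',
          ?_, .inl ⟨_, logOp_write_act _, rfl⟩, ?_⟩
        · rw [Multiset.map_cons]
          exact .contrib hst hg
        · refine ⟨by simp, by simp, rfl, ?_, rfl, .inr (.inr ⟨o, rfl, by simp, rfl⟩)⟩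
          intro p hp
          rcases Multiset.mem_cons.1 hp with rfl | hp
          · exact .inr rfl
          · exact hagree p (Multiset.mem_cons_of_mem hp)
      · rw [Op.mem_views_read] at hr
        subst hr
        obtain ⟨rfl, ⟨o', h1, h2⟩ | ⟨o', h1⟩ | ⟨o', h1, -⟩⟩ := hmode
        · simp only [Msg.toFin_inj, Msg.req.injEq] at h1
          subst h1
          exact ⟨_, none, P, rfl, .inr ⟨rfl, .inl rfl⟩, rfl, rfl, rfl, hagree, hh, h2, _, rfl⟩
        · simp at h1
        · simp at h1
      · obtain ⟨rfl, -⟩ := hmode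
        exact ⟨_, none, P, rfl, .inr ⟨by simp, .inl rfl⟩, rfl, rfl, rfl,
          fun p hp => (hagree p hp).loosen, rfl, .inl rfl⟩
      · exact ⟨_, none, P, rfl, .inr ⟨rfl, .inl rfl⟩, rfl, rfl, rfl, hagree, .inl ⟨o, rfl⟩⟩
    · -- the leader performs a step of its own
      simp only at hs hst
      obtain ⟨rfl, h, hh, ⟨rfl, rfl⟩ | ⟨rfl, rfl⟩⟩ := mem_lControl_sync.1 hs
      · obtain ⟨rfl, -⟩ := hmode
        exact ⟨_, some (.leader o'), P, .leader hst hh, .inl ⟨_, logOp_write_act _, rfl⟩,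
          rfl, rfl, rfl, hagree, rfl, .inr (.inl ⟨o', rfl⟩)⟩
      · obtain ⟨rfl, -⟩ := hmode
        exact ⟨_, some (.leader o'), P, .leader hst hh, .inl ⟨_, logOp_write_act _, rfl⟩,
          rfl, rfl, rfl, hagree, .inr ⟨o', rfl⟩⟩
  · simp only [logAct_contrib, Option.none_or]
    simp only at hr hN
    obtain ⟨s₀, P', rfl, rfl⟩ := exists_eq_cons_of_map_fst_eq hN
    have hP' : ∀ p ∈ P', Agree sys mode.IsStrict p := fun p hp =>
      hagree p (Multiset.mem_cons_of_mem hp)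
    have hp := hagree _ (Multiset.mem_cons_self _ _)
    have hcons : ∀ p, Agree sys mode.IsStrict p → ∀ q ∈ p ::ₘ P', Agree sys mode.IsStrict q := by
      intro p hp q hq
      rcases Multiset.mem_cons.1 hq with rfl | hq
      · exact hp
      · exact hP' q hq
    rcases hs with ⟨hs, hst⟩ | ⟨o, hs, hst⟩
    · simp only at hs hst
      subst hst
      rcases mem_cControl_loc.1 hs with ⟨o, rfl, rfl, rfl⟩ | ⟨o, rfl, rfl, rfl⟩ |
        ⟨o, h, rfl, rfl, rfl⟩
      · refine ⟨_, none, ((.wait o, s'), s₀) ::ₘ P', rfl, .inr ⟨rfl, .inl rfl⟩, by simp, by simp,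
          rfl, hcons _ ?_, hmode.request hp⟩
        exact hp.imp_right And.right
      · rw [Op.mem_views_read] at hr
        subst hr
        have hm' := hmode.cons (p' := ((.passive, s'), s')) (by simp [Msg.IsReq])
        rcases hp with hp | rfl
        · -- the contributor performs its operation only now
          cases mode with
          | idle h =>
            obtain ⟨rfl, ⟨o', h1, -⟩ | ⟨o', h1⟩ | ⟨o', h1, h2, rfl⟩⟩ := hmode
            · simp at h1
            · simp at h1
            · simp only [Msg.toFin_inj, Msg.act.injEq, Act.contrib.injEq] at h1
              subst h1
              refine ⟨⟨s' ::ₘ P'.map Prod.snd, _, o.val⟩, some (.contrib o),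
                ((.passive, s'), s') ::ₘ P', ?_, .inr ⟨rfl, .inr ⟨.contrib o, trivial, rfl, h2⟩⟩,
                by simp, by simp, rfl, hcons _ rfl, hm'⟩
              rw [Multiset.map_cons]
              exact .contrib hp o.val_mem_views
          | ack o' =>
            obtain ⟨-, -, o'', h1⟩ := hmode
            simp at h1
          | ended h => rcases hmode with ⟨-, h1 | ⟨o', h1⟩⟩ <;> simp at h1
          | dead => rcases hmode with ⟨o', h1⟩ | ⟨o', h1⟩ <;> simp at h1
        · exact ⟨_, none, ((.passive, s'), s') ::ₘ P', rfl, .inr ⟨rfl, .inl rfl⟩, by simp, by simp,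
            rfl, hcons _ rfl, hm'⟩
      · rw [Op.mem_views_read] at hr
        subst hr
        have hm' := hmode.cons (p' := ((.pend o, s'), s₀)) (by simp [Msg.IsReq])
        have hmd : ¬ mode.IsStrict := by
          cases mode with
          | idle _ => rcases hmode with ⟨-, ⟨o', h1, -⟩ | ⟨o', h1⟩ | ⟨o', h1, -⟩⟩ <;> simp at h1
          | ack o' =>
            obtain ⟨-, -, o'', h1⟩ := hmode
            simp at h1
          | ended _ => exact id
          | dead => exact id
        exact ⟨_, none, ((.pend o, s'), s₀) ::ₘ P', rfl, .inr ⟨rfl, .inl rfl⟩, by simp, by simp,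
          rfl, hcons _ (hp.imp_right fun h => ⟨hmd, h⟩), hm'⟩
    · simp only at hs hst
      obtain ⟨rfl, rfl, h, hh, x, hx, rfl⟩ := mem_cControl_sync.1 hs
      rw [Op.mem_views_read] at hr
      subst hr
      have hm' := hmode.cons (p' := ((.pend o, s'), s₀)) (not_isReq_of_mem_leaderMsgs hx)
      obtain rfl : s = s₀ := hp
      exact ⟨_, none, ((.pend o, s'), s) ::ₘ P', rfl, .inr ⟨rfl, .inl rfl⟩, by simp, by simp,
        rfl, hcons _ (.inl hst), hm'⟩

theorem Simulates.initial (n : ℕ) :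
    Simulates sys ((protocol sys).initial n) (sys.initial n) none
      (Multiset.replicate n ((.passive, sys.C.init), sys.C.init)) := by
  refine ⟨?_, ?_, rfl, ?_, rfl, .inr (.inl ⟨_, rfl⟩)⟩
  · simp [System.initial, protocol, Control.product, cControl]
  · simp [System.initial]
  · intro p hp
    rw [Multiset.eq_of_mem_replicate hp]
    rfl

end Soundness

end ParamSys

namespace ParamSys

section Soundness

variable {k : ℕ} {S T : Type*} {sys : System (Fin k) S T}

theorem exists_simulation_of_finRun {n : ℕ} {l : List (Act (Fin (7 * k)))}
    {d : Config (Fin (7 * k)) (CMode k × S) (LMode k × T)}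
    (h : (protocol sys).FinRun ((protocol sys).initial n) l d) :
    ∃ c w P, sys.FinRun (sys.initial n) w c ∧
      Simulates sys d c (l.filterMap logAct).getLast? P ∧
      Word.ListExpansion Act.IsContrib (l.filterMap logAct) w := by
  refine System.FinRun.snoc_induction (p := fun l d => ∃ c w P, sys.FinRun (sys.initial n) w c ∧
    Simulates sys d c (l.filterMap logAct).getLast? P ∧
    Word.ListExpansion Act.IsContrib (l.filterMap logAct) w) ?_ ?_ h
  · exact ⟨_, [], _, .nil _, .initial n, .nil⟩
  · intro l d b d' ih hs
    obtain ⟨c, w, P, hrun, hsim, hexp⟩ := ih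
    obtain ⟨c', em, P', hem, hrule, hsim'⟩ := hsim.step hs
    rcases hrule with ⟨a, ha, rfl⟩ | ⟨ha, rfl | ⟨a, hac, rfl, hlast⟩⟩
    · refine ⟨c', w ++ [a], P', hrun.append (System.Step.finRun hem), ?_, ?_⟩
      · simpa [List.filterMap_append, ha] using hsim'
      · simpa [List.filterMap_append, ha] using hexp.snoc _ _ a
    · obtain rfl : c' = c := hem
      refine ⟨c', w, P', hrun, ?_, ?_⟩
      · simpa [List.filterMap_append, ha] using hsim'
      · simpa [List.filterMap_append, ha] using hexp
    · refine ⟨c', w ++ [a], P', hrun.append (System.Step.finRun hem), ?_, ?_⟩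
      · simpa [List.filterMap_append, ha] using hsim'
      · obtain ⟨l₀, hl₀⟩ := List.getLast?_eq_some_iff.1 hlast
        rw [hl₀] at hexp
        simpa [List.filterMap_append, ha, hl₀] using Word.ListExpansion.dup _ _ a hac hexp

theorem mode_eq_ended {n : ℕ} {l : List (Act (Fin (7 * k)))}
    {d : Config (Fin (7 * k)) (CMode k × S) (LMode k × T)}
    (h : (protocol sys).FinRun ((protocol sys).initial n) l d) {y : List (Op (Fin (7 * k)))}
    {g : Fin k} (hl : l.filterMap Act.leader? = y ++ [.write (Msg.toFin (.done g))]) :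
    d.leader.1 = .ended g := by
  refine System.FinRun.snoc_induction (p := fun l d => ∀ y,
    l.filterMap Act.leader? = y ++ [.write (Msg.toFin (.done g))] → d.leader.1 = .ended g)
    ?_ ?_ h y hl
  · intro y hl
    simp at hl
  · intro l d b d' ih hs y hl
    rw [System.step_iff] at hs
    rcases hs with ⟨o, ⟨m', t'⟩, rfl, hs, hr, rfl⟩ |
      ⟨o, s, s', N, rfl, hN, hs, hr, rfl⟩
    · simp only [List.filterMap_append, List.filterMap_cons, Act.leader?, List.filterMap_nil] at hl
      obtain ⟨-, hl⟩ := List.append_inj' hl rfl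
      simp only [List.cons.injEq, and_true] at hl
      subst hl
      rcases hs with ⟨hs, rfl⟩ | ⟨o', hs, hst⟩
      · rcases mem_lControl_loc.1 hs with ⟨o, h1, h2, h3⟩ | ⟨o, h, hh, h1, h2, h3⟩ |
          ⟨h, h1, h2, h3⟩ | ⟨h, o, h1, h2, h3⟩
        · simp at h2
        · simp at h2
        · simp only [Op.write.injEq, Msg.toFin_inj, Msg.done.injEq] at h2
          subst h2
          exact h3
        · simp at h2
      · obtain ⟨h, -⟩ := mem_lControl_sync.1 hs
        simp at h
    · refine ih y ?_
      rw [List.filterMap_append] at hl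
      exact (List.append_nil _).symm.trans hl

/-- If the leader has declared the end of the simulated run and the new system cannot move, then
every contributor has performed its operation, and the original system cannot move. -/
theorem Simulates.deadlock {d : Config (Fin (7 * k)) (CMode k × S) (LMode k × T)}
    {c : Config (Fin k) S T} {last : Option (Act (Fin k))} {P : Multiset ((CMode k × S) × S)}
    (h : Simulates sys d c last P) {g : Fin k} (hm : d.leader.1 = .ended g)
    (hd : ¬ ∃ a d', (protocol sys).Step d a d') : ¬ ∃ a c', sys.Step c a c' := by
  obtain ⟨hnew, hold, hleader, hagree, hmode⟩ := h
  obtain ⟨M, t, g'⟩ := c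
  obtain ⟨M', ⟨mode, t'⟩, r⟩ := d
  simp only at hnew hold hleader hagree hmode hm
  subst hnew hold hleader hm
  obtain ⟨rfl, rfl | ⟨o, rfl⟩⟩ := hmode
  swap
  · exact absurd ⟨_, _, System.Step.leader (t' := (.dead, t)) (.inl ⟨mem_lControl_loc.2
      (.inr (.inr (.inr ⟨g, o, rfl, rfl, rfl⟩))), rfl⟩) (by simp [Op.views])⟩ hd
  have hpass : ∀ p ∈ P, p.1.1 = .passive := by
    rintro ⟨⟨m, s⟩, s₀⟩ hp
    obtain ⟨P', rfl⟩ := Multiset.exists_cons_of_mem hp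
    rw [Multiset.map_cons] at hd
    cases m with
    | passive => rfl
    | pend o =>
      exact absurd ⟨_, _, System.Step.contrib (s' := (.wait o, s)) (.inl ⟨mem_cControl_loc.2
        (.inl ⟨o, rfl, rfl, rfl⟩), rfl⟩) (by simp [Op.views])⟩ hd
    | wait o =>
      exact absurd ⟨_, _, System.Step.contrib (s' := (.pend o, s)) (.inl ⟨mem_cControl_loc.2
        (.inr (.inr ⟨o, g, rfl, rfl, rfl⟩)), rfl⟩) (by simp [Op.views])⟩ hd
  rintro ⟨a, c', hs⟩
  rcases (System.step_iff _).1 hs with ⟨o, t', rfl, hst, hr, rfl⟩ | ⟨o, s, s', N, rfl, hN, hst, hr, rfl⟩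
  · exact hd ⟨_, _, System.Step.leader (t' := (.dead, t')) (.inr ⟨o, mem_lControl_sync.2
      ⟨rfl, g, hr, .inr ⟨rfl, rfl⟩⟩, hst⟩) (by simp [Op.views])⟩
  · simp only at hN hr
    have hsm : s ∈ P.map Prod.snd := by simp [hN]
    obtain ⟨⟨⟨m, s₁⟩, s₀⟩, hp, rfl⟩ := Multiset.mem_map.1 hsm
    obtain rfl : m = .passive := hpass _ hp
    obtain rfl : s₁ = s₀ := hagree _ hp
    obtain ⟨P', rfl⟩ := Multiset.exists_cons_of_mem hp
    rw [Multiset.map_cons] at hd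
    exact hd ⟨_, _, System.Step.contrib (s' := (.pend o, s')) (.inr ⟨o, mem_cControl_sync.2
        ⟨rfl, rfl, g, hr, Msg.done g, by simp [leaderMsgs], rfl⟩, hst⟩) (by simp [Op.views])⟩

/-- Skipping the positions of a sequence of configurations at which nothing happens. -/
theorem infRun_of_emissions {c : ℕ → Config (Fin k) S T} {em : ℕ → Option (Act (Fin k))}
    {w : ℕ → Act (Fin k)} (h : ∀ n, Emits sys (c n) (em n) (c (n + 1)))
    (hw : (Word.inf em).HasProj id (.inf w)) :
    ∃ c' : ℕ → Config (Fin k) S T, c' 0 = c 0 ∧ sys.InfRun c' w := by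
  obtain ⟨f, hf, h1, h2⟩ := hw
  simp only [id] at h1 h2
  have hnone : ∀ n m, em n = none → c n = m → c (n + 1) = m := by
    intro n m hn hm
    have := h n
    rw [hn] at this
    exact Eq.trans this hm
  refine ⟨fun n => c (f n), ?_, ?_⟩
  · have : ∀ n, n ≤ f 0 → c n = c 0 := by
      intro n
      induction n with
      | zero => simp
      | succ n ih =>
        intro hn
        refine hnone _ _ (h2 _ ?_) (ih (by omega))
        rintro ⟨i, rfl⟩
        have := hf.monotone (Nat.zero_le i)
        omega
    exact this _ le_rfl
  · intro i
    have hstep := h (f i)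
    rw [h1] at hstep
    have : ∀ n, f i + 1 ≤ n → n ≤ f (i + 1) → c n = c (f i + 1) := by
      intro n hn
      induction n, hn using Nat.le_induction with
      | base => simp
      | succ n hn ih =>
        intro hn'
        refine hnone _ _ (h2 _ ?_) (ih (by omega))
        rintro ⟨j, rfl⟩
        have h3 : i < j := hf.lt_iff_lt.1 (by omega)
        have h4 : j < i + 1 := hf.lt_iff_lt.1 (by omega)
        omega
    have h5 : f i < f (i + 1) := hf (by omega)
    change sys.Step (c (f i)) (w i) (c (f (i + 1)))
    rw [this _ h5 le_rfl]
    exact hstep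

theorem protocol_infinitely_many_writes
    {d : ℕ → Config (Fin (7 * k)) (CMode k × S) (LMode k × T)} {b : ℕ → Act (Fin (7 * k))}
    (h : (protocol sys).InfRun d b) (N : ℕ) :
    ∃ i, N ≤ i ∧ ∃ g, b i = .leader (.write g) := by
  refine infinitely_many_leader_writes (cm := Prod.fst) (lm := Prod.fst) (g₀ := sys.ginit)
    ?_ ?_ h N
  · rintro x b y (⟨h, -⟩ | ⟨o, h, -⟩)
    · exact .inl h
    · exact .inr ⟨o, h⟩
  · rintro x b y (⟨h, -⟩ | ⟨o, h, -⟩)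
    · exact .inl h
    · exact .inr ⟨o, h⟩

theorem not_isStrict_step {d d' : Config (Fin (7 * k)) (CMode k × S) (LMode k × T)}
    {b : Act (Fin (7 * k))} (h : (protocol sys).Step d b d') :
    (¬ d.leader.1.IsStrict → ¬ d'.leader.1.IsStrict ∧
      ∀ g, b ≠ .leader (.write (Msg.toFin (.done g)))) ∧
    ((∃ g, b = .leader (.write (Msg.toFin (.done g)))) → ¬ d'.leader.1.IsStrict) := by
  rcases (System.step_iff _).1 h with ⟨o, ⟨m', t'⟩, rfl, hs, hr, rfl⟩ |
      ⟨o, s, s', N, rfl, hN, hs, hr, rfl⟩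
  · obtain ⟨M', ⟨mode, t⟩, r⟩ := d
    rcases hs with ⟨hs, rfl⟩ | ⟨o', hs, hst⟩
    · simp only at hs
      rcases mem_lControl_loc.1 hs with ⟨o, rfl, rfl, rfl⟩ | ⟨o, h, hh, rfl, rfl, rfl⟩ |
        ⟨h, rfl, rfl, rfl⟩ | ⟨h, o, rfl, rfl, rfl⟩ <;> simp [LMode.IsStrict]
    · simp only at hs
      obtain ⟨rfl, h, hh, ⟨rfl, rfl⟩ | ⟨rfl, rfl⟩⟩ := mem_lControl_sync.1 hs <;>
        simp [LMode.IsStrict]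
  · exact ⟨fun h => ⟨h, by simp⟩, by simp⟩

/-- The leader declares the end of the simulated run at most once, and so the log of an infinite
run is infinite. -/
theorem infinitely_many_logs
    {d : ℕ → Config (Fin (7 * k)) (CMode k × S) (LMode k × T)} {b : ℕ → Act (Fin (7 * k))}
    (h : (protocol sys).InfRun d b) (N : ℕ) : ∃ i, N ≤ i ∧ (logAct (b i)).isSome := by
  by_contra hcon
  push Not at hcon
  have hdone : ∀ i, N ≤ i → (∃ g, b i = .leader (.write g)) →
      ∃ g, b i = .leader (.write (Msg.toFin (.done g))) := by
    rintro i hi ⟨r, hr⟩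
    obtain ⟨m, rfl⟩ := Msg.toFin_bijective.2 r
    have h1 := hcon i hi
    rw [hr] at h1
    cases m with
    | act a => simp at h1
    | done g => exact ⟨g, hr⟩
    | req o =>
      rcases (System.step_iff _).1 (h i) with ⟨o', ⟨m', t'⟩, h2, hs, -, -⟩ |
        ⟨o', s, s', N, h2, hN, hs, -, -⟩
      · rw [hr] at h2
        simp only [Act.leader.injEq] at h2
        subst h2
        rcases hs with ⟨hs, -⟩ | ⟨o', hs, -⟩
        · have := mem_lControl_loc.1 hs
          simp at this
        · have := mem_lControl_sync.1 hs
          simp at this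
      · simp [hr] at h2
  obtain ⟨i, hi, hw⟩ := protocol_infinitely_many_writes h N
  have hns : ∀ j, i + 1 ≤ j → ¬ (d j).leader.1.IsStrict := by
    intro j hj
    induction j, hj using Nat.le_induction with
    | base => exact (not_isStrict_step (h i)).2 (hdone i hi hw)
    | succ j hj ih => exact ((not_isStrict_step (h j)).1 ih).1
  obtain ⟨j, hj, hw'⟩ := protocol_infinitely_many_writes h (i + 1)
  obtain ⟨g, hg⟩ := hdone j (by omega) hw'
  exact ((not_isStrict_step (h j)).1 (hns j hj)).2 g hg

theorem exists_simulation_of_infRun {n : ℕ}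
    {d : ℕ → Config (Fin (7 * k)) (CMode k × S) (LMode k × T)} {b : ℕ → Act (Fin (7 * k))}
    (hd : d 0 = (protocol sys).initial n) (h : (protocol sys).InfRun d b) {u : ℕ → Act (Fin k)}
    (hu : (Word.inf b).HasProj logAct (.inf u)) :
    ∃ c w, c 0 = sys.initial n ∧ sys.InfRun c w ∧
      Word.IsExpansion Act.IsContrib (.inf u) (.inf w) := by
  obtain ⟨f, hf0, hf⟩ := exists_seq_of_step
    (p := fun i (x : Config (Fin k) S T × Option (Act (Fin k))) =>
      ∃ P, Simulates sys (d i) x.1 x.2 P)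
    (r := fun i x y => ∃ em, Emits sys x.1 em y.1 ∧ EmissionRule x.2 (logAct (b i)) em ∧
      y.2 = (logAct (b i)).or x.2)
    (a₀ := (sys.initial n, none)) ⟨_, by rw [hd]; exact Simulates.initial n⟩ (by
      rintro i ⟨c, last⟩ ⟨P, hP⟩
      obtain ⟨c', em, P', hem, hrule, hsim⟩ := hP.step (h i)
      exact ⟨(c', _), ⟨P', hsim⟩, em, hem, hrule, rfl⟩)
  choose em hem using fun i => (hf i).2
  have hκ : (Word.inf fun i => logAct (b i)).HasProj id (.inf u) := hu
  have hfreq : ∀ N, ∃ i, N ≤ i ∧ (id (em i)).isSome := by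
    intro N
    obtain ⟨i, hi, hs⟩ := hκ.frequently N
    refine ⟨i, hi, ?_⟩
    rcases (hem i).2.1 with ⟨a, -, h2⟩ | ⟨h1, -⟩
    · simp [h2]
    · simp [h1] at hs
  obtain ⟨w, hw⟩ := Word.exists_hasProj hfreq
  obtain ⟨c, hc0, hc⟩ := infRun_of_emissions (fun i => (hem i).1) hw
  refine ⟨c, w, by rw [hc0, hf0], hc, ?_⟩
  exact Word.isExpansion_of_emissions hw hκ (last := fun i => (f i).2) (by simp [hf0])
    (fun i => (hem i).2.2) (fun i => (hem i).2.1)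

end Soundness

end ParamSys

namespace ParamSys

/-! ### Every run of the original system is simulated by the new one -/

theorem System.FinRun.exists_path {G : Type} {S T : Type*} {sys : System G S T}
    {c c' : Config G S T} {l : List (Act G)} (h : sys.FinRun c l c') :
    ∃ γ : ℕ → Config G S T, γ 0 = c ∧ γ l.length = c' ∧
      ∀ i (hi : i < l.length), sys.Step (γ i) l[i] (γ (i + 1)) := by
  induction h with
  | nil c => exact ⟨fun _ => c, rfl, rfl, by simp⟩
  | cons c c₁ c₂ a l hs _ ih =>
    obtain ⟨γ, h0, h1, h2⟩ := ih
    refine ⟨fun i => i.casesOn c γ, rfl, h1, ?_⟩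
    rintro (_ | i) hi
    · simpa [h0] using hs
    · simpa using h2 i (by simpa using hi)

/-- Concatenation of infinitely many nonempty finite runs; the `i`-th one starts at position
`E i`. -/
theorem System.exists_infRun_of_blocks {G : Type} {S T : Type*} {sys : System G S T}
    {d : ℕ → Config G S T} {blk : ℕ → List (Act G)} (hne : ∀ i, 0 < (blk i).length)
    (h : ∀ i, sys.FinRun (d i) (blk i) (d (i + 1))) :
    ∃ (c : ℕ → Config G S T) (s : ℕ → Act G) (E : ℕ → ℕ), c 0 = d 0 ∧ sys.InfRun c s ∧
      (∀ i, E (i + 1) = E i + (blk i).length) ∧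
      (∀ i r (hr : r < (blk i).length), s (E i + r) = (blk i)[r]) ∧
      ∀ p, ∃ i r, r < (blk i).length ∧ p = E i + r := by
  choose γ hγ0 hγ1 hγ using fun i => (h i).exists_path
  let dec : ℕ → ℕ × ℕ := fun p => Nat.rec (0, 0)
    (fun _ x => if x.2 + 1 < (blk x.1).length then (x.1, x.2 + 1) else (x.1 + 1, 0)) p
  have hdec : ∀ p, dec (p + 1) = if (dec p).2 + 1 < (blk (dec p).1).length
      then ((dec p).1, (dec p).2 + 1) else ((dec p).1 + 1, 0) := fun p => rfl
  have hlt : ∀ p, (dec p).2 < (blk (dec p).1).length := by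
    intro p
    induction p with
    | zero => exact hne 0
    | succ p ih =>
      rw [hdec]
      split_ifs with h
      · exact h
      · exact hne _
  let E : ℕ → ℕ := fun i => ∑ j ∈ Finset.range i, (blk j).length
  have hE : ∀ i, E (i + 1) = E i + (blk i).length := fun i => Finset.sum_range_succ _ _
  have hin : ∀ i, dec (E i) = (i, 0) → ∀ r, r < (blk i).length → dec (E i + r) = (i, r) := by
    intro i hi r
    induction r with
    | zero => intro _; exact hi
    | succ r ih =>
      intro hr
      rw [← Nat.add_assoc, hdec, ih (by omega), if_pos hr]
  have hstart : ∀ i, dec (E i) = (i, 0) := by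
    intro i
    induction i with
    | zero => simp [E, dec]
    | succ i ih =>
      have h1 := hin i ih ((blk i).length - 1) (by have := hne i; omega)
      have h2 : E (i + 1) = E i + ((blk i).length - 1) + 1 := by
        rw [hE]
        have := hne i
        omega
      rw [h2, hdec, h1, if_neg (by simp only; omega)]
  refine ⟨fun p => γ (dec p).1 (dec p).2, fun p => (blk (dec p).1)[(dec p).2]'(hlt p), E,
    hγ0 0, ?_, hE, ?_, ?_⟩
  · intro p
    have h1 := hγ (dec p).1 (dec p).2 (hlt p)
    have h2 : γ (dec (p + 1)).1 (dec (p + 1)).2 = γ (dec p).1 ((dec p).2 + 1) := by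
      rw [hdec]
      split_ifs with h
      · rfl
      · have h3 : (dec p).2 + 1 = (blk (dec p).1).length := by
          have := hlt p
          omega
        simp only [hγ0]
        rw [h3, hγ1]
    show sys.Step _ _ (γ (dec (p + 1)).1 (dec (p + 1)).2)
    rw [h2]
    exact h1
  · intro i r hr
    have h1 := hin i (hstart i) r hr
    simp only [h1]
  · intro p
    induction p with
    | zero => exact ⟨0, 0, hne 0, by simp [E]⟩
    | succ p ih =>
      obtain ⟨i, r, hr, rfl⟩ := ih
      by_cases h : r + 1 < (blk i).length
      · exact ⟨i, r + 1, h, rfl⟩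
      · exact ⟨i + 1, 0, hne _, by rw [hE]; omega⟩

theorem exists_getElem_of_filterMap_eq_singleton {α β : Type*} {f : α → Option β} {l : List α}
    {b : β} (h : l.filterMap f = [b]) :
    ∃ r, ∃ hr : r < l.length, f l[r] = some b ∧
      ∀ r' (hr' : r' < l.length), r' ≠ r → f l[r'] = none := by
  induction l with
  | nil => simp at h
  | cons a l ih =>
    cases ha : f a with
    | none =>
      rw [List.filterMap_cons_none ha] at h
      obtain ⟨r, hr, h1, h2⟩ := ih h
      refine ⟨r + 1, by simpa using hr, by simpa using h1, ?_⟩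
      rintro (_ | r') hr' hne
      · simpa using ha
      · simpa using h2 r' (by simpa using hr') (by omega)
    | some a' =>
      rw [List.filterMap_cons_some ha] at h
      simp only [List.cons.injEq, List.filterMap_eq_nil_iff] at h
      obtain ⟨rfl, h⟩ := h
      refine ⟨0, by simp, by simpa using ha, ?_⟩
      rintro (_ | r') hr' hne
      · simp at hne
      · simpa using h _ (List.getElem_mem _)

theorem Word.hasProj_of_blocks {α β : Type} {π : α → Option β} {blk : ℕ → List α} {s : ℕ → α}
    {E : ℕ → ℕ} {u : ℕ → β} (hE : ∀ i, E (i + 1) = E i + (blk i).length)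
    (hs : ∀ i r (hr : r < (blk i).length), s (E i + r) = (blk i)[r])
    (hp : ∀ p, ∃ i r, r < (blk i).length ∧ p = E i + r)
    (h : ∀ i, (blk i).filterMap π = [u i]) : (Word.inf s).HasProj π (.inf u) := by
  choose pos hpos h1 h2 using fun i => exists_getElem_of_filterMap_eq_singleton (h i)
  refine ⟨fun i => E i + pos i, strictMono_nat_of_lt_succ fun i => ?_, fun i => ?_, fun p hp' => ?_⟩
  · rw [hE]
    have := hpos i
    omega
  · rw [hs i _ (hpos i), h1]
  · obtain ⟨i, r, hr, rfl⟩ := hp p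
    rw [hs i r hr]
    refine h2 i r hr ?_
    rintro rfl
    exact hp' ⟨i, rfl⟩

section Completeness

variable {k : ℕ} {S T : Type*} {sys : System (Fin k) S T}

/-- The configuration of the new system between two simulated steps. -/
def Config.lift (m : Msg k) (c : Config (Fin k) S T) :
    Config (Fin (7 * k)) (CMode k × S) (LMode k × T) :=
  ⟨c.contributors.map (Prod.mk .passive), (.idle c.register, c.leader), m.toFin⟩

/-- The simulation of a step if the register contains the message `m`. -/
def simulation (m : Msg k) : Act (Fin k) → List (Act (Fin (7 * k)))
  | .leader o => [.leader (.write (Msg.toFin (.act (.leader o))))]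
  | .contrib o => [.contrib (.read m.toFin), .contrib (.write (Msg.toFin (.req o))),
      .leader (.read (Msg.toFin (.req o))), .leader (.write (Msg.toFin (.act (.contrib o)))),
      .contrib (.read (Msg.toFin (.act (.contrib o))))]

@[simp]
theorem filterMap_simulation (m : Msg k) (a : Act (Fin k)) :
    (simulation m a).filterMap logAct = [a] := by
  cases a <;> simp [simulation, List.filterMap_cons]

theorem simulation_length_pos (m : Msg k) (a : Act (Fin k)) : 0 < (simulation m a).length := by
  cases a <;> simp [simulation]

theorem finRun_simulation {c c' : Config (Fin k) S T} {a : Act (Fin k)} {m : Msg k}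
    (h : sys.Step c a c') (hm : m ∈ leaderMsgs c.register) :
    (protocol sys).FinRun (c.lift m) (simulation m a) (c'.lift (.act a)) ∧
      Msg.act a ∈ leaderMsgs c'.register := by
  obtain ⟨M, t, g⟩ := c
  rcases (System.step_iff _).1 h with ⟨o, t', rfl, hst, hr, rfl⟩ |
    ⟨o, s, s', N, rfl, hN, hst, hr, rfl⟩
  · refine ⟨?_, mem_leaderMsgs.2 (.inl ⟨_, rfl, rfl⟩)⟩
    simp only at hr hst
    exact System.Step.finRun (.leader (.inr ⟨o, mem_lControl_sync.2
      ⟨rfl, g, hr, .inl ⟨rfl, rfl⟩⟩, hst⟩) (by simp [Op.views]))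
  · refine ⟨?_, mem_leaderMsgs.2 (.inl ⟨_, rfl, rfl⟩)⟩
    simp only at hr hN hm
    subst hN
    simp only [Config.lift, Multiset.map_cons]
    refine .cons _ _ _ _ _ (.contrib (s' := (.pend o, s')) (.inr ⟨o, mem_cControl_sync.2
      ⟨rfl, rfl, g, hr, m, hm, rfl⟩, hst⟩) (by simp [Op.views])) ?_
    refine .cons _ _ _ _ _ (.contrib (s' := (.wait o, s')) (.inl ⟨mem_cControl_loc.2
      (.inl ⟨o, rfl, rfl, rfl⟩), rfl⟩) (by simp [Op.views])) ?_
    refine .cons _ _ _ _ _ (.leader (t' := (.ack o, t)) (.inl ⟨mem_lControl_loc.2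
      (.inr (.inl ⟨o, g, hr, rfl, rfl, rfl⟩)), rfl⟩) (by simp [Op.views, Op.val])) ?_
    refine .cons _ _ _ _ _ (.leader (t' := (.idle o.val, t)) (.inl ⟨mem_lControl_loc.2
      (.inl ⟨o, rfl, rfl, rfl⟩), rfl⟩) (by simp [Op.views])) ?_
    exact .cons _ _ _ _ _ (.contrib (s' := (.passive, s')) (.inl ⟨mem_cControl_loc.2
      (.inr (.inl ⟨o, rfl, rfl, rfl⟩)), rfl⟩) (by simp [Op.views, Op.val])) (.nil _)

theorem initial_protocol (n : ℕ) : (protocol sys).initial n =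
    (sys.initial n).lift (.act (.leader (.write sys.ginit))) := by
  simp [System.initial, protocol, Control.product, cControl, lControl, Config.lift]

theorem exists_finRun_protocol {n : ℕ} {l : List (Act (Fin k))} {c : Config (Fin k) S T}
    (h : sys.FinRun (sys.initial n) l c) :
    ∃ l' m, (protocol sys).FinRun ((protocol sys).initial n) l' (c.lift m) ∧
      m ∈ leaderMsgs c.register ∧ l'.filterMap logAct = l := by
  refine System.FinRun.snoc_induction (p := fun l c => ∃ l' m,
    (protocol sys).FinRun ((protocol sys).initial n) l' (c.lift m) ∧
      m ∈ leaderMsgs c.register ∧ l'.filterMap logAct = l) ?_ ?_ h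
  · refine ⟨[], _, ?_, mem_leaderMsgs.2 (.inl ⟨.leader (.write sys.ginit), rfl, rfl⟩), rfl⟩
    rw [initial_protocol]
    exact .nil _
  · rintro l c a c' ⟨l', m, hrun, hm, rfl⟩ hs
    obtain ⟨h1, h2⟩ := finRun_simulation hs hm
    exact ⟨l' ++ simulation m a, _, hrun.append h1, h2, by simp⟩

/-- If the original system cannot move, then the leader can declare the end of the simulated run,
and nobody can move afterwards. -/
theorem deadlock_protocol {c : Config (Fin k) S T} (h : ¬ ∃ a c', sys.Step c a c') :
    ¬ ∃ a d', (protocol sys).Step ⟨c.contributors.map (Prod.mk .passive),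
      (.ended c.register, c.leader), Msg.toFin (.done c.register)⟩ a d' := by
  obtain ⟨M, t, g⟩ := c
  rintro ⟨b, d', hs⟩
  rw [System.step_iff] at hs
  rcases hs with ⟨o, ⟨m', t'⟩, rfl, hs, hr, rfl⟩ | ⟨o, ⟨m, s⟩, ⟨m', s'⟩, N, rfl, hN, hs, hr, rfl⟩
  · rcases hs with ⟨hs, -⟩ | ⟨o', hs, hst⟩
    · have := mem_lControl_loc.1 hs
      simp only [reduceCtorEq, LMode.ended.injEq, false_and, and_false, exists_false,
        false_or] at this
      obtain ⟨g', o', -, rfl, -⟩ := this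
      simp [Op.views] at hr
    · obtain ⟨rfl, g', hg', ⟨h1, -⟩ | ⟨h1, -⟩⟩ := mem_lControl_sync.1 hs
      · simp at h1
      · simp only [LMode.ended.injEq] at h1
        subst h1
        exact h ⟨_, _, .leader hst hg'⟩
  · simp only at hN hr
    have hmem : (m, s) ∈ M.map (Prod.mk CMode.passive) := by simp [hN]
    obtain ⟨s₀, hs₀, heq⟩ := Multiset.mem_map.1 hmem
    simp only [Prod.mk.injEq] at heq
    obtain ⟨rfl, rfl⟩ := heq
    obtain ⟨M', rfl⟩ := Multiset.exists_cons_of_mem hs₀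
    rcases hs with ⟨hs, -⟩ | ⟨o', hs, hst⟩
    · have := mem_cControl_loc.1 hs
      simp at this
    · obtain ⟨-, -, g', hg', x, hx, rfl⟩ := mem_cControl_sync.1 hs
      simp only [Op.mem_views_read, Msg.toFin_inj] at hr
      subst hr
      simp only [mem_leaderMsgs, reduceCtorEq, false_and, exists_false, Msg.done.injEq,
        false_or] at hx
      subst hx
      exact h ⟨_, _, .contrib hst hg'⟩

theorem exists_infRun_protocol {n : ℕ} {c : ℕ → Config (Fin k) S T} {a : ℕ → Act (Fin k)}
    (hc : c 0 = sys.initial n) (h : sys.InfRun c a) :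
    ∃ d b, d 0 = (protocol sys).initial n ∧ (protocol sys).InfRun d b ∧
      (Word.inf b).HasProj logAct (.inf a) := by
  let m : ℕ → Msg k := fun i => i.casesOn (.act (.leader (.write sys.ginit))) fun i => .act (a i)
  have hm : ∀ i, m i ∈ leaderMsgs (c i).register := by
    intro i
    induction i with
    | zero =>
      rw [hc]
      exact mem_leaderMsgs.2 (.inl ⟨_, rfl, rfl⟩)
    | succ i ih => exact (finRun_simulation (h i) ih).2
  obtain ⟨d, b, E, hd, hrun, hE, hb, hp⟩ := System.exists_infRun_of_blocks
    (d := fun i => (c i).lift (m i)) (blk := fun i => simulation (m i) (a i))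
    (fun i => simulation_length_pos _ _) (fun i => (finRun_simulation (h i) (hm i)).1)
  refine ⟨d, b, ?_, hrun, Word.hasProj_of_blocks hE hb hp fun i => filterMap_simulation _ _⟩
  rw [hd, hc, initial_protocol]
  rfl

end Completeness

/-! ### Correctness of the protocol -/

section Protocol

variable {k : ℕ} {S T : Type*} {sys : System (Fin k) S T}

theorem filterMap_logAct (l : List (Act (Fin (7 * k)))) :
    l.filterMap logAct = (l.filterMap Act.leader?).filterMap logOp := by
  rw [List.filterMap_filterMap]
  rfl

theorem protocol_finite_iff {P : Set (Word (Act (Fin k)))} (hP : IsExpanding P) :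
    (∃ u : Word _, u.IsFinite ∧ sys.IsMaximalTrace u ∧ u ∈ P) ↔
      ∃ u' : Word _, u'.IsFinite ∧ (protocol sys).IsMaximalTrace u' ∧
        ∃ v ∈ counterpart P, u'.HasProj Act.leader? v := by
  constructor
  · rintro ⟨l | s, hfin, ⟨n, c, hrun, hdead⟩, hu⟩
    · obtain ⟨l', m, hrun', hm, rfl⟩ := exists_finRun_protocol hrun
      have hstep : (protocol sys).Step (c.lift m) (.leader (.write (Msg.toFin (.done c.register))))
          ⟨c.contributors.map (Prod.mk .passive), (.ended c.register, c.leader),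
            Msg.toFin (.done c.register)⟩ :=
        System.Step.leader (g := m.toFin) (.inl ⟨mem_lControl_loc.2
          (.inr (.inr (.inl ⟨c.register, rfl, rfl, rfl⟩))), rfl⟩) (by simp [Op.views])
      refine ⟨.fin (l' ++ [.leader (.write (Msg.toFin (.done c.register)))]), trivial,
        ⟨n, _, hrun'.append hstep.finRun, deadlock_protocol hdead⟩,
        .fin (l'.filterMap Act.leader? ++ [.write (Msg.toFin (.done c.register))]),
        ⟨_, _, rfl, ?_⟩, ?_⟩
      · rw [← filterMap_logAct]
        exact hu
      · simp [Word.HasProj, Act.leader?]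
    · exact hfin.elim
  · rintro ⟨l' | s', hfin, ⟨n, d, hrun, hdead⟩, v, hv, hproj⟩
    · obtain v | v := v
      · obtain ⟨y, g, rfl, hy⟩ := hv
        have hproj : y ++ _ = l'.filterMap Act.leader? := hproj
        obtain ⟨c, w, P', hrun', hsim, hexp⟩ := exists_simulation_of_finRun hrun
        refine ⟨.fin w, trivial, ⟨n, c, hrun', hsim.deadlock (mode_eq_ended hrun hproj.symm) hdead⟩,
          hP _ _ ?_ hexp.isExpansion⟩
        rw [filterMap_logAct, ← hproj]
        simpa using hy
      · exact hproj.elim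
    · exact hfin.elim

theorem leader?_frequently {d : ℕ → Config (Fin (7 * k)) (CMode k × S) (LMode k × T)}
    {b : ℕ → Act (Fin (7 * k))} (h : (protocol sys).InfRun d b) (N : ℕ) :
    ∃ i, N ≤ i ∧ (Act.leader? (b i)).isSome := by
  obtain ⟨i, hi, g, hg⟩ := protocol_infinitely_many_writes h N
  exact ⟨i, hi, by simp [hg, Act.leader?]⟩

theorem protocol_infinite_iff {P : Set (Word (Act (Fin k)))} (hP : IsExpanding P) :
    (∃ u : Word _, u.IsInfinite ∧ sys.IsMaximalTrace u ∧ u ∈ P) ↔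
      ∃ u' : Word _, u'.IsInfinite ∧ (protocol sys).IsMaximalTrace u' ∧
        ∃ v ∈ counterpart P, u'.HasProj Act.leader? v := by
  constructor
  · rintro ⟨l | s, hinf, ⟨n, c, hc, hrun⟩, hu⟩
    · exact hinf.elim
    · obtain ⟨d, b, hd, hrun', hproj⟩ := exists_infRun_protocol hc hrun
      obtain ⟨v, hv⟩ := Word.exists_hasProj (leader?_frequently hrun')
      exact ⟨.inf b, trivial, ⟨n, d, hd, hrun'⟩, .inf v, ⟨s, hv.comp_iff.1 hproj, hu⟩, hv⟩
  · rintro ⟨l | b, hinf, ⟨n, d, hd, hrun⟩, v | v, hv, hproj⟩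
    · exact hinf.elim
    · exact hinf.elim
    · exact absurd hproj (Word.not_hasProj_fin (leader?_frequently hrun))
    · obtain ⟨u, hlog, hu⟩ := hv
      obtain ⟨c, w, hc, hrun', hexp⟩ := exists_simulation_of_infRun hd hrun
        (hproj.comp_iff.2 hlog)
      exact ⟨.inf w, trivial, ⟨n, c, hc, hrun'⟩, hP _ _ hu hexp⟩

theorem protocol_hasInfiniteRun_iff : (protocol sys).HasInfiniteRun ↔ sys.HasInfiniteRun := by
  constructor
  · rintro ⟨n, d, b, hd, hrun⟩
    obtain ⟨u, hu⟩ := Word.exists_hasProj (infinitely_many_logs hrun)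
    obtain ⟨c, w, hc, hrun', -⟩ := exists_simulation_of_infRun hd hrun hu
    exact ⟨n, c, w, hc, hrun'⟩
  · rintro ⟨n, c, a, hc, hrun⟩
    obtain ⟨d, b, hd, hrun', -⟩ := exists_infRun_protocol hc hrun
    exact ⟨n, d, b, hd, hrun'⟩

end Protocol

end ParamSys

namespace ParamSys

namespace Word

variable {α β : Type}

theorem get?_isSome_of_le {v : Word α} {i j : ℕ} (h : (v.get? j).isSome) (hij : i ≤ j) :
    (v.get? i).isSome := by
  cases v with
  | fin l =>
    simp only [get?, Option.isSome_iff_ne_none, ne_eq, List.getElem?_eq_none_iff] at h ⊢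
    omega
  | inf s => rfl

/-- The word `u` is the projection of `v`, and `cnt i` is the number of letters of `u` that come
from positions before `i`. -/
structure Tracks (π : α → Option β) (v : Word α) (u : Word β) (cnt : ℕ → ℕ) : Prop where
  zero : cnt 0 = 0
  keep : ∀ i a, (v.get? i).bind π = some a → cnt (i + 1) = cnt i + 1 ∧ u.get? (cnt i) = some a
  skip : ∀ i, (v.get? i).bind π = none → cnt (i + 1) = cnt i
  surj : ∀ n, (u.get? n).isSome → ∃ i, cnt i = n ∧ ((v.get? i).bind π).isSome

theorem tracks_fin (π : α → Option β) (l : List α) :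
    Tracks π (fin l) (fin (l.filterMap π)) fun i => ((l.take i).filterMap π).length := by
  refine ⟨by simp, ?_, ?_, ?_⟩
  · intro i a h
    obtain ⟨b, hb, hba⟩ := Option.bind_eq_some_iff.1 h
    simp only [get?] at hb
    obtain ⟨hi, rfl⟩ := List.getElem?_eq_some_iff.1 hb
    constructor
    · rw [← List.take_append_getElem hi, List.filterMap_append, List.length_append,
        List.filterMap_cons_some hba]
      rfl
    · have : l.filterMap π = (l.take i).filterMap π ++ a :: (l.drop (i + 1)).filterMap π := by
        rw [← List.filterMap_cons_some hba, ← List.drop_eq_getElem_cons hi,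
          ← List.filterMap_append, List.take_append_drop]
      simp only [get?]
      rw [this]
      simp
  · intro i h
    simp only [get?] at h
    cases hb : l[i]? with
    | none => simp [List.take_add_one, hb]
    | some b =>
      have : π b = none := by simpa [hb] using h
      simp [List.take_add_one, List.filterMap_append, hb, this]
  · intro n hn
    simp only [get?] at hn ⊢
    induction l generalizing n with
    | nil => simp at hn
    | cons a l ih =>
      cases ha : π a with
      | none =>
        obtain ⟨i, h1, h2⟩ := ih n (by simpa [ha] using hn)
        exact ⟨i + 1, by simpa [ha] using h1, by simpa using h2⟩
      | some b =>
        cases n with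
        | zero => exact ⟨0, by simp, by simp [ha]⟩
        | succ n =>
          obtain ⟨i, h1, h2⟩ := ih n (by simpa [ha] using hn)
          exact ⟨i + 1, by simpa [ha] using h1, by simpa using h2⟩

theorem HasProj.exists_tracks {π : α → Option β} {s : ℕ → α} {u : ℕ → β}
    (h : (inf s).HasProj π (inf u)) : ∃ cnt, Tracks π (inf s) (inf u) cnt := by
  obtain ⟨e, he, h1, h2⟩ := h
  let cnt : ℕ → ℕ := fun i => Nat.rec 0 (fun i c => if (π (s i)).isSome then c + 1 else c) i
  have hcnt : ∀ i, cnt (i + 1) = if (π (s i)).isSome then cnt i + 1 else cnt i := fun i => rfl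
  have hsucc : ∀ n, cnt (e n) = n → ∀ i, e n < i → i ≤ e (n + 1) → cnt i = n + 1 := by
    intro n hn i hi
    induction i, hi using Nat.le_induction with
    | base => intro _; simp [hcnt, h1, hn]
    | succ i hi ih =>
      intro hi'
      have : i ∉ Set.range e := by
        rintro ⟨m, rfl⟩
        have h3 : n < m := he.lt_iff_lt.1 (by omega)
        have h4 : m < n + 1 := he.lt_iff_lt.1 (by omega)
        omega
      simp [hcnt, h2 i this, ih (by omega)]
  have hcnte : ∀ n, cnt (e n) = n := by
    intro n
    induction n with
    | zero =>
      have : ∀ i, i ≤ e 0 → cnt i = 0 := by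
        intro i
        induction i with
        | zero => intro _; rfl
        | succ i ih =>
          intro hi
          have : i ∉ Set.range e := by
            rintro ⟨m, rfl⟩
            have := he.monotone (Nat.zero_le m)
            omega
          simp [hcnt, h2 i this, ih (by omega)]
      exact this _ le_rfl
    | succ n ih => exact hsucc n ih _ (he (by omega)) le_rfl
  refine ⟨cnt, rfl, ?_, ?_, ?_⟩
  · intro i a ha
    simp only [get?, Option.bind_some] at ha
    have : i ∈ Set.range e := by
      by_contra hcon
      simp [h2 i hcon] at ha
    obtain ⟨n, rfl⟩ := this
    refine ⟨by simp [hcnt, ha], ?_⟩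
    rw [hcnte, get?, ← h1, ha]
  · intro i hi
    simp only [get?, Option.bind_some] at hi
    simp [hcnt, hi]
  · intro n _
    exact ⟨e n, hcnte n, by simp [get?, h1]⟩

namespace Tracks

variable {π : α → Option β} {v : Word α} {u : Word β} {cnt : ℕ → ℕ} (h : Tracks π v u cnt)
include h

theorem le_succ (i : ℕ) : cnt i ≤ cnt (i + 1) := by
  cases hi : (v.get? i).bind π with
  | none => exact (h.skip i hi).ge
  | some a => have := (h.keep i a hi).1; omega

theorem monotone : Monotone cnt := monotone_nat_of_le_succ h.le_succ

/-- Every letter of `u` at a position not before `cnt p` comes from a position not before `p`. -/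
theorem exists_ge {n p : ℕ} (hn : (u.get? n).isSome) (hp : cnt p ≤ n) :
    ∃ i, p ≤ i ∧ cnt i = n ∧ ((v.get? i).bind π).isSome := by
  obtain ⟨i, hi, hs⟩ := h.surj n hn
  refine ⟨i, ?_, hi, hs⟩
  by_contra hlt
  obtain ⟨a, ha⟩ := Option.isSome_iff_exists.1 hs
  have h1 := (h.keep i a ha).1
  have h2 : cnt (i + 1) ≤ cnt p := h.monotone (by omega)
  omega

theorem eq_of_skip {p j : ℕ} (hpj : p ≤ j)
    (hs : ∀ r, p ≤ r → r < j → (v.get? r).bind π = none) : cnt j = cnt p := by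
  induction j, hpj using Nat.le_induction with
  | base => rfl
  | succ j hpj ih =>
    rw [h.skip j (hs j hpj (by omega)), ih fun r h1 h2 => hs r h1 (by omega)]

theorem skip_of_eq {p j r : ℕ} (hpj : cnt j = cnt p) (hr : p ≤ r) (hrj : r < j) :
    (v.get? r).bind π = none := by
  cases hb : (v.get? r).bind π with
  | none => rfl
  | some a =>
    have h1 := (h.keep r a hb).1
    have h2 : cnt (r + 1) ≤ cnt j := h.monotone (by omega)
    have h3 := h.monotone hr
    omega

theorem get?_isSome {i : ℕ} (hi : ((v.get? i).bind π).isSome) : (u.get? (cnt i)).isSome := by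
  obtain ⟨a, ha⟩ := Option.isSome_iff_exists.1 hi
  simp [(h.keep i a ha).2]

theorem exists_ge_iff {p : ℕ} :
    (∃ j, p ≤ j ∧ ((v.get? j).bind π).isSome) ↔ (u.get? (cnt p)).isSome := by
  constructor
  · rintro ⟨j, hj, hs⟩
    exact get?_isSome_of_le (h.get?_isSome hs) (h.monotone hj)
  · intro hs
    obtain ⟨i, hi, -, hs⟩ := h.exists_ge hs le_rfl
    exact ⟨i, hi, hs⟩

end Tracks

end Word

end ParamSys

namespace ParamSys

/-! ### Automata for the new property -/

/-- The letters by which the leader announces nothing. -/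
def silentOps (k : ℕ) : List (Op (Fin (7 * k))) :=
  (List.finRange (7 * k)).map .read ++ (List.finRange k).map (fun g => .write (Msg.toFin (.done g))) ++
    (Op.all k).map fun o => .write (Msg.toFin (.req o))

theorem mem_silentOps {k : ℕ} {b : Op (Fin (7 * k))} : b ∈ silentOps k ↔ logOp b = none := by
  cases b with
  | read r => simp [silentOps]
  | write r =>
    obtain ⟨m, rfl⟩ := Msg.toFin_bijective.2 r
    cases m <;> simp [silentOps, Op.mem_all]

/-- The element `q` of `Fin n` together with a flag, in a set with one further element `extra n`. -/
def withFlag {n : ℕ} (f : Bool) (q : Fin n) : Fin (2 * n + 1) :=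
  ⟨q + n * f.toNat, by cases f <;> simp <;> omega⟩

/-- The element of `Fin (2 * n + 1)` without flag. -/
def extra (n : ℕ) : Fin (2 * n + 1) := Fin.last _

@[simp]
theorem withFlag_inj {n : ℕ} {f f' : Bool} {q q' : Fin n} :
    withFlag f q = withFlag f' q' ↔ f = f' ∧ q = q' := by
  simp only [withFlag, Fin.ext_iff]
  cases f <;> cases f' <;> simp <;> omega

@[simp]
theorem withFlag_ne_extra {n : ℕ} {f : Bool} {q : Fin n} : withFlag f q ≠ extra n := by
  simp only [withFlag, extra, ne_eq, Fin.ext_iff, Fin.val_last]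
  cases f <;> simp <;> omega

namespace BuchiAut

variable {k : ℕ} (B : BuchiAut (Act (Fin k)))

/-- The transitions of the new automaton. Its states are those of `B` with a flag which tells
whether the last letter has announced an action, and a state after the final declaration. It skips
the silent letters, reads an announced action like `B` reads this action, and reads the final
declaration in the final states of `B`. -/
def transformTrans :
    List (Fin (2 * B.numStates + 1) × Op (Fin (7 * k)) × Fin (2 * B.numStates + 1)) :=
  (silentOps k).flatMap (fun b => (List.finRange B.numStates).flatMap fun q =>
      [(withFlag false q, b, withFlag false q), (withFlag true q, b, withFlag false q)]) ++
    (B.trans.flatMap (fun τ =>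
      [(withFlag false τ.1, .write (Msg.toFin (.act τ.2.1)), withFlag true τ.2.2),
        (withFlag true τ.1, .write (Msg.toFin (.act τ.2.1)), withFlag true τ.2.2)]) ++
    B.final.flatMap fun q => (List.finRange k).flatMap fun g =>
      [(withFlag false q, .write (Msg.toFin (.done g)), extra B.numStates),
        (withFlag true q, .write (Msg.toFin (.done g)), extra B.numStates)])

/-- The automaton for the logs that are in the language of `B`. The flag excludes infinite words
with finite log. -/
def transform : BuchiAut (Op (Fin (7 * k))) where
  numStates := 2 * B.numStates + 1
  trans := B.transformTrans
  init := withFlag false B.init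
  final := [extra B.numStates]
  repeating := B.repeating.map (withFlag true)

variable {B}

theorem mem_transform_trans {x y : Fin (2 * B.numStates + 1)} {b : Op (Fin (7 * k))} :
    (x, b, y) ∈ B.transformTrans ↔
      (∃ f q, logOp b = none ∧ x = withFlag f q ∧ y = withFlag false q) ∨
      (∃ f q q' a, logOp b = some a ∧ (q, a, q') ∈ B.trans ∧ x = withFlag f q ∧
        y = withFlag true q') ∨
      ∃ f, ∃ q ∈ B.final, ∃ g, b = .write (Msg.toFin (.done g)) ∧ x = withFlag f q ∧
        y = extra B.numStates := by
  simp only [transformTrans, List.mem_append, List.mem_flatMap, mem_silentOps, List.mem_finRange,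
    true_and, List.mem_cons, List.not_mem_nil, or_false, Prod.mk.injEq, Bool.exists_bool,
    logOp_eq_some, Prod.exists]
  refine or_congr ?_ (or_congr ?_ ?_)
  · constructor
    · rintro ⟨b', hb, q, ⟨rfl, rfl, rfl⟩ | ⟨rfl, rfl, rfl⟩⟩
      · exact .inl ⟨q, hb, rfl, rfl⟩
      · exact .inr ⟨q, hb, rfl, rfl⟩
    · rintro (⟨q, hb, rfl, rfl⟩ | ⟨q, hb, rfl, rfl⟩)
      · exact ⟨b, hb, q, .inl ⟨rfl, rfl, rfl⟩⟩
      · exact ⟨b, hb, q, .inr ⟨rfl, rfl, rfl⟩⟩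
  · constructor
    · rintro ⟨q, a, q', h, ⟨rfl, rfl, rfl⟩ | ⟨rfl, rfl, rfl⟩⟩
      · exact .inl ⟨q, q', a, rfl, h, rfl, rfl⟩
      · exact .inr ⟨q, q', a, rfl, h, rfl, rfl⟩
    · rintro (⟨q, q', a, rfl, h, rfl, rfl⟩ | ⟨q, q', a, rfl, h, rfl, rfl⟩)
      · exact ⟨q, a, q', h, .inl ⟨rfl, rfl, rfl⟩⟩
      · exact ⟨q, a, q', h, .inr ⟨rfl, rfl, rfl⟩⟩
  · constructor
    · rintro ⟨q, hq, g, ⟨rfl, rfl, rfl⟩ | ⟨rfl, rfl, rfl⟩⟩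
      · exact .inl ⟨q, hq, g, rfl, rfl, rfl⟩
      · exact .inr ⟨q, hq, g, rfl, rfl, rfl⟩
    · rintro (⟨q, hq, g, rfl, rfl, rfl⟩ | ⟨q, hq, g, rfl, rfl, rfl⟩)
      · exact ⟨q, hq, g, .inl ⟨rfl, rfl, rfl⟩⟩
      · exact ⟨q, hq, g, .inr ⟨rfl, rfl, rfl⟩⟩

theorem not_mem_transform_trans_extra {y : Fin (2 * B.numStates + 1)} {b : Op (Fin (7 * k))} :
    (extra B.numStates, b, y) ∉ B.transformTrans := by
  rw [mem_transform_trans]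
  rintro (⟨f, q, -, h, -⟩ | ⟨f, q, -, -, -, -, h, -⟩ | ⟨f, q, -, -, -, h, -⟩) <;>
    exact withFlag_ne_extra h.symm

theorem path_nil_iff {α : Type} {A : BuchiAut α} {q z : Fin A.numStates} :
    A.Path q [] z ↔ q = z := by
  constructor
  · rintro ⟨⟩
    rfl
  · rintro rfl
    exact .nil q

theorem path_cons_iff {α : Type} {A : BuchiAut α} {q z : Fin A.numStates} {a : α} {l : List α} :
    A.Path q (a :: l) z ↔ ∃ q', (q, a, q') ∈ A.trans ∧ A.Path q' l z := by
  constructor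
  · rintro (_ | ⟨_, q', _, _, _, h, h'⟩)
    exact ⟨q', h, h'⟩
  · rintro ⟨q', h, h'⟩
    exact .cons _ _ _ _ _ h h'

theorem path_of_transform_path {l : List (Op (Fin (7 * k)))} {f : Bool} {q : Fin B.numStates}
    (h : B.transform.Path (withFlag f q) l (extra B.numStates)) :
    ∃ y g, l = y ++ [.write (Msg.toFin (.done g))] ∧
      ∃ q' ∈ B.final, B.Path q (y.filterMap logOp) q' := by
  induction l generalizing f q with
  | nil => exact absurd (path_nil_iff.1 h) withFlag_ne_extra
  | cons b l ih =>
    obtain ⟨y, htr, hrest⟩ := path_cons_iff.1 h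
    rcases mem_transform_trans.1 htr with ⟨f', q', hb, h1, rfl⟩ | ⟨f', q₁, q', a, hb, hm, h1, rfl⟩ |
      ⟨f', q', hq', g, rfl, h1, rfl⟩
    · obtain ⟨rfl, rfl⟩ := withFlag_inj.1 h1
      obtain ⟨y, g, rfl, q₂, hq₂, hp⟩ := ih hrest
      exact ⟨b :: y, g, rfl, q₂, hq₂, by rwa [List.filterMap_cons_none hb]⟩
    · obtain ⟨rfl, rfl⟩ := withFlag_inj.1 h1
      obtain ⟨y, g, rfl, q₂, hq₂, hp⟩ := ih hrest
      exact ⟨b :: y, g, rfl, q₂, hq₂, by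
        rw [List.filterMap_cons_some hb]
        exact .cons _ _ _ _ _ hm hp⟩
    · obtain ⟨rfl, rfl⟩ := withFlag_inj.1 h1
      refine ⟨[], g, ?_, q, hq', .nil _⟩
      cases l with
      | nil => rfl
      | cons b l =>
        obtain ⟨y, htr, -⟩ := path_cons_iff.1 hrest
        exact absurd htr not_mem_transform_trans_extra

theorem transform_path_of_path {y : List (Op (Fin (7 * k)))} {f : Bool} {q q' : Fin B.numStates}
    (hq' : q' ∈ B.final) (h : B.Path q (y.filterMap logOp) q') (g : Fin k) :
    B.transform.Path (withFlag f q) (y ++ [.write (Msg.toFin (.done g))]) (extra B.numStates) := by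
  induction y generalizing f q with
  | nil =>
    obtain rfl : q = q' := path_nil_iff.1 h
    exact .cons _ _ _ _ _ (mem_transform_trans.2 (.inr (.inr ⟨f, q, hq', g, rfl, rfl, rfl⟩)))
      (.nil _)
  | cons b y ih =>
    cases hb : logOp b with
    | none =>
      rw [List.filterMap_cons_none hb] at h
      exact .cons _ _ _ _ _ (mem_transform_trans.2 (.inl ⟨f, q, hb, rfl, rfl⟩)) (ih h)
    | some a =>
      rw [List.filterMap_cons_some hb] at h
      obtain ⟨q₁, hm, hp⟩ := path_cons_iff.1 h
      exact .cons _ _ _ _ _ (mem_transform_trans.2 (.inr (.inl ⟨f, q, q₁, a, hb, hm, rfl, rfl⟩)))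
        (ih hp)

theorem transform_accepts_fin {l : List (Op (Fin (7 * k)))} :
    B.transform.Accepts (.fin l) ↔ .fin l ∈ counterpart B.language := by
  constructor
  · rintro ⟨x, hx, hp⟩
    obtain rfl : x = extra B.numStates := List.mem_singleton.1 hx
    obtain ⟨y, g, rfl, q', hq', hp'⟩ := path_of_transform_path hp
    exact ⟨y, g, rfl, q', hq', hp'⟩
  · rintro ⟨y, g, rfl, q', hq', hp⟩
    exact ⟨extra B.numStates, List.mem_singleton.2 rfl, transform_path_of_path hq' hp g⟩

theorem accepts_of_transform_accepts_inf {s : ℕ → Op (Fin (7 * k))}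
    (h : B.transform.Accepts (.inf s)) : .inf s ∈ counterpart B.language := by
  obtain ⟨ρ, h0, htr, hrep⟩ := h
  have hne : ∀ i, ∃ f q, ρ i = withFlag f q := by
    intro i
    rcases mem_transform_trans.1 (htr i) with ⟨f, q, -, h, -⟩ | ⟨f, q, -, -, -, -, h, -⟩ |
      ⟨f, q, -, -, -, h, -⟩ <;> exact ⟨f, q, h⟩
  choose f q hρ using hne
  have hstep : ∀ i, (logOp (s i) = none ∧ f (i + 1) = false ∧ q (i + 1) = q i) ∨
      ∃ a, logOp (s i) = some a ∧ f (i + 1) = true ∧ (q i, a, q (i + 1)) ∈ B.trans := by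
    intro i
    rcases mem_transform_trans.1 (htr i) with ⟨f', q', hb, h1, h2⟩ |
      ⟨f', q₁, q', a, hb, hm, h1, h2⟩ | ⟨f', q', hq', g, hb, h1, h2⟩
    · rw [hρ] at h1 h2
      obtain ⟨rfl, rfl⟩ := withFlag_inj.1 h1
      exact .inl ⟨hb, withFlag_inj.1 h2⟩
    · rw [hρ] at h1 h2
      obtain ⟨rfl, rfl⟩ := withFlag_inj.1 h1
      obtain ⟨h3, rfl⟩ := withFlag_inj.1 h2
      exact .inr ⟨a, hb, h3, hm⟩
    · rw [hρ] at h2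
      exact absurd h2 withFlag_ne_extra
  have hrep' : ∀ N, ∃ i, N ≤ i ∧ (logOp (s i)).isSome ∧ q (i + 1) ∈ B.repeating := by
    intro N
    obtain ⟨i, hi, hmem⟩ := hrep (N + 1)
    obtain ⟨r, hr, heq⟩ := List.mem_map.1 hmem
    obtain ⟨i, rfl⟩ : ∃ j, i = j + 1 := ⟨i - 1, by omega⟩
    rw [hρ] at heq
    obtain ⟨h1, rfl⟩ := withFlag_inj.1 heq
    refine ⟨i, by omega, ?_, hr⟩
    rcases hstep i with ⟨-, h2, -⟩ | ⟨a, h2, -⟩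
    · simp [h2] at h1
    · simp [h2]
  obtain ⟨u, hu⟩ := Word.exists_hasProj (π := logOp) (s := s) fun N => by
    obtain ⟨i, hi, hs, -⟩ := hrep' N
    exact ⟨i, hi, hs⟩
  refine ⟨u, hu, ?_⟩
  obtain ⟨e, he, h1, h2⟩ := hu
  have hconst : ∀ n i, n ≤ i → (∀ j, n ≤ j → j < i → j ∉ Set.range e) → q i = q n := by
    intro n i hi
    induction i, hi using Nat.le_induction with
    | base => intro _; rfl
    | succ i hi ih =>
      intro hj
      rw [← ih fun j h3 h4 => hj j h3 (by omega)]
      rcases hstep i with ⟨-, -, h3⟩ | ⟨a, h3, -⟩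
      · exact h3
      · simp [h2 i (hj i hi (by omega))] at h3
  refine ⟨fun n => q (e n), ?_, ?_, ?_⟩
  · change q (e 0) = B.init
    rw [hconst 0 (e 0) (Nat.zero_le _) ?_]
    · have := hρ 0
      rw [h0] at this
      exact (withFlag_inj.1 this).2.symm
    · rintro j - hj ⟨n, rfl⟩
      have := he.monotone (Nat.zero_le n)
      omega
  · intro n
    have hq : q (e (n + 1)) = q (e n + 1) := by
      refine hconst _ _ (he (by omega)) ?_
      rintro j h3 h4 ⟨m, rfl⟩
      have h5 : n < m := he.lt_iff_lt.1 (by omega)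
      have h6 : m < n + 1 := he.lt_iff_lt.1 (by omega)
      omega
    rcases hstep (e n) with ⟨h3, -⟩ | ⟨a, h3, -, h4⟩
    · simp [h1] at h3
    · rw [h1] at h3
      obtain rfl : u n = a := by simpa using h3
      show (q (e n), u n, q (e (n + 1))) ∈ B.trans
      rwa [hq]
  · intro N
    obtain ⟨i, hi, hs, hr⟩ := hrep' (e N)
    have : i ∈ Set.range e := by
      by_contra hcon
      simp [h2 i hcon] at hs
    obtain ⟨n, rfl⟩ := this
    have hn : N ≤ n := he.le_iff_le.1 hi
    refine ⟨n + 1, by omega, ?_⟩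
    show q (e (n + 1)) ∈ B.repeating
    rw [hconst (e n + 1) (e (n + 1)) (he (by omega)) ?_]
    · exact hr
    · rintro j h3 h4 ⟨m, rfl⟩
      have h5 : n < m := he.lt_iff_lt.1 (by omega)
      have h6 : m < n + 1 := he.lt_iff_lt.1 (by omega)
      omega

theorem transform_accepts_inf {s : ℕ → Op (Fin (7 * k))} :
    B.transform.Accepts (.inf s) ↔ .inf s ∈ counterpart B.language := by
  refine ⟨accepts_of_transform_accepts_inf, ?_⟩
  rintro ⟨u, hu, ρ, h0, htr, hrep⟩
  obtain ⟨cnt, ht⟩ := hu.exists_tracks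
  let f : ℕ → Bool := fun i => i.casesOn false fun i => (logOp (s i)).isSome
  refine ⟨fun i => withFlag (f i) (ρ (cnt i)), ?_, ?_, ?_⟩
  · simp [ht.zero, h0, f, transform]
  · intro i
    change (withFlag (f i) (ρ (cnt i)), s i, withFlag (f (i + 1)) (ρ (cnt (i + 1)))) ∈
      B.transformTrans
    cases hb : logOp (s i) with
    | none =>
      rw [ht.skip i (by simpa [Word.get?] using hb)]
      exact mem_transform_trans.2 (.inl ⟨f i, _, hb, rfl, by simp [f, hb]⟩)
    | some a =>
      obtain ⟨h1, h2⟩ := ht.keep i a (by simpa [Word.get?] using hb)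
      obtain rfl : u (cnt i) = a := by simpa [Word.get?] using h2
      rw [h1]
      exact mem_transform_trans.2 (.inr (.inl ⟨f i, _, _, _, hb, htr _, rfl, by simp [f, hb]⟩))
  · intro N
    obtain ⟨n, hn, hr⟩ := hrep (cnt N + 1)
    obtain ⟨n, rfl⟩ : ∃ m, n = m + 1 := ⟨n - 1, by omega⟩
    obtain ⟨i, hi, hcnt, hs⟩ := ht.exists_ge (n := n) (p := N) (by simp [Word.get?]) (by omega)
    obtain ⟨a, ha⟩ := Option.isSome_iff_exists.1 hs
    have h1 := (ht.keep i a ha).1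
    refine ⟨i + 1, by omega, List.mem_map.2 ⟨ρ (n + 1), hr, ?_⟩⟩
    have h2 : f (i + 1) = true := by simpa [f, Word.get?] using hs
    simp only [h2, h1, hcnt]
    rfl

variable (B) in
theorem language_transform : B.transform.language = counterpart B.language := by
  ext (l | s)
  · exact transform_accepts_fin
  · exact transform_accepts_inf

theorem transform_size_le (hk : 0 < k) : B.transform.size ≤ 24 * k * B.size := by
  have h1 : (silentOps k).length = 10 * k := by
    simp [silentOps, Op.all]
    ring
  have h2 : B.transform.trans.length =
      10 * k * (B.numStates * 2) + (B.trans.length * 2 + B.final.length * (k * 2)) := by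
    simp [transform, transformTrans, List.length_flatMap, h1]
  have h3 : B.transform.size = 2 * B.numStates + 1 + B.transform.trans.length + 1 +
      B.repeating.length := by
    simp [size, transform]
  have h4 : 0 < B.numStates := Fin.pos B.init
  rw [h3, h2, size]
  obtain ⟨k, rfl⟩ : ∃ j, k = j + 1 := ⟨k - 1, by omega⟩
  nlinarith [Nat.zero_le (k * B.trans.length), Nat.zero_le (k * B.repeating.length),
    Nat.zero_le (k * B.numStates), Nat.zero_le (k * B.final.length)]

end BuchiAut

end ParamSys

namespace ParamSys

/-! ### Formulas for the new property -/

namespace LTL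

section Basic

variable {α : Type}

def or (φ ψ : LTL α) : LTL α := .neg (.conj (.neg φ) (.neg ψ))

def eventually (φ : LTL α) : LTL α := .until .tt φ

/-- The current letter is in the list. -/
def anyOf : List α → LTL α
  | [] => .neg .tt
  | a :: l => or (.atom a) (anyOf l)

@[simp]
theorem sat_or {w : Word α} {i : ℕ} {φ ψ : LTL α} :
    (or φ ψ).Sat w i ↔ φ.Sat w i ∨ ψ.Sat w i := by
  simp only [or, Sat]
  tauto

@[simp]
theorem sat_eventually {w : Word α} {i : ℕ} {φ : LTL α} :
    φ.eventually.Sat w i ↔ ∃ j, i ≤ j ∧ (w.get? j).isSome ∧ φ.Sat w j := by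
  simp [eventually, Sat]

theorem sat_anyOf {w : Word α} {i : ℕ} {l : List α} :
    (anyOf l).Sat w i ↔ ∃ a ∈ l, w.get? i = some a := by
  induction l with
  | nil => simp [anyOf, Sat]
  | cons a l ih => simp [anyOf, ih, Sat]

theorem size_anyOf (l : List α) : (anyOf l).size = 5 * l.length + 2 := by
  induction l with
  | nil => rfl
  | cons a l ih =>
    simp only [anyOf, or, size, ih, List.length_cons]
    ring

theorem size_pos (φ : LTL α) : 0 < φ.size := by
  cases φ <;> simp [size]

end Basic

/-- All actions of the original system. -/
def _root_.ParamSys.Act.all (k : ℕ) : List (Act (Fin k)) :=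
  (Op.all k).map .leader ++ (Op.all k).map .contrib

theorem _root_.ParamSys.Act.mem_all {k : ℕ} (a : Act (Fin k)) : a ∈ Act.all k := by
  cases a <;> simp [Act.all, Op.mem_all]

/-- An action of the original system is announced now. -/
def announce (k : ℕ) : LTL (Op (Fin (7 * k))) :=
  anyOf ((Act.all k).map fun a => .write (Msg.toFin (.act a)))

/-- The last letter of the word is the declaration that the simulated run has ended. -/
def ended (k : ℕ) : LTL (Op (Fin (7 * k))) :=
  .conj (anyOf ((List.finRange k).map fun g => .write (Msg.toFin (.done g)))) (.neg (.next .tt))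

/-- The words which are the projection of a maximal trace: they end with the declaration that the
simulated run has ended, or they contain infinitely many announcements. -/
def wellFormed (k : ℕ) : LTL (Op (Fin (7 * k))) :=
  or (ended k).eventually
    (.conj (announce k).eventually
      (.neg (eventually (.neg (eventually (.next (announce k)))))))

/-- The translation of a formula, which says that there is a further announcement and that the log
from there on satisfies the formula. Only connectives in front of the translated subformulas are
used, so that a code is translated symbol by symbol. -/
def lift {k : ℕ} : LTL (Act (Fin k)) → LTL (Op (Fin (7 * k)))
  | .tt => (announce k).eventually
  | .atom a => .until (.neg (announce k)) (.atom (.write (Msg.toFin (.act a))))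
  | .neg φ => .conj (announce k).eventually (.neg φ.lift)
  | .conj φ ψ => .conj φ.lift ψ.lift
  | .next φ => .until (.neg (announce k)) (.conj (announce k) (.next φ.lift))
  | .until φ ψ => .until φ.lift ψ.lift

/-- A formula that has the truth value of the given formula on the empty word. -/
def onEmpty {α β : Type} : LTL α → LTL β
  | .tt => .tt
  | .atom _ => .neg .tt
  | .neg φ => .neg φ.onEmpty
  | .conj φ ψ => .conj φ.onEmpty ψ.onEmpty
  | .next φ => .conj (.neg .tt) φ.onEmpty
  | .until φ ψ => .conj (.neg .tt) (.conj φ.onEmpty ψ.onEmpty)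

/-- The formula for the logs which satisfy `φ`. -/
def transform {k : ℕ} (φ : LTL (Act (Fin k))) : LTL (Op (Fin (7 * k))) :=
  .conj (wellFormed k) (or φ.lift (.conj (.neg (announce k).eventually) φ.onEmpty))

variable {k : ℕ}

theorem sat_announce {w : Word (Op (Fin (7 * k)))} {i : ℕ} :
    (announce k).Sat w i ↔ ((w.get? i).bind logOp).isSome := by
  simp only [announce, sat_anyOf, List.mem_map, Act.mem_all, true_and, Option.isSome_iff_exists,
    Option.bind_eq_some_iff, logOp_eq_some]
  constructor
  · rintro ⟨b, ⟨a, rfl⟩, h⟩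
    exact ⟨a, _, h, rfl⟩
  · rintro ⟨a, b, h, rfl⟩
    exact ⟨_, ⟨a, rfl⟩, h⟩

theorem not_sat_announce {w : Word (Op (Fin (7 * k)))} {i : ℕ} :
    ¬ (announce k).Sat w i ↔ (w.get? i).bind logOp = none := by
  rw [sat_announce, Bool.not_eq_true, Option.isSome_eq_false_iff, Option.isNone_iff_eq_none]

theorem isSome_of_bind {α β : Type} {o : Option α} {f : α → Option β} (h : (o.bind f).isSome) :
    o.isSome := by
  cases o <;> simp_all

theorem sat_eventually_announce {w : Word (Op (Fin (7 * k)))} {u : Word (Act (Fin k))}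
    {cnt : ℕ → ℕ} (h : Word.Tracks logOp w u cnt) {p : ℕ} :
    (announce k).eventually.Sat w p ↔ (u.get? (cnt p)).isSome := by
  rw [sat_eventually, ← h.exists_ge_iff]
  refine exists_congr fun j => and_congr_right fun _ => ?_
  rw [sat_announce]
  exact ⟨And.right, fun h => ⟨isSome_of_bind h, h⟩⟩

theorem sat_lift {w : Word (Op (Fin (7 * k)))} {u : Word (Act (Fin k))}
    {cnt : ℕ → ℕ} (h : Word.Tracks logOp w u cnt) (φ : LTL (Act (Fin k))) (p : ℕ) :
    φ.lift.Sat w p ↔ (u.get? (cnt p)).isSome ∧ φ.Sat u (cnt p) := by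
  induction φ generalizing p with
  | tt => simp [lift, sat_eventually_announce h, Sat]
  | atom a =>
    simp only [lift, Sat, not_sat_announce]
    constructor
    · rintro ⟨j, hj, -, h1, h2⟩
      have h3 := (h.keep j a (by simp [h1])).2
      rw [h.eq_of_skip hj h2] at h3
      simp [h3]
    · rintro ⟨h1, h2⟩
      obtain ⟨j, hj, h3, h4⟩ := h.exists_ge h1 le_rfl
      obtain ⟨a', ha'⟩ := Option.isSome_iff_exists.1 h4
      have h5 := (h.keep j a' ha').2
      rw [h3, h2] at h5
      obtain rfl : a = a' := by simpa using h5
      obtain ⟨b, hb, hba⟩ := Option.bind_eq_some_iff.1 ha'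
      rw [logOp_eq_some] at hba
      subst hba
      exact ⟨j, hj, by simp [hb], hb, fun r h6 h7 => h.skip_of_eq h3 h6 h7⟩
  | neg φ ih =>
    simp only [lift, Sat, sat_eventually_announce h, ih]
    tauto
  | conj φ ψ ihφ ihψ =>
    simp only [lift, Sat, ihφ, ihψ]
    tauto
  | next φ ih =>
    simp only [lift, Sat, sat_announce, ih, Bool.not_eq_true, Option.isSome_eq_false_iff,
      Option.isNone_iff_eq_none]
    constructor
    · rintro ⟨j, hj, -, ⟨h1, -, h2, h3⟩, h4⟩
      obtain ⟨a, ha⟩ := Option.isSome_iff_exists.1 h1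
      obtain ⟨h5, h6⟩ := h.keep j a ha
      have h7 := h.eq_of_skip hj h4
      rw [h5, h7] at h2 h3
      rw [h7] at h6
      exact ⟨by simp [h6], h2, h3⟩
    · rintro ⟨h1, h2, h3⟩
      obtain ⟨j, hj, h4, h5⟩ := h.exists_ge h1 le_rfl
      obtain ⟨a, ha⟩ := Option.isSome_iff_exists.1 h5
      have h6 := (h.keep j a ha).1
      rw [h4] at h6
      refine ⟨j, hj, isSome_of_bind h5, ⟨h5, ?_, by rwa [h6], by rwa [h6]⟩,
        fun r h7 h8 => h.skip_of_eq h4 h7 h8⟩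
      obtain ⟨i, hi, -, h7⟩ := h.exists_ge (n := cnt p + 1) (p := j + 1) h2 h6.le
      exact Word.get?_isSome_of_le (isSome_of_bind h7) hi
  | _ φ ψ ihφ ihψ =>
    simp only [lift, Sat, ihφ, ihψ]
    constructor
    · rintro ⟨j, hj, -, ⟨h1, h2⟩, h3⟩
      refine ⟨Word.get?_isSome_of_le h1 (h.monotone hj), cnt j, h.monotone hj, h1, h2, ?_⟩
      intro n hn hnj
      obtain ⟨r, hr, rfl, -⟩ := h.exists_ge (Word.get?_isSome_of_le h1 hnj.le) hn
      refine (h3 r hr ?_).2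
      by_contra hcon
      have := h.monotone (not_lt.1 hcon)
      omega
    · rintro ⟨h1, n, hn, h2, h3, h4⟩
      -- the first position not before `p` with count `n`: before it, the count is smaller
      have hex : ∃ j, p ≤ j ∧ cnt j = n ∧ (w.get? j).isSome := by
        obtain ⟨j, hj, h5, h6⟩ := h.exists_ge h2 hn
        exact ⟨j, hj, h5, isSome_of_bind h6⟩
      classical
      obtain ⟨hj, h5, h6⟩ := Nat.find_spec hex
      refine ⟨Nat.find hex, hj, h6, by rw [h5]; exact ⟨h2, h3⟩, ?_⟩
      intro r hr hrj
      have hle : cnt r ≤ n := h5 ▸ h.monotone hrj.le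
      have hne : cnt r ≠ n := fun heq =>
        Nat.find_min hex hrj ⟨hr, heq, Word.get?_isSome_of_le h6 hrj.le⟩
      exact ⟨Word.get?_isSome_of_le h2 hle, h4 _ (h.monotone hr) (by omega)⟩

theorem sat_onEmpty {α β : Type} (φ : LTL α) (w : Word β) (p : ℕ) :
    (φ.onEmpty : LTL β).Sat w p ↔ φ.Sat (.fin []) 0 := by
  induction φ with
  | tt => simp [onEmpty, Sat]
  | atom a => simp [onEmpty, Sat, Word.get?]
  | neg φ ih => simp [onEmpty, Sat, ih]
  | conj φ ψ ihφ ihψ => simp [onEmpty, Sat, ihφ, ihψ]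
  | next φ ih => simp [onEmpty, Sat, Word.get?]
  | _ φ ψ ihφ ihψ => simp [onEmpty, Sat, Word.get?]

theorem sat_transform {w : Word (Op (Fin (7 * k)))} {u : Word (Act (Fin k))}
    {cnt : ℕ → ℕ} (h : Word.Tracks logOp w u cnt) (φ : LTL (Act (Fin k))) :
    φ.transform.Sat w 0 ↔ (wellFormed k).Sat w 0 ∧ φ.Sat u 0 := by
  simp only [transform, Sat, sat_or, sat_lift h, sat_onEmpty, sat_eventually_announce h, h.zero]
  refine and_congr_right fun _ => ?_
  by_cases hu : (u.get? 0).isSome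
  · simp [hu]
  · have : u = .fin [] := by
      obtain l | s := u
      · simpa [Word.get?] using hu
      · simp [Word.get?] at hu
    simp [this, Word.get?]

theorem sat_wellFormed_fin {l : List (Op (Fin (7 * k)))} :
    (wellFormed k).Sat (.fin l) 0 ↔ ∃ y g, l = y ++ [.write (Msg.toFin (.done g))] := by
  simp only [wellFormed, sat_or, sat_eventually, ended, Sat, sat_anyOf, Nat.zero_le, true_and,
    List.mem_map, List.mem_finRange]
  constructor
  · rintro (⟨j, -, ⟨b, ⟨g, rfl⟩, h1⟩, h2⟩ | ⟨⟨j, h1, -⟩, h2⟩)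
    · simp only [Word.get?, and_true, Bool.not_eq_true, Option.isSome_eq_false_iff,
        Option.isNone_iff_eq_none, List.getElem?_eq_none_iff] at h1 h2
      obtain ⟨h3, h4⟩ := List.getElem?_eq_some_iff.1 h1
      obtain rfl : j = l.length - 1 := by omega
      refine ⟨l.dropLast, g, ?_⟩
      have hne : l ≠ [] := by
        rintro rfl
        simp at h3
      rw [← List.getLast_eq_getElem hne] at h4
      rw [← h4, List.dropLast_append_getLast]
    · refine absurd ⟨l.length - 1, ?_, ?_⟩ h2
      · have := (List.getElem?_eq_some_iff.1 (Option.isSome_iff_exists.1 h1).choose_spec).1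
        exact Option.isSome_iff_exists.2 ⟨_, List.getElem?_eq_getElem (by omega)⟩
      · rintro ⟨i, hi, h3, h4, -⟩
        have := (List.getElem?_eq_some_iff.1 (Option.isSome_iff_exists.1 h4).choose_spec).1
        omega
  · rintro ⟨y, g, rfl⟩
    exact .inl ⟨y.length, by simp [Word.get?], ⟨_, ⟨g, rfl⟩, by simp [Word.get?]⟩, by simp [Word.get?]⟩

theorem sat_wellFormed_inf {s : ℕ → Op (Fin (7 * k))} :
    (wellFormed k).Sat (.inf s) 0 ↔ ∀ N, ∃ i, N ≤ i ∧ (logOp (s i)).isSome := by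
  simp only [wellFormed, sat_or, sat_eventually, ended, Sat, Word.get?, Nat.zero_le, true_and,
    Option.isSome_some, sat_announce, Option.bind_some, and_true, not_true_eq_false, and_false,
    exists_false, false_or, not_exists, not_forall, not_not]
  constructor
  · rintro ⟨-, h⟩ N
    obtain ⟨i, hi, h⟩ := h N
    exact ⟨i + 1, by omega, h⟩
  · intro h
    refine ⟨?_, fun N => ?_⟩
    · obtain ⟨i, -, h⟩ := h 0
      exact ⟨i, h⟩
    · obtain ⟨i, hi, h⟩ := h (N + 1)
      exact ⟨i - 1, by omega, by rwa [Nat.sub_add_cancel (by omega)]⟩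

theorem language_transform (φ : LTL (Act (Fin k))) :
    φ.transform.language = counterpart φ.language := by
  ext (l | s)
  · show φ.transform.Sat (.fin l) 0 ↔ _
    rw [sat_transform (Word.tracks_fin logOp l), sat_wellFormed_fin]
    constructor
    · rintro ⟨⟨y, g, rfl⟩, h⟩
      refine ⟨y, g, rfl, ?_⟩
      show Sat _ 0 φ
      simpa using h
    · rintro ⟨y, g, rfl, h⟩
      have h' : Sat _ 0 φ := h
      exact ⟨⟨y, g, rfl⟩, by simpa using h'⟩
  · show φ.transform.Sat (.inf s) 0 ↔ _
    constructor
    · intro h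
      have hw : (wellFormed k).Sat (.inf s) 0 := h.1
      obtain ⟨u, hu⟩ := Word.exists_hasProj (sat_wellFormed_inf.1 hw)
      obtain ⟨cnt, ht⟩ := hu.exists_tracks
      exact ⟨u, hu, ((sat_transform ht φ).1 h).2⟩
    · rintro ⟨u, hu, h⟩
      obtain ⟨cnt, ht⟩ := hu.exists_tracks
      exact (sat_transform ht φ).2 ⟨sat_wellFormed_inf.2 hu.frequently, h⟩

theorem size_announce : (announce k).size = 20 * k + 2 := by
  rw [announce, size_anyOf]
  simp [Act.all, Op.all]
  ring

theorem size_lift_le (hk : 0 < k) (φ : LTL (Act (Fin k))) : φ.lift.size ≤ 50 * k * φ.size := by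
  induction φ with
  | tt | atom _ =>
    simp only [lift, eventually, size, size_announce]
    omega
  | neg φ ih | next φ ih =>
    simp only [lift, eventually, size, size_announce, Nat.mul_add]
    omega
  | conj φ ψ ihφ ihψ | _ φ ψ ihφ ihψ =>
    simp only [lift, size, Nat.mul_add]
    omega

theorem size_onEmpty_le {α β : Type} (φ : LTL α) : (φ.onEmpty : LTL β).size ≤ 5 * φ.size := by
  induction φ <;> simp only [onEmpty, size] <;> omega

theorem size_transform_le (hk : 0 < k) (φ : LTL (Act (Fin k))) :
    φ.transform.size ≤ 300 * k * φ.size := by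
  have h1 := size_lift_le hk φ
  have h2 : (φ.onEmpty : LTL (Op (Fin (7 * k)))).size ≤ 5 * φ.size := size_onEmpty_le φ
  have h3 : (ended k).size = 5 * k + 6 := by
    simp only [ended, size, size_anyOf, List.length_map, List.length_finRange]
  have h4 : φ.size ≤ k * φ.size := Nat.le_mul_of_pos_left _ hk
  have h5 : k ≤ k * φ.size := Nat.le_mul_of_pos_right _ φ.size_pos
  simp only [transform, wellFormed, or, eventually, size, size_announce, h3]
  rw [Nat.mul_assoc] at h1 ⊢
  omega

end LTL

end ParamSys

namespace ParamSys

/-! ### Functional bisimulations between systems -/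

section Embedding

variable {k : ℕ} {S T S' T' : Type*}

def Config.map (ι : S → S') (κ : T → T') (c : Config (Fin k) S T) : Config (Fin k) S' T' :=
  ⟨c.contributors.map ι, κ c.leader, c.register⟩

/-- The transition system `C'` behaves in the states `ι x` like `C` in the states `x`. -/
structure IsBisimulation {α : Type} (C : TransitionSystem S α) (C' : TransitionSystem S' α)
    (ι : S → S') : Prop where
  init : C'.init = ι C.init
  step : ∀ x a y', C'.step (ι x) a y' ↔ ∃ y, y' = ι y ∧ C.step x a y

variable {sys : System (Fin k) S T} {sys' : System (Fin k) S' T'} {ι : S → S'} {κ : T → T'}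
  (hC : IsBisimulation sys.C sys'.C ι) (hD : IsBisimulation sys.D sys'.D κ)
  (hg : sys'.ginit = sys.ginit)
include hC hD

theorem step_map_iff {c : Config (Fin k) S T} {a : Act (Fin k)} {d' : Config (Fin k) S' T'} :
    sys'.Step (c.map ι κ) a d' ↔ ∃ d, d' = d.map ι κ ∧ sys.Step c a d := by
  obtain ⟨M, t, g⟩ := c
  constructor
  · intro h
    rcases (System.step_iff _).1 h with ⟨o, t', rfl, hst, hr, rfl⟩ |
      ⟨o, x, s', N, rfl, hN, hst, hr, rfl⟩
    · obtain ⟨t', rfl, ht⟩ := (hD.step _ _ _).1 hst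
      exact ⟨⟨M, t', o.val⟩, rfl, .leader ht hr⟩
    · classical
      obtain ⟨s, hs, rfl, rfl⟩ := (Multiset.map_eq_cons _ _ _ _).2 hN
      obtain ⟨s', rfl, hs'⟩ := (hC.step _ _ _).1 hst
      refine ⟨⟨s' ::ₘ M.erase s, t, o.val⟩, by simp [Config.map], ?_⟩
      have := System.Step.contrib (M := M.erase s) (t := t) hs' hr
      rwa [Multiset.cons_erase hs] at this
  · rintro ⟨d, rfl, h⟩
    rcases (System.step_iff _).1 h with ⟨o, t', rfl, hst, hr, rfl⟩ |
      ⟨o, s, s', N, rfl, hN, hst, hr, rfl⟩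
    · exact .leader ((hD.step _ _ _).2 ⟨t', rfl, hst⟩) hr
    · simp only at hN
      subst hN
      simp only [Config.map, Multiset.map_cons]
      exact .contrib ((hC.step _ _ _).2 ⟨s', rfl, hst⟩) hr

theorem finRun_map_iff {c : Config (Fin k) S T} {l : List (Act (Fin k))}
    {d' : Config (Fin k) S' T'} :
    sys'.FinRun (c.map ι κ) l d' ↔ ∃ d, d' = d.map ι κ ∧ sys.FinRun c l d := by
  constructor
  · intro h
    generalize hx : c.map ι κ = x at h
    induction h generalizing c with
    | nil => exact ⟨c, hx.symm, .nil c⟩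
    | cons _ _ _ a l hs _ ih =>
      subst hx
      obtain ⟨d, rfl, hd⟩ := (step_map_iff hC hD).1 hs
      obtain ⟨e, rfl, h⟩ := ih rfl
      exact ⟨e, rfl, .cons _ _ _ _ _ hd h⟩
  · rintro ⟨d, rfl, h⟩
    induction h with
    | nil => exact .nil _
    | cons _ _ _ a l hs _ ih =>
      exact .cons _ _ _ _ _ ((step_map_iff hC hD).2 ⟨_, rfl, hs⟩) ih

theorem infRun_map {c : Config (Fin k) S T} {d' : ℕ → Config (Fin k) S' T'}
    {a : ℕ → Act (Fin k)} (h0 : d' 0 = c.map ι κ) (h : sys'.InfRun d' a) :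
    ∃ d, d 0 = c ∧ sys.InfRun d a := by
  obtain ⟨d, hd0, hd⟩ := exists_seq_of_step (p := fun i (x : Config (Fin k) S T) => d' i = x.map ι κ)
    (r := fun i x y => sys.Step x (a i) y) (a₀ := c) h0 (by
      intro i x hx
      have hs := h i
      rw [hx] at hs
      obtain ⟨y, hy, hs⟩ := (step_map_iff hC hD).1 hs
      exact ⟨y, hy, hs⟩)
  exact ⟨d, hd0, fun i => (hd i).2⟩

theorem map_infRun {d : ℕ → Config (Fin k) S T} {a : ℕ → Act (Fin k)} (h : sys.InfRun d a) :
    sys'.InfRun (fun i => (d i).map ι κ) a :=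
  fun i => (step_map_iff hC hD).2 ⟨_, rfl, h i⟩

include hg

theorem initial_map (n : ℕ) : sys'.initial n = (sys.initial n).map ι κ := by
  simp [System.initial, Config.map, hC.init, hD.init, hg]

theorem isMaximalTrace_iff (w : Word (Act (Fin k))) :
    sys'.IsMaximalTrace w ↔ sys.IsMaximalTrace w := by
  cases w with
  | fin l =>
    refine exists_congr fun n => ?_
    rw [initial_map hC hD hg]
    constructor
    · rintro ⟨d', hrun, hdead⟩
      obtain ⟨d, rfl, hd⟩ := (finRun_map_iff hC hD).1 hrun
      exact ⟨d, hd, fun ⟨a, c, hs⟩ => hdead ⟨a, _, (step_map_iff hC hD).2 ⟨c, rfl, hs⟩⟩⟩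
    · rintro ⟨d, hrun, hdead⟩
      refine ⟨_, (finRun_map_iff hC hD).2 ⟨d, rfl, hrun⟩, ?_⟩
      rintro ⟨a, c', hs⟩
      obtain ⟨c, -, hs⟩ := (step_map_iff hC hD).1 hs
      exact hdead ⟨a, c, hs⟩
  | inf s =>
    refine exists_congr fun n => ?_
    rw [initial_map hC hD hg]
    constructor
    · rintro ⟨d', h0, hrun⟩
      exact infRun_map hC hD h0 hrun
    · rintro ⟨d, h0, hrun⟩
      exact ⟨_, by rw [h0], map_infRun hC hD hrun⟩

theorem hasInfiniteRun_iff : sys'.HasInfiniteRun ↔ sys.HasInfiniteRun := by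
  constructor
  · rintro ⟨n, c, a, h⟩
    obtain ⟨n, c, h⟩ := (isMaximalTrace_iff hC hD hg (.inf a)).1 ⟨n, c, h⟩
    exact ⟨n, c, a, h⟩
  · rintro ⟨n, c, a, h⟩
    obtain ⟨n, c, h⟩ := (isMaximalTrace_iff hC hD hg (.inf a)).2 ⟨n, c, h⟩
    exact ⟨n, c, a, h⟩

end Embedding

/-- A system which is bisimilar to the protocol for `sys`, and whose states, reachable or not, are
governed by the controls, reduces properties of `sys` to properties of its leader. -/
theorem reduces_of_isBisimulation {k : ℕ} {S T S' T' : Type*} {sys : System (Fin k) S T}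
    {sys' : System (Fin (7 * k)) S' T'} {ι : CMode k × S → S'} {κ : LMode k × T → T'}
    (hC : IsBisimulation (protocol sys).C sys'.C ι) (hD : IsBisimulation (protocol sys).D sys'.D κ)
    (hg : sys'.ginit = (protocol sys).ginit) {cm : S' → CMode k} {lm : T' → LMode k}
    (hcm : ∀ x b y, sys'.C.step x b y → (cControl k).Rule (cm x) b (cm y))
    (hlm : ∀ x b y, sys'.D.step x b y → (lControl sys.ginit).Rule (lm x) b (lm y)) :
    Reduces BuchiAut.transform LTL.transform sys sys' := by
  refine ⟨fun P hP => ⟨counterpart P, ?_, ?_, ?_, ?_⟩, ?_, ?_⟩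
  · simp only [isMaximalTrace_iff hC hD hg]
    exact protocol_finite_iff hP
  · simp only [isMaximalTrace_iff hC hD hg]
    exact protocol_infinite_iff hP
  · rintro B rfl
    exact B.language_transform
  · rintro φ rfl
    exact φ.language_transform
  · intro c a h N
    exact infinitely_many_leader_writes hcm hlm h N
  · exact (hasInfiniteRun_iff hC hD hg).trans protocol_hasInfiniteRun_iff

theorem Control.product_rule {k : ℕ} {μ : Type} {S : Type*} {K : Control k μ}
    {C : TransitionSystem S (Op (Fin k))} {x y : μ × S} {b : Op (Fin (7 * k))}
    (h : (K.product C).step x b y) : K.Rule x.1 b y.1 := by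
  rcases h with ⟨h, -⟩ | ⟨o, h, -⟩
  · exact .inl h
  · exact .inr ⟨o, h⟩

theorem isBisimulation_id {α : Type} {S : Type*} (C : TransitionSystem S α) :
    IsBisimulation C C id :=
  ⟨rfl, fun x a y' => ⟨fun h => ⟨y', rfl, h⟩, by rintro ⟨y, rfl, h⟩; exact h⟩⟩

theorem reduces_protocol {k : ℕ} {S T : Type*} (sys : System (Fin k) S T) :
    Reduces BuchiAut.transform LTL.transform sys (protocol sys) :=
  reduces_of_isBisimulation (isBisimulation_id _) (isBisimulation_id _) rfl
    (fun _ _ _ => Control.product_rule) (fun _ _ _ => Control.product_rule)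

/-! ### The protocol for pushdown systems -/

section Pushdown

/-- The encoding of stacks by nonempty stacks: the lowest symbol is marked, and the empty stack is
represented by an additional symbol. So a control can still work when the stack is empty. -/
def encStack {n : ℕ} (β : List (Fin n)) : List (Fin (2 * n + 1)) :=
  β.dropLast.map (withFlag false) ++ [β.getLast?.elim (extra n) (withFlag true)]

theorem encStack_nil {n : ℕ} : encStack ([] : List (Fin n)) = [extra n] := rfl

theorem encStack_singleton {n : ℕ} (A : Fin n) : encStack [A] = [withFlag true A] := rfl

theorem encStack_append {n : ℕ} (w : List (Fin n)) {β : List (Fin n)} (hβ : β ≠ []) :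
    encStack (w ++ β) = w.map (withFlag false) ++ encStack β := by
  rw [encStack, encStack, List.dropLast_append_of_ne_nil hβ, List.getLast?_append_of_ne_nil _ hβ]
  simp

theorem encStack_ne_nil {n : ℕ} (β : List (Fin n)) : encStack β ≠ [] := by
  simp [encStack]

theorem encStack_length_le {n : ℕ} (β : List (Fin n)) : (encStack β).length ≤ β.length + 1 := by
  simp [encStack]

variable {k : ℕ} {μ : Type} {N : ℕ}

/-- The transitions of the pushdown system driven by a control. -/
def Control.pushdownTrans (K : Control k μ) (enc : μ → Fin N) (A : Pushdown (Op (Fin k))) :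
    List (PushdownTransition (N * A.numStates) (2 * A.numSymbols + 1) (Op (Fin (7 * k)))) :=
  (K.loc.flatMap fun ρ => (List.finRange A.numStates).flatMap fun q =>
      (List.finRange (2 * A.numSymbols + 1)).map fun X =>
        ⟨finProdFinEquiv (enc ρ.1, q), X, ρ.2.1, finProdFinEquiv (enc ρ.2.2, q), [X]⟩) ++
    A.trans.flatMap fun τ => (K.sync τ.label).flatMap fun ρ =>
      [⟨finProdFinEquiv (enc ρ.1, τ.source), withFlag false τ.top, ρ.2.1,
          finProdFinEquiv (enc ρ.2.2, τ.target), τ.push.map (withFlag false)⟩,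
        ⟨finProdFinEquiv (enc ρ.1, τ.source), withFlag true τ.top, ρ.2.1,
          finProdFinEquiv (enc ρ.2.2, τ.target), encStack τ.push⟩]

/-- The pushdown system driven by a control; `enc` numbers the modes of the control. -/
def Control.pushdown (K : Control k μ) (enc : μ → Fin N) (A : Pushdown (Op (Fin k))) :
    Pushdown (Op (Fin (7 * k))) where
  numStates := N * A.numStates
  numSymbols := 2 * A.numSymbols + 1
  trans := K.pushdownTrans enc A
  init := finProdFinEquiv (enc K.init, A.init)
  initSymbol := withFlag true A.initSymbol

theorem Control.pushdown_step_iff {K : Control k μ} {enc : μ → Fin N} {A : Pushdown (Op (Fin k))}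
    {x y : Fin (N * A.numStates) × List (Fin (2 * A.numSymbols + 1))} {b : Op (Fin (7 * k))} :
    (K.pushdown enc A).toTS.step x b y ↔
      (∃ m m' q γ, (m, b, m') ∈ K.loc ∧ γ ≠ [] ∧ x = (finProdFinEquiv (enc m, q), γ) ∧
        y = (finProdFinEquiv (enc m', q), γ)) ∨
      ∃ m m', ∃ τ ∈ A.trans, (m, b, m') ∈ K.sync τ.label ∧ ∃ X w γ,
        (X = withFlag false τ.top ∧ w = τ.push.map (withFlag false) ∨
          X = withFlag true τ.top ∧ w = encStack τ.push) ∧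
        x = (finProdFinEquiv (enc m, τ.source), X :: γ) ∧
        y = (finProdFinEquiv (enc m', τ.target), w ++ γ) := by
  constructor
  · rintro ⟨τ', hτ', rfl, γ, rfl, rfl⟩
    change τ' ∈ K.pushdownTrans enc A at hτ'
    rcases List.mem_append.1 hτ' with h | h
    · obtain ⟨⟨m, b, m'⟩, hK, h⟩ := List.mem_flatMap.1 h
      obtain ⟨q, -, h⟩ := List.mem_flatMap.1 h
      obtain ⟨X, -, rfl⟩ := List.mem_map.1 h
      exact .inl ⟨m, m', q, X :: γ, hK, by simp, rfl, rfl⟩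
    · obtain ⟨τ, hτ, h⟩ := List.mem_flatMap.1 h
      obtain ⟨⟨m, b, m'⟩, hK, h⟩ := List.mem_flatMap.1 h
      rcases List.mem_pair.1 h with rfl | rfl
      · exact .inr ⟨m, m', τ, hτ, hK, _, _, γ, .inl ⟨rfl, rfl⟩, rfl, rfl⟩
      · exact .inr ⟨m, m', τ, hτ, hK, _, _, γ, .inr ⟨rfl, rfl⟩, rfl, rfl⟩
  · rintro (⟨m, m', q, γ, hK, hγ, rfl, rfl⟩ | ⟨m, m', τ, hτ, hK, X, w, γ, h, rfl, rfl⟩)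
    · obtain ⟨X, γ, rfl⟩ := List.exists_cons_of_ne_nil hγ
      refine ⟨⟨finProdFinEquiv (enc m, q), X, b, finProdFinEquiv (enc m', q), [X]⟩,
        List.mem_append_left _ ?_, rfl, γ, rfl, rfl⟩
      exact List.mem_flatMap.2 ⟨_, hK, List.mem_flatMap.2 ⟨q, List.mem_finRange _,
        List.mem_map.2 ⟨X, List.mem_finRange _, rfl⟩⟩⟩
    · refine ⟨⟨finProdFinEquiv (enc m, τ.source), X, b, finProdFinEquiv (enc m', τ.target), w⟩,
        List.mem_append_right _ ?_, rfl, γ, rfl, rfl⟩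
      refine List.mem_flatMap.2 ⟨τ, hτ, List.mem_flatMap.2 ⟨_, hK, ?_⟩⟩
      rcases h with ⟨rfl, rfl⟩ | ⟨rfl, rfl⟩
      · exact List.mem_cons_self
      · exact List.mem_cons_of_mem _ List.mem_cons_self

/-- The state of the pushdown system which represents a mode and a state of the given one. -/
def encState (enc : μ → Fin N) {n m : ℕ} (x : μ × (Fin n × List (Fin m))) :
    Fin (N * n) × List (Fin (2 * m + 1)) :=
  (finProdFinEquiv (enc x.1, x.2.1), encStack x.2.2)

theorem Control.isBisimulation_pushdown (K : Control k μ) {enc : μ → Fin N}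
    (henc : Function.Injective enc) (A : Pushdown (Op (Fin k))) :
    IsBisimulation (K.product A.toTS) (K.pushdown enc A).toTS (encState enc) := by
  refine ⟨rfl, ?_⟩
  rintro ⟨m, q, β⟩ b y'
  refine Control.pushdown_step_iff.trans ?_
  constructor
  · rintro (⟨m₁, m', q₁, γ, hK, hγ, hx, rfl⟩ | ⟨m₁, m', τ, hτ, hK, X, w, γ, h, hx, rfl⟩)
    · simp only [encState, Prod.mk.injEq, EmbeddingLike.apply_eq_iff_eq] at hx
      obtain ⟨⟨h1, rfl⟩, rfl⟩ := hx
      obtain rfl := henc h1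
      exact ⟨(m', q, β), rfl, .inl ⟨hK, rfl⟩⟩
    · simp only [encState, Prod.mk.injEq, EmbeddingLike.apply_eq_iff_eq] at hx
      obtain ⟨⟨h1, rfl⟩, h2⟩ := hx
      obtain rfl := henc h1
      obtain ⟨β', rfl, hw⟩ : ∃ β', β = τ.top :: β' ∧ w ++ γ = encStack (τ.push ++ β') := by
        cases β with
        | nil =>
          rw [encStack_nil] at h2
          obtain ⟨rfl, -⟩ := List.cons.inj h2
          rcases h with ⟨h, -⟩ | ⟨h, -⟩ <;> exact absurd h.symm withFlag_ne_extra
        | cons B β' =>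
          by_cases hβ' : β' = []
          · subst hβ'
            rw [encStack_singleton] at h2
            obtain ⟨rfl, rfl⟩ := List.cons.inj h2
            rcases h with ⟨h, -⟩ | ⟨h, rfl⟩
            · simp at h
            · exact ⟨[], by simpa using h, by simp⟩
          · rw [← List.singleton_append, encStack_append _ hβ'] at h2
            obtain ⟨rfl, rfl⟩ := List.cons.inj h2
            rcases h with ⟨h, rfl⟩ | ⟨h, -⟩
            · exact ⟨β', by simpa using h, by rw [encStack_append _ hβ']; rfl⟩
            · simp at h
      refine ⟨(m', τ.target, τ.push ++ β'), by rw [hw]; rfl, .inr ⟨τ.label, hK, τ, hτ, rfl, β',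
        rfl, rfl⟩⟩
  · rintro ⟨⟨m', q', β'⟩, rfl, ⟨hK, h⟩ | ⟨o, hK, τ, hτ, rfl, γ, h, h'⟩⟩
    · simp only [Prod.mk.injEq] at h
      obtain ⟨rfl, rfl⟩ := h
      exact .inl ⟨m, m', q', _, hK, encStack_ne_nil _, rfl, rfl⟩
    · simp only [Prod.mk.injEq] at h h'
      obtain ⟨rfl, rfl⟩ := h
      obtain ⟨rfl, rfl⟩ := h'
      by_cases hγ : γ = []
      · subst hγ
        exact .inr ⟨m, m', τ, hτ, hK, _, _, [], .inr ⟨rfl, rfl⟩, rfl, by simp [encState]⟩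
      · refine .inr ⟨m, m', τ, hτ, hK, _, _, encStack γ, .inl ⟨rfl, rfl⟩, ?_, ?_⟩
        · rw [encState, ← List.singleton_append, encStack_append _ hγ]
          rfl
        · rw [encState, encStack_append _ hγ]

theorem Control.pushdown_rule [Nonempty μ] {K : Control k μ} {enc : μ → Fin N}
    (henc : Function.Injective enc) {A : Pushdown (Op (Fin k))}
    {x y : Fin (N * A.numStates) × List (Fin (2 * A.numSymbols + 1))} {b : Op (Fin (7 * k))}
    (h : (K.pushdown enc A).toTS.step x b y) :
    K.Rule (Function.invFun enc (finProdFinEquiv.symm x.1).1) b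
      (Function.invFun enc (finProdFinEquiv.symm y.1).1) := by
  rcases Control.pushdown_step_iff.1 h with ⟨m, m', q, γ, hK, -, rfl, rfl⟩ |
    ⟨m, m', τ, -, hK, X, w, γ, -, rfl, rfl⟩
  · simp only [Equiv.symm_apply_apply, Function.leftInverse_invFun henc _]
    exact .inl hK
  · simp only [Equiv.symm_apply_apply, Function.leftInverse_invFun henc _]
    exact .inr ⟨_, hK⟩

/-- The numbering of the modes of contributors. -/
def CMode.enc : CMode k → Fin (4 * k + 1)
  | .passive => ⟨0, by omega⟩
  | .pend (.read g) => ⟨g + 1, by omega⟩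
  | .pend (.write g) => ⟨g + (k + 1), by omega⟩
  | .wait (.read g) => ⟨g + (2 * k + 1), by omega⟩
  | .wait (.write g) => ⟨g + (3 * k + 1), by omega⟩

/-- The numbering of the modes of the leader. -/
def LMode.enc : LMode k → Fin (4 * k + 1)
  | .dead => ⟨0, by omega⟩
  | .idle g => ⟨g + 1, by omega⟩
  | .ended g => ⟨g + (k + 1), by omega⟩
  | .ack (.read g) => ⟨g + (2 * k + 1), by omega⟩
  | .ack (.write g) => ⟨g + (3 * k + 1), by omega⟩

theorem CMode.enc_injective : Function.Injective (CMode.enc (k := k)) := by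
  rintro (_ | (g | g) | (g | g)) (_ | (h | h) | (h | h)) heq <;>
    simp only [CMode.enc, Fin.mk.injEq] at heq <;>
    first
      | rfl
      | (exfalso; omega)
      | (obtain rfl : g = h := Fin.ext (by omega)
         rfl)

theorem LMode.enc_injective : Function.Injective (LMode.enc (k := k)) := by
  rintro (g | (g | g) | g | _) (h | (h | h) | h | _) heq <;>
    simp only [LMode.enc, Fin.mk.injEq] at heq <;>
    first
      | rfl
      | (exfalso; omega)
      | (obtain rfl : g = h := Fin.ext (by omega)
         rfl)

end Pushdown

/-- The pushdown systems of the protocol. -/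
def PushdownSys.transform {k : ℕ} (A : PushdownSys k) : PushdownSys (7 * k) where
  AC := (cControl k).pushdown CMode.enc A.AC
  AD := (lControl A.ginit).pushdown LMode.enc A.AD
  ginit := Msg.toFin (.act (.leader (.write A.ginit)))

theorem reduces_pushdownSys {k : ℕ} (A : PushdownSys k) :
    Reduces BuchiAut.transform LTL.transform A.toSystem A.transform.toSystem := by
  have : Nonempty (CMode k) := ⟨.passive⟩
  have : Nonempty (LMode k) := ⟨.dead⟩
  exact reduces_of_isBisimulation (sys := A.toSystem)
    ((cControl k).isBisimulation_pushdown CMode.enc_injective A.AC)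
    ((lControl A.ginit).isBisimulation_pushdown LMode.enc_injective A.AD) rfl
    (fun _ _ _ => Control.pushdown_rule CMode.enc_injective)
    (fun _ _ _ => Control.pushdown_rule LMode.enc_injective)

theorem Control.linearlyBounded {k : ℕ} (hk : 0 < k) {μ : Type} (K : Control k μ)
    (enc : μ → Fin (4 * k + 1)) (hloc : K.loc.length ≤ 7 * k * k)
    (hsync : ∀ o, (K.sync o).length ≤ 5 * k) (A : Pushdown (Op (Fin k))) :
    LinearlyBounded 300 A (K.pushdown enc A) := by
  have hQ : 0 < A.numStates := Fin.pos A.init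
  have hΓ : 0 < A.numSymbols := Fin.pos A.initSymbol
  have h1 : (4 * k + 1) * A.numStates ≤ 5 * k * A.numStates := Nat.mul_le_mul_right _ (by omega)
  refine ⟨h1.trans (Nat.mul_le_mul_right _ (Nat.mul_le_mul_right _ (by norm_num))),
    show 2 * A.numSymbols + 1 ≤ _ by omega, ?_⟩
  have h2 : (A.trans.flatMap fun τ => (K.sync τ.label).flatMap fun _ =>
      [1 + τ.push.length, 1 + (encStack τ.push).length]).sum ≤
      15 * k * (A.trans.map fun τ => 1 + τ.push.length).sum := by
    induction A.trans with
    | nil => simp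
    | cons τ l ih =>
      have h3 : ((K.sync τ.label).flatMap fun _ =>
          [1 + τ.push.length, 1 + (encStack τ.push).length]).sum ≤
          15 * k * (1 + τ.push.length) := by
        have h4 : ∀ (l : List (μ × Op (Fin (7 * k)) × μ)), (l.flatMap fun _ =>
            [1 + τ.push.length, 1 + (encStack τ.push).length]).sum ≤
            l.length * (3 * (1 + τ.push.length)) := by
          intro l
          induction l with
          | nil => simp
          | cons _ l ih =>
            have := encStack_length_le τ.push
            simp only [List.flatMap_cons, List.sum_append, List.sum_cons, List.sum_nil,
              List.length_cons, Nat.add_mul, Nat.one_mul]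
            omega
        refine (h4 _).trans ?_
        calc (K.sync τ.label).length * (3 * (1 + τ.push.length))
            ≤ 5 * k * (3 * (1 + τ.push.length)) := Nat.mul_le_mul_right _ (hsync _)
          _ = _ := by ring
      simp only [List.flatMap_cons, List.sum_append, List.map_cons, List.sum_cons, Nat.mul_add] at *
      omega
  have h3 : (K.pushdown enc A).size = (4 * k + 1) * A.numStates * (2 * A.numSymbols + 1) *
      (2 * (7 * k)) + (K.loc.length * (A.numStates * ((2 * A.numSymbols + 1) * 2)) +
      (A.trans.flatMap fun τ => (K.sync τ.label).flatMap fun _ =>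
        [1 + τ.push.length, 1 + (encStack τ.push).length]).sum) := by
    simp only [Pushdown.size, Control.pushdown, Control.pushdownTrans, List.map_append, List.sum_append,
      List.map_flatMap, List.map_map, List.map_cons, List.map_nil, List.length_map]
    congr 2
    simp [Function.comp_def, List.flatMap_def]
    ring
  have h4 : (4 * k + 1) * A.numStates * (2 * A.numSymbols + 1) * (2 * (7 * k)) ≤
      5 * k * A.numStates * (3 * A.numSymbols) * (2 * (7 * k)) :=
    Nat.mul_le_mul_right _ (Nat.mul_le_mul h1 (by omega))
  have h5 : K.loc.length * (A.numStates * ((2 * A.numSymbols + 1) * 2)) ≤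
      7 * k * k * (A.numStates * ((3 * A.numSymbols) * 2)) :=
    Nat.mul_le_mul hloc (Nat.mul_le_mul_left _ (by omega))
  rw [h3, Pushdown.size]
  nlinarith [Nat.zero_le (k * k * A.numStates * A.numSymbols),
    Nat.zero_le (k * (A.trans.map fun τ => 1 + τ.push.length).sum)]

theorem Op.length_all (k : ℕ) : (Op.all k).length = 2 * k := by
  simp [Op.all]
  ring

theorem Op.length_views_le {k : ℕ} (o : Op (Fin k)) : o.views.length ≤ k := by
  cases o with
  | read g => exact Fin.pos g
  | write g => simp [Op.views]

theorem linearlyBounded_cControl {k : ℕ} (hk : 0 < k) (A : Pushdown (Op (Fin k))) :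
    LinearlyBounded 300 A ((cControl k).pushdown CMode.enc A) := by
  refine Control.linearlyBounded hk _ _ ?_ ?_ A
  · simp only [cControl, List.length_flatMap, List.length_cons, List.length_map,
      List.length_finRange, List.map_const', List.sum_replicate, Op.length_all, smul_eq_mul]
    nlinarith
  · intro o
    have := o.length_views_le
    simp only [cControl, List.length_flatMap, List.length_map, leaderMsgs, List.length_cons,
      List.length_nil, List.map_const', List.sum_replicate, smul_eq_mul]
    omega

theorem linearlyBounded_lControl {k : ℕ} (g : Fin k) (A : Pushdown (Op (Fin k))) :
    LinearlyBounded 300 A ((lControl g).pushdown LMode.enc A) := by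
  refine Control.linearlyBounded (Fin.pos g) _ _ ?_ ?_ A
  · have hk := Fin.pos g
    have h : ((Op.all k).map fun o => o.views.length + 1).sum ≤ (Op.all k).length • (k + 1) := by
      refine (List.sum_le_card_nsmul _ (k + 1) ?_).trans_eq (by simp)
      intro x hx
      obtain ⟨o, -, rfl⟩ := List.mem_map.1 hx
      exact Nat.succ_le_succ o.length_views_le
    simp only [lControl, List.length_append, List.length_flatMap, List.length_cons,
      List.length_map, List.length_finRange, List.map_const', List.sum_replicate, Op.length_all,
      smul_eq_mul] at h ⊢
    nlinarith
  · intro o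
    have := o.length_views_le
    simp only [lControl, List.length_flatMap, List.length_cons, List.length_nil, List.map_const',
      List.sum_replicate, smul_eq_mul]
    omega

end ParamSys

namespace ParamSys

/-! ### Primitive recursive functions -/

attribute [fun_prop] Primrec

namespace Code

section Primrec

variable {α β γ σ : Type} [Primcodable α] [Primcodable β] [Primcodable γ] [Primcodable σ]

@[fun_prop]
theorem primrec_id : Primrec (fun a : α => a) := Primrec.id

@[fun_prop]
theorem primrec_const (b : β) : Primrec (fun _ : α => b) := Primrec.const b

@[fun_prop]
theorem primrec_comp {f : β → σ} {g : α → β} (hf : Primrec f) (hg : Primrec g) :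
    Primrec (fun a => f (g a)) := hf.comp hg

@[fun_prop]
theorem primrec_fst {f : α → β × γ} (hf : Primrec f) : Primrec (fun a => (f a).1) :=
  Primrec.fst.comp hf

@[fun_prop]
theorem primrec_snd {f : α → β × γ} (hf : Primrec f) : Primrec (fun a => (f a).2) :=
  Primrec.snd.comp hf

@[fun_prop]
theorem primrec_pair {f : α → β} {g : α → γ} (hf : Primrec f) (hg : Primrec g) :
    Primrec (fun a => (f a, g a)) := hf.pair hg

@[fun_prop]
theorem primrec_add {f g : α → ℕ} (hf : Primrec f) (hg : Primrec g) :
    Primrec (fun a => f a + g a) := Primrec.nat_add.comp hf hg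

@[fun_prop]
theorem primrec_mul {f g : α → ℕ} (hf : Primrec f) (hg : Primrec g) :
    Primrec (fun a => f a * g a) := Primrec.nat_mul.comp hf hg

@[fun_prop]
theorem primrec_toNat {f : α → Bool} (hf : Primrec f) : Primrec (fun a => (f a).toNat) :=
  (Primrec.dom_finite Bool.toNat).comp hf

@[fun_prop]
theorem primrec_bif {c : α → Bool} {f g : α → σ} (hc : Primrec c) (hf : Primrec f)
    (hg : Primrec g) : Primrec (fun a => bif c a then f a else g a) := hc.cond hf hg

@[fun_prop]
theorem primrec_sumElim {f : α → β ⊕ γ} {g : α → β → σ} {h : α → γ → σ} (hf : Primrec f)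
    (hg : Primrec fun p : α × β => g p.1 p.2) (hh : Primrec fun p : α × γ => h p.1 p.2) :
    Primrec (fun a => Sum.elim (g a) (h a) (f a)) :=
  (Primrec.sumCasesOn hf hg hh).of_eq fun a => by cases f a <;> rfl

@[fun_prop]
theorem primrec_inr {f : α → γ} (hf : Primrec f) :
    Primrec (fun a => (Sum.inr (f a) : β ⊕ γ)) := Primrec.sumInr.comp hf

@[fun_prop]
theorem primrec_optionMap {f : α → Option β} {g : α → β → σ} (hf : Primrec f)
    (hg : Primrec fun p : α × β => g p.1 p.2) : Primrec (fun a => (f a).map (g a)) :=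
  Primrec.option_map hf hg

@[fun_prop]
theorem primrec_optionGetD {f : α → Option β} {g : α → β} (hf : Primrec f) (hg : Primrec g) :
    Primrec (fun a => (f a).getD (g a)) := Primrec.option_getD.comp hf hg

@[fun_prop]
theorem primrec_range {f : α → ℕ} (hf : Primrec f) : Primrec (fun a => List.range (f a)) :=
  Primrec.list_range.comp hf

@[fun_prop]
theorem primrec_cons {f : α → β} {g : α → List β} (hf : Primrec f) (hg : Primrec g) :
    Primrec (fun a => f a :: g a) := Primrec.list_cons.comp hf hg

@[fun_prop]
theorem primrec_append {f g : α → List β} (hf : Primrec f) (hg : Primrec g) :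
    Primrec (fun a => f a ++ g a) := Primrec.list_append.comp hf hg

@[fun_prop]
theorem primrec_reverse {f : α → List β} (hf : Primrec f) : Primrec (fun a => (f a).reverse) :=
  Primrec.list_reverse.comp hf

@[fun_prop]
theorem primrec_tail {f : α → List β} (hf : Primrec f) : Primrec (fun a => (f a).tail) :=
  Primrec.list_tail.comp hf

@[fun_prop]
theorem primrec_head? {f : α → List β} (hf : Primrec f) : Primrec (fun a => (f a).head?) :=
  Primrec.list_head?.comp hf

@[fun_prop]
theorem primrec_listGetD {f : α → List β} {g : α → ℕ} (d : β) (hf : Primrec f) (hg : Primrec g) :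
    Primrec (fun a => (f a).getD (g a) d) := (Primrec.list_getD d).comp hf hg

@[fun_prop]
theorem primrec_map {f : α → List β} {g : α → β → γ} (hf : Primrec f)
    (hg : Primrec fun p : α × β => g p.1 p.2) : Primrec (fun a => (f a).map (g a)) :=
  Primrec.list_map hf hg

@[fun_prop]
theorem primrec_flatMap {f : α → List β} {g : α → β → List γ} (hf : Primrec f)
    (hg : Primrec fun p : α × β => g p.1 p.2) : Primrec (fun a => (f a).flatMap (g a)) :=
  Primrec.list_flatMap hf hg

end Primrec

/-! ### The constructions on codes -/

/-- The code of `Op.all`. -/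
def ops (k : ℕ) : List (Bool × ℕ) :=
  (List.range k).map (fun g => (false, g)) ++ (List.range k).map fun g => (true, g)

/-- The code of `Op.views`. -/
def views (k : ℕ) (o : Bool × ℕ) : List ℕ := bif o.1 then List.range k else [o.2]

/-- The register value for the message `act`. -/
def act (k : ℕ) (a : Bool × Bool × ℕ) : ℕ := a.2.2 + k * (2 * a.1.toNat + a.2.1.toNat)

/-- The register value for the message `done`. -/
def done (k g : ℕ) : ℕ := g + k * 4

/-- The register value for the message `req`. -/
def req (k : ℕ) (o : Bool × ℕ) : ℕ := o.2 + k * (5 + o.1.toNat)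

/-- The number of the mode `pend` of a contributor. -/
def pend (k : ℕ) (o : Bool × ℕ) : ℕ := o.2 + (k * o.1.toNat + 1)

/-- The number of the mode `wait` of a contributor, and of the mode `ack` of the leader. -/
def wait (k : ℕ) (o : Bool × ℕ) : ℕ := o.2 + (k * (2 + o.1.toNat) + 1)

/-- The code of the local rules of the contributors. -/
def cLoc (k : ℕ) : List (ℕ × (Bool × ℕ) × ℕ) :=
  (ops k).flatMap fun o =>
    (pend k o, (true, req k o), wait k o) ::
    (wait k o, (false, act k (true, o)), 0) ::
    (List.range k).map fun g => (wait k o, (false, done k g), pend k o)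

/-- The code of the synchronizing rules of the contributors. The numbers `t < 5` are the tags of
the messages in `leaderMsgs`. -/
def cSync (k : ℕ) (o : Bool × ℕ) : List (ℕ × (Bool × ℕ) × ℕ) :=
  (views k o).flatMap fun g => (List.range 5).map fun t => (0, (false, g + k * t), pend k o)

/-- The code of the local rules of the leader. -/
def lLoc (k : ℕ) : List (ℕ × (Bool × ℕ) × ℕ) :=
  ((ops k).flatMap fun o =>
      (wait k o, (true, act k (true, o)), o.2 + 1) ::
      (views k o).map fun g => (g + 1, (false, req k o), wait k o)) ++
    (List.range k).flatMap fun g =>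
      (g + 1, (true, done k g), g + (k + 1)) ::
      (ops k).map fun o => (g + (k + 1), (false, req k o), 0)

/-- The code of the synchronizing rules of the leader. -/
def lSync (k : ℕ) (o : Bool × ℕ) : List (ℕ × (Bool × ℕ) × ℕ) :=
  (views k o).flatMap fun g =>
    [(g + 1, (true, act k (false, o)), o.2 + 1), (g + (k + 1), (true, act k (false, o)), 0)]

/-- The function `encStack` on codes. -/
def stack (n : ℕ) (w : List ℕ) : List ℕ :=
  w.reverse.tail.reverse ++ [(w.reverse.head?.map fun q => q + n).getD (2 * n)]

/-- The construction `Control.pushdown` on codes, for a control with `N` modes. -/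
def pushdown (N : ℕ) (loc : List (ℕ × (Bool × ℕ) × ℕ))
    (sync : Bool × ℕ → List (ℕ × (Bool × ℕ) × ℕ)) (m : ℕ) (A : PushdownCode) : PushdownCode :=
  (N * A.1, 2 * A.2.1 + 1,
    (loc.flatMap fun ρ => (List.range A.1).flatMap fun q => (List.range (2 * A.2.1 + 1)).map
      fun X => (q + A.1 * ρ.1, X, ρ.2.1, q + A.1 * ρ.2.2, [X])) ++
    (A.2.2.1.flatMap fun τ => (sync τ.2.2.1).flatMap fun ρ =>
      [(τ.1 + A.1 * ρ.1, τ.2.1, ρ.2.1, τ.2.2.2.1 + A.1 * ρ.2.2, τ.2.2.2.2),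
        (τ.1 + A.1 * ρ.1, τ.2.1 + A.2.1, ρ.2.1, τ.2.2.2.1 + A.1 * ρ.2.2,
          stack A.2.1 τ.2.2.2.2)]),
    A.2.2.2.1 + A.1 * m, A.2.2.2.2 + A.2.1)

/-- The construction `PushdownSys.transform` on codes. -/
def pushdownSys (k : ℕ) (A : PushdownCode × PushdownCode × ℕ) :
    PushdownCode × PushdownCode × ℕ :=
  (pushdown (4 * k + 1) (cLoc k) (cSync k) 0 A.1,
    pushdown (4 * k + 1) (lLoc k) (lSync k) (A.2.2 + 1) A.2.1, A.2.2 + k * 1)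

/-- The code of `silentOps`. -/
def silent (k : ℕ) : List (Bool × ℕ) :=
  (List.range (7 * k)).map (fun r => (false, r)) ++ (List.range k).map (fun g => (true, done k g)) ++
    (ops k).map fun o => (true, req k o)

/-- The construction `BuchiAut.transform` on codes. -/
def aut (k : ℕ) (B : ℕ × List (ℕ × (Bool × Bool × ℕ) × ℕ) × ℕ × List ℕ × List ℕ) :
    ℕ × List (ℕ × (Bool × ℕ) × ℕ) × ℕ × List ℕ × List ℕ :=
  (2 * B.1 + 1,
    (silent k).flatMap (fun b => (List.range B.1).flatMap fun q => [(q, b, q), (q + B.1, b, q)]) ++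
    (B.2.1.flatMap (fun τ => [(τ.1, (true, act k τ.2.1), τ.2.2 + B.1),
      (τ.1 + B.1, (true, act k τ.2.1), τ.2.2 + B.1)]) ++
    B.2.2.2.1.flatMap fun q => (List.range k).flatMap fun g =>
      [(q, (true, done k g), 2 * B.1), (q + B.1, (true, done k g), 2 * B.1)]),
    B.2.2.1, [2 * B.1], B.2.2.2.2.map fun q => q + B.1)

/-- The code of `LTL.anyOf`. -/
def anyOf (l : List (Bool × ℕ)) : List (ℕ ⊕ (Bool × ℕ)) :=
  l.flatMap (fun a => [.inl 1, .inl 2, .inl 1, .inr a, .inl 1]) ++ [.inl 1, .inl 0]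

/-- The code of `LTL.eventually`. -/
def eventually (c : List (ℕ ⊕ (Bool × ℕ))) : List (ℕ ⊕ (Bool × ℕ)) := .inl 4 :: .inl 0 :: c

/-- The code of `LTL.announce`. -/
def announce (k : ℕ) : List (ℕ ⊕ (Bool × ℕ)) :=
  anyOf ((ops k).map (fun o => (true, act k (false, o))) ++
    (ops k).map fun o => (true, act k (true, o)))

/-- The code of `LTL.ended`. -/
def ended (k : ℕ) : List (ℕ ⊕ (Bool × ℕ)) :=
  .inl 2 :: (anyOf ((List.range k).map fun g => (true, done k g)) ++ [.inl 1, .inl 3, .inl 0])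

/-- The code of `LTL.or`. -/
def or (c c' : List (ℕ ⊕ (Bool × ℕ))) : List (ℕ ⊕ (Bool × ℕ)) :=
  .inl 1 :: .inl 2 :: .inl 1 :: (c ++ .inl 1 :: c')

/-- The code of `LTL.wellFormed`. -/
def wellFormed (k : ℕ) : List (ℕ ⊕ (Bool × ℕ)) :=
  or (eventually (ended k)) (.inl 2 :: (eventually (announce k) ++
    .inl 1 :: eventually (.inl 1 :: eventually (.inl 3 :: announce k))))

/-- The code of `LTL.lift`, symbol by symbol. -/
def lift (k : ℕ) (c : List (ℕ ⊕ (Bool × Bool × ℕ))) : List (ℕ ⊕ (Bool × ℕ)) :=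
  c.flatMap fun x => Sum.elim
    (fun n => [eventually (announce k), .inl 2 :: (eventually (announce k) ++ [.inl 1]), [.inl 2],
      .inl 4 :: .inl 1 :: (announce k ++ .inl 2 :: (announce k ++ [.inl 3])), [.inl 4]].getD n [])
    (fun a => .inl 4 :: .inl 1 :: (announce k ++ [.inr (true, act k a)])) x

/-- The code of `LTL.onEmpty`, symbol by symbol. -/
def onEmpty (c : List (ℕ ⊕ (Bool × Bool × ℕ))) : List (ℕ ⊕ (Bool × ℕ)) :=
  c.flatMap fun x => Sum.elim
    (fun n => [[.inl 0], [.inl 1], [.inl 2], [.inl 2, .inl 1, .inl 0],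
      [.inl 2, .inl 1, .inl 0, .inl 2]].getD n [])
    (fun _ => [.inl 1, .inl 0]) x

/-- The construction `LTL.transform` on codes. -/
def ltl (k : ℕ) (c : List (ℕ ⊕ (Bool × Bool × ℕ))) : List (ℕ ⊕ (Bool × ℕ)) :=
  .inl 2 :: (wellFormed k ++
    or (lift k c) (.inl 2 :: .inl 1 :: (eventually (announce k) ++ onEmpty c)))

/-! ### Effectiveness -/

section Primrec

variable {α : Type} [Primcodable α]

@[fun_prop]
theorem primrec_ops {f : α → ℕ} (hf : Primrec f) : Primrec (fun a => ops (f a)) := by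
  unfold ops; fun_prop

@[fun_prop]
theorem primrec_announce {f : α → ℕ} (hf : Primrec f) : Primrec (fun a => announce (f a)) := by
  unfold announce anyOf act; fun_prop

theorem primrec_pushdownSys :
    Primrec (fun x : ℕ × PushdownCode × PushdownCode × ℕ => pushdownSys x.1 x.2) := by
  unfold pushdownSys pushdown cLoc cSync lLoc lSync stack views act done req pend wait
  fun_prop

theorem primrec_aut :
    Primrec (fun x : ℕ × ℕ × List (ℕ × (Bool × Bool × ℕ) × ℕ) × ℕ × List ℕ × List ℕ =>
      aut x.1 x.2) := by
  unfold aut silent act done req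
  fun_prop

theorem primrec_ltl :
    Primrec (fun x : ℕ × List (ℕ ⊕ (Bool × Bool × ℕ)) => ltl x.1 x.2) := by
  unfold ltl wellFormed or lift onEmpty eventually ended anyOf act done
  fun_prop

end Primrec

section Correctness

variable {k : ℕ}

theorem range_eq (n : ℕ) : List.range n = (List.finRange n).map fun i => i.val :=
  List.map_coe_finRange_eq_range.symm

theorem ops_eq : ops k = (Op.all k).map Op.code := by
  simp only [ops, Op.all, range_eq, List.map_append, List.map_map, Op.code, Function.comp_def]

theorem views_eq (o : Op (Fin k)) : views k o.code = o.views.map fun g => g.val := by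
  cases o with
  | read g => rfl
  | write g => exact range_eq k

theorem val_eq (o : Op (Fin k)) : o.val.val = o.code.2 := by
  cases o <;> rfl

theorem act_eq (a : Act (Fin k)) : (Msg.toFin (.act a)).val = act k a.code := by
  rcases a with (o | o) | (o | o) <;> rfl

theorem done_eq (g : Fin k) : (Msg.toFin (.done g)).val = done k g := rfl

theorem req_eq (o : Op (Fin k)) : (Msg.toFin (.req o)).val = req k o.code := by
  cases o <;> rfl

theorem withFlag_false_val {n : ℕ} (q : Fin n) : (withFlag false q).val = q := rfl

theorem withFlag_true_val {n : ℕ} (q : Fin n) : (withFlag true q).val = q + n := by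
  simp [withFlag]

theorem extra_val (n : ℕ) : (extra n).val = 2 * n := rfl

theorem pend_eq (o : Op (Fin k)) : (CMode.enc (.pend o)).val = pend k o.code := by
  cases o <;> simp [CMode.enc, pend, Op.code]

theorem wait_eq (o : Op (Fin k)) : (CMode.enc (.wait o)).val = wait k o.code := by
  cases o <;> simp [CMode.enc, wait, Op.code] <;> ring

theorem ack_eq (o : Op (Fin k)) : (LMode.enc (.ack o)).val = wait k o.code := by
  cases o <;> simp [LMode.enc, wait, Op.code] <;> ring

/-- The code of a rule. -/
def rule {μ : Type} {N : ℕ} (enc : μ → Fin N) (ρ : μ × Op (Fin (7 * k)) × μ) :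
    ℕ × (Bool × ℕ) × ℕ :=
  ((enc ρ.1).val, ρ.2.1.code, (enc ρ.2.2).val)

theorem read_code (r : Fin k) : (Op.read r).code = (false, r.val) := rfl

theorem write_code (r : Fin k) : (Op.write r).code = (true, r.val) := rfl

theorem cLoc_eq : cLoc k = (cControl k).loc.map (rule CMode.enc) := by
  simp only [cLoc, cControl, List.map_flatMap, ops_eq, List.flatMap_map, range_eq k, List.map_map,
    List.map_cons, rule, read_code, write_code, act_eq, done_eq, req_eq, pend_eq, wait_eq,
    Function.comp_def]
  rfl

theorem cSync_eq (o : Op (Fin k)) :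
    cSync k o.code = ((cControl k).sync o).map (rule CMode.enc) := by
  simp only [cSync, cControl, List.map_flatMap, views_eq, List.flatMap_map, List.map_map,
    Function.comp_def, rule, read_code, pend_eq]
  rfl

theorem lLoc_eq (g : Fin k) : lLoc k = (lControl g).loc.map (rule LMode.enc) := by
  simp only [lLoc, lControl, List.map_flatMap, ops_eq, views_eq, List.flatMap_map, range_eq k,
    List.map_map, List.map_cons, List.map_append, rule, read_code, write_code, act_eq, done_eq,
    req_eq, ack_eq, Function.comp_def]
  simp only [LMode.enc, val_eq]
  rfl

theorem lSync_eq (g : Fin k) (o : Op (Fin k)) :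
    lSync k o.code = ((lControl g).sync o).map (rule LMode.enc) := by
  simp only [lSync, lControl, List.map_flatMap, views_eq, List.flatMap_map, List.map_cons,
    List.map_nil, rule, write_code, act_eq, LMode.enc, val_eq]
  rfl

theorem stack_eq {n : ℕ} (w : List (Fin n)) :
    stack n (w.map Fin.val) = (encStack w).map Fin.val := by
  rw [stack, ← List.map_reverse, ← List.map_tail, List.tail_reverse, ← List.map_reverse,
    List.reverse_reverse, List.head?_map, List.head?_reverse, encStack, List.map_append,
    List.map_map]
  congr 2
  cases w.getLast? with
  | none => rfl
  | some q => exact (withFlag_true_val q).symm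

theorem pushdown_eq {μ : Type} {N : ℕ} (K : Control k μ) (enc : μ → Fin N)
    (A : Pushdown (Op (Fin k))) {loc : List (ℕ × (Bool × ℕ) × ℕ)}
    {sync : Bool × ℕ → List (ℕ × (Bool × ℕ) × ℕ)} (hloc : loc = K.loc.map (rule enc))
    (hsync : ∀ o, sync o.code = (K.sync o).map (rule enc)) :
    pushdown N loc sync (enc K.init) A.code = (K.pushdown enc A).code := by
  simp only [pushdown, Pushdown.code, Control.pushdown, Control.pushdownTrans, hloc,
    List.map_append, List.map_flatMap, List.flatMap_map, hsync, range_eq, List.map_map,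
    List.map_cons, List.map_nil, stack_eq, withFlag_true_val, Function.comp_def, rule]
  rfl

theorem aut_eq (B : BuchiAut (Act (Fin k))) :
    aut k (B.code Act.code) = B.transform.code Op.code := by
  simp only [aut, silent, BuchiAut.code, BuchiAut.transform, BuchiAut.transformTrans, silentOps,
    List.map_append, List.map_flatMap, List.flatMap_map, List.flatMap_append, range_eq,
    ops_eq, List.map_map, List.map_cons, List.map_nil, withFlag_false_val, withFlag_true_val,
    extra_val, read_code, write_code, act_eq, done_eq, req_eq, Function.comp_def]

theorem anyOf_eq (l : List (Op (Fin k))) :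
    anyOf (l.map Op.code) = (LTL.anyOf l).code Op.code := by
  induction l with
  | nil => rfl
  | cons a l ih =>
    rw [LTL.anyOf, LTL.or, LTL.code, LTL.code, LTL.code, LTL.code, LTL.code, ← ih]
    rfl

theorem announce_eq : announce k = (LTL.announce k).code Op.code := by
  rw [LTL.announce, ← anyOf_eq, announce]
  simp only [Act.all, ops_eq, List.map_append, List.map_map, Function.comp_def, write_code, act_eq]
  rfl

theorem ended_eq : ended k = (LTL.ended k).code Op.code := by
  rw [LTL.ended, LTL.code, ← anyOf_eq, ended]
  simp only [range_eq, List.map_map, Function.comp_def, write_code, done_eq]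
  rfl

theorem eventually_eq (φ : LTL (Op (Fin k))) :
    eventually (φ.code Op.code) = φ.eventually.code Op.code := rfl

theorem wellFormed_eq : wellFormed k = (LTL.wellFormed k).code Op.code := by
  simp only [wellFormed, announce_eq, ended_eq]
  rfl

theorem lift_eq (φ : LTL (Act (Fin k))) : lift k (φ.code Act.code) = φ.lift.code Op.code := by
  induction φ with
  | tt => simp [lift, LTL.code, LTL.lift, announce_eq, eventually_eq]
  | atom a => simp [lift, LTL.code, LTL.lift, announce_eq, act_eq, write_code]
  | neg φ ih =>
    rw [LTL.lift, LTL.code, LTL.code, LTL.code, ← ih, ← eventually_eq, ← announce_eq]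
    simp [lift]
  | conj φ ψ ih ih' =>
    rw [LTL.lift, LTL.code, LTL.code, ← ih, ← ih']
    simp [lift]
  | next φ ih =>
    rw [LTL.lift, LTL.code, LTL.code, LTL.code, LTL.code, LTL.code, ← ih, ← announce_eq]
    simp [lift]
  | _ φ ψ ih ih' =>
    rw [LTL.lift, LTL.code, LTL.code, ← ih, ← ih']
    simp [lift]

theorem onEmpty_eq (φ : LTL (Act (Fin k))) :
    onEmpty (φ.code Act.code) = (φ.onEmpty : LTL (Op (Fin (7 * k)))).code Op.code := by
  induction φ with
  | tt => rfl
  | atom a => rfl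
  | neg φ ih =>
    rw [LTL.onEmpty, LTL.code, LTL.code, ← ih]
    simp [onEmpty]
  | conj φ ψ ih ih' =>
    rw [LTL.onEmpty, LTL.code, LTL.code, ← ih, ← ih']
    simp [onEmpty]
  | next φ ih =>
    rw [LTL.onEmpty, LTL.code, LTL.code, ← ih]
    simp [onEmpty, LTL.code]
  | _ φ ψ ih ih' =>
    rw [LTL.onEmpty, LTL.code, LTL.code, LTL.code, LTL.code, ← ih, ← ih']
    simp [onEmpty, LTL.code]

theorem ltl_eq (φ : LTL (Act (Fin k))) : ltl k (φ.code Act.code) = φ.transform.code Op.code := by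
  simp only [ltl, wellFormed_eq, lift_eq, onEmpty_eq, announce_eq, eventually_eq]
  rfl

theorem pushdownSys_eq (A : PushdownSys k) : pushdownSys k A.code = A.transform.code := by
  refine Prod.ext ?_ (Prod.ext ?_ ?_)
  · exact pushdown_eq (cControl k) CMode.enc A.AC cLoc_eq cSync_eq
  · exact pushdown_eq (lControl A.ginit) LMode.enc A.AD (lLoc_eq A.ginit) (lSync_eq A.ginit)
  · rfl

end Correctness

end Code

theorem isEffective_buchiAut : IsEffective (fun k (B : BuchiAut (Act (Fin k))) => B.code Act.code)
    (fun k (B : BuchiAut (Op (Fin (7 * k)))) => B.code Op.code) fun _ => BuchiAut.transform :=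
  ⟨_, Code.primrec_aut.to_comp, fun _ => Code.aut_eq⟩

theorem isEffective_ltl : IsEffective (fun k (φ : LTL (Act (Fin k))) => φ.code Act.code)
    (fun k (φ : LTL (Op (Fin (7 * k)))) => φ.code Op.code) fun _ => LTL.transform :=
  ⟨_, Code.primrec_ltl.to_comp, fun _ => Code.ltl_eq⟩

theorem isEffective_pushdownSys : IsEffective (fun k (A : PushdownSys k) => A.code)
    (fun k (A : PushdownSys (7 * k)) => A.code) fun _ => PushdownSys.transform :=
  ⟨_, Code.primrec_pushdownSys.to_comp, fun _ => Code.pushdownSys_eq⟩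

end ParamSys

theorem theorem4 :
    ∃ (c : ℕ) (reg : ℕ → ℕ)
      (autT : ∀ k, BuchiAut (Act (Fin k)) → BuchiAut (Op (Fin (reg k))))
      (ltlT : ∀ k, LTL (Act (Fin k)) → LTL (Op (Fin (reg k))))
      (sysT : ∀ k, PushdownSys k → PushdownSys (reg k)),
      -- the number of register values
      (Computable reg ∧ ∀ k, 0 < k → reg k ≤ c * k) ∧
      -- automata and formulas for the new property: effective, and of linear size
      (IsEffective (fun _ B => B.code Act.code) (fun _ B => B.code Op.code) autT ∧
        ∀ k, 0 < k → ∀ B : BuchiAut (Act (Fin k)),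
          (autT k B).numStates ≤ c * B.numStates ∧ (autT k B).size ≤ c * k * B.size) ∧
      (IsEffective (fun _ φ => φ.code Act.code) (fun _ φ => φ.code Op.code) ltlT ∧
        ∀ k, 0 < k → ∀ φ : LTL (Act (Fin k)), (ltlT k φ).size ≤ c * k * φ.size) ∧
      -- arbitrary systems
      (∀ (k : ℕ) (S : Type u) (T : Type v) (sys : System (Fin k) S T),
        ∃ (S' : Type u) (T' : Type v) (sys' : System (Fin (reg k)) S' T'),
          Reduces (autT k) (ltlT k) sys sys') ∧
      -- pushdown systems: the new system is a pushdown system, effective, and of linear size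
      IsEffective (fun _ A => A.code) (fun _ A => A.code) sysT ∧
      ∀ (k : ℕ) (A : PushdownSys k),
        LinearlyBounded c A.AC (sysT k A).AC ∧ LinearlyBounded c A.AD (sysT k A).AD ∧
        Reduces (autT k) (ltlT k) A.toSystem (sysT k A).toSystem := by
  refine ⟨300, fun k => 7 * k, fun _ => BuchiAut.transform, fun _ => LTL.transform,
    fun _ => PushdownSys.transform, ⟨?_, fun k _ => by dsimp only; omega⟩,
    ⟨isEffective_buchiAut, fun k hk B => ⟨?_, ?_⟩⟩,
    ⟨isEffective_ltl, fun k hk φ => LTL.size_transform_le hk φ⟩,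
    fun k S T sys => ⟨_, _, protocol sys, reduces_protocol sys⟩,
    isEffective_pushdownSys, fun k A => ⟨linearlyBounded_cControl (Fin.pos A.ginit) A.AC,
      linearlyBounded_lControl A.ginit A.AD, reduces_pushdownSys A⟩⟩
  · exact (Primrec.nat_mul.comp (Primrec.const 7) Primrec.id).to_comp
  · have hQ : 0 < B.numStates := Fin.pos B.init
    change 2 * B.numStates + 1 ≤ _
    omega
  · exact (BuchiAut.transform_size_le hk).trans
      (Nat.mul_le_mul_right _ (Nat.mul_le_mul_right _ (by norm_num)))
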